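/- **Covariance of absolute log-returns.** Let $D^X,D^Y\in(0,1/2]$, $\sigma^X,\sigma^Y>0$, $\rho\in[-1,1]$ and $\lambda_1,\lambda_2,\lambda_3\ge 0$ with $\lambda^X:=\lambda_1+\lambda_2>0$ and $\lambda^Y:=\lambda_1+\lambda_3>0$. Let $\mathcal T^1,\mathcal T^2,\mathcal T^3$ be independent Poisson point processes on $\mathbb R$ with rates $\lambda_1,\lambda_2,\lambda_3$, and put $\mathcal T^X=\mathcal T^1\cup\mathcal T^2$ and $\mathcal T^Y=\mathcal T^1\cup\mathcal T^3$. Let $W^X,\tilde W$ be independent standard Brownian motions, put $W^Y=\rho W^X+\sqrt{1-\rho^2}\,\tilde W$, and suppose that $(W^X,W^Y)$ is independent of $(\mathcal T^X,\mathcal T^Y)$. For $Z\in\{X,Y\}$ write $\mathcal T^Z=(\tau^Z_n)_{n\in\mathbb Z}$ in increasing order with $\tau^Z_0<0<\tau^Z_1$, let $i^Z(t)=\#(\mathcal T^Z\cap(0,t])$ and $$I^Z_t=(\sigma^Z)^2\Big[(t-\tau^Z_{i^Z(t)})^{2D^Z}+\sum_{k=1}^{i^Z(t)}(\tau^Z_k-\tau^Z_{k-1})^{2D^Z}-(-\tau^Z_0)^{2D^Z}\Big],\qquad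 t\ge 0,$$ and define $X_t=W^X_{I^X_t}$, $Y_t=W^Y_{I^Y_t}$. Let $\xi_r=|X_{r+h}-X_r|$ and $\eta_r=|Y_{r+h}-Y_r|$ for $r\ge 0$, $h>0$. Let $t\ge s\ge 0$. If $\rho\ne0$, suppose moreover that $t>s$, and that $(\sigma^X)^2s\neq(\sigma^Y)^2t$ in case $D^X=D^Y=1/2$. Then the random variables $\xi_r,\eta_r$ ($r\ge0$, $h>0$), $(-\tau^X_0)^{D^X-1/2}$ and $(t-s-\tau^Y_0)^{D^Y-1/2}$ are square-integrable, and $$\lim_{h\downarrow 0}\frac{\operatorname{Cov}(\xi_s,\eta_t)}{h}=\lim_{h\downarrow 0}\frac{\operatorname{Cov}(\xi_0,\eta_{t-s})}{h}=\frac{4\,\sigma^X\sigma^Y\sqrt{D^XD^Y}}{\pi}\,\operatorname{Cov}\Big((-\tau^X_0)^{D^X-1/2},\,(t-s-\tau^Y_0)^{D^Y-1/2}\Big)\,e^{-\lambda^Y(t-s)},$$ both limits existing. -/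

import Mathlib

open MeasureTheory ProbabilityTheory Filter Topology Set
open scoped NNReal

/-- The number of points of the random set `T` that fall in `B`. -/
noncomputable def pointCount {Ω : Type*} (T : Ω → Set ℝ) (B : Set ℝ) (ω : Ω) : ℕ :=
  (T ω ∩ B).ncard

/-- The σ-algebra on `Ω` generated by the random set `T`, that is, by its point counts on bounded
Borel sets. -/
@[reducible]
noncomputable def pointSigma {Ω : Type*} (T : Ω → Set ℝ) : MeasurableSpace Ω :=
  ⨆ B ∈ {B : Set ℝ | MeasurableSet B ∧ Bornology.IsBounded B},
    MeasurableSpace.comap (pointCount T B) ⊤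

/-- `T` is a Poisson point process on `ℝ` of rate `r` (`r = 0` being the degenerate process):
a random locally finite set whose point counts on bounded Borel sets are random variables, are
Poisson distributed with mean `r` times the Lebesgue measure of the set, and are independent
for disjoint sets. -/
structure IsPoissonPointProcess {Ω : Type*} [MeasurableSpace Ω] (T : Ω → Set ℝ) (r : ℝ≥0)
    (P : Measure Ω) : Prop where
  locallyFinite : ∀ ω, ∀ B : Set ℝ, Bornology.IsBounded B → (T ω ∩ B).Finite
  measurable : ∀ B : Set ℝ, MeasurableSet B → Bornology.IsBounded B → Measurable (pointCount T B)
  hasLaw : ∀ B : Set ℝ, MeasurableSet B → Bornology.IsBounded B →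
    HasLaw (pointCount T B) (poissonMeasure (r * (volume B).toNNReal)) P
  indep : ∀ (n : ℕ) (B : Fin n → Set ℝ), (∀ i, MeasurableSet (B i)) →
    (∀ i, Bornology.IsBounded (B i)) → Pairwise (Function.onFun Disjoint B) →
    iIndepFun (fun i => pointCount T (B i)) P

/-- The points `τ₀ < 0 < τ₁ < τ₂ < ⋯` of a set `S`: `τ₀` is the last negative point, `τ₁` the first
positive one, and `τ₂, τ₃, …` the following ones (points before `τ₀` are never used). -/
noncomputable def shock (S : Set ℝ) : ℕ → ℝ
  | 0 => sSup (S ∩ Iio 0)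
  | 1 => sInf (S ∩ Ioi 0)
  | n + 2 => sInf (S ∩ Ioi (shock S (n + 1)))

/-- `i(t)`, the number of points of `S` in `(0, t]`. -/
noncomputable def shockIndex (S : Set ℝ) (t : ℝ) : ℕ := (S ∩ Ioc 0 t).ncard

/-- The time change
`I_t = σ² [(t - τ_{i(t)})^{2D} + ∑_{k=1}^{i(t)} (τ_k - τ_{k-1})^{2D} - (-τ_0)^{2D}]`. -/
noncomputable def timeChange (D σ : ℝ) (S : Set ℝ) (t : ℝ) : ℝ :=
  σ ^ 2 * ((t - shock S (shockIndex S t)) ^ (2 * D)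
    + ∑ k ∈ Finset.Icc 1 (shockIndex S t), (shock S k - shock S (k - 1)) ^ (2 * D)
    - (-shock S 0) ^ (2 * D))

/-- The process `X_t = W_{I_t}` built from the process `W` and the random set of shocks `T`. -/
noncomputable def timeChangedProcess {Ω : Type*} (W : ℝ≥0 → Ω → ℝ) (D σ : ℝ) (T : Ω → Set ℝ)
    (t : ℝ) (ω : Ω) : ℝ :=
  W (timeChange D σ (T ω) t).toNNReal ω

/-- The absolute log-return `|X_{t+h} - X_t|` of a process `X`. -/
def absReturn {Ω : Type*} (X : ℝ → Ω → ℝ) (h t : ℝ) (ω : Ω) : ℝ := |X (t + h) ω - X t ω|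

/-- The Brownian motion `ρ W + √(1 - ρ²) W'` built from `W` and `W'`. -/
noncomputable def correlated {Ω : Type*} (ρ : ℝ) (W W' : ℝ≥0 → Ω → ℝ) (t : ℝ≥0) (ω : Ω) : ℝ :=
  ρ * W t ω + √(1 - ρ ^ 2) * W' t ω

/-- The bivariate model. `T 0, T 1, T 2` are the independent Poisson processes `T¹, T², T³`, of
rates `l 0, l 1, l 2`; the shocks of the two assets are `T¹ ∪ T²` and `T¹ ∪ T³`, both of positive
rate; the two driving Brownian motions are `WX` and `ρ WX + √(1 - ρ²) W'`, with `WX, W'`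
independent, and this pair is independent of the pair of shock processes. -/
structure IsBivariateModel {Ω : Type*} [MeasurableSpace Ω] (P : Measure Ω)
    (T : Fin 3 → Ω → Set ℝ) (TX TY : Ω → Set ℝ) (l : Fin 3 → ℝ≥0)
    (WX W' WY : ℝ≥0 → Ω → ℝ) (ρ DX DY σX σY : ℝ) : Prop where
  poisson : ∀ i, IsPoissonPointProcess (T i) (l i) P
  poisson_indep : iIndep (fun i => pointSigma (T i)) P
  shocks_X : TX = fun ω => T 0 ω ∪ T 1 ω
  shocks_Y : TY = fun ω => T 0 ω ∪ T 2 ω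
  rate_X : 0 < l 0 + l 1
  rate_Y : 0 < l 0 + l 2
  measurable_X : ∀ t, Measurable (WX t)
  measurable_W' : ∀ t, Measurable (W' t)
  brownian_X : IsBrownianReal WX P
  brownian_W' : IsBrownianReal W' P
  brownian_indep : IndepFun (fun ω t => WX t ω) (fun ω t => W' t ω) P
  brownian_Y : WY = correlated ρ WX W'
  indep : Indep (MeasurableSpace.comap (fun ω (t : ℝ≥0) => (WX t ω, WY t ω)) inferInstance)
    (pointSigma TX ⊔ pointSigma TY) P
  corr : ρ ∈ Icc (-1) 1
  exponent_X : DX ∈ Ioc 0 (1 / 2)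
  exponent_Y : DY ∈ Ioc 0 (1 / 2)
  scale_X : 0 < σX
  scale_Y : 0 < σY

/-! Condition on the shocks. The increments of `X` over `[s, s+h]` and of `Y` over `[t, t+h]` become
Brownian increments over the operational intervals `[I^X_s, I^X_{s+h}]` and `[I^Y_t, I^Y_{t+h}]`, of
lengths `δ` and `ε`. Each is centred Gaussian with absolute mean `√(2/π)` times the root of its
length. If `ρ = 0` or the intervals do not overlap, the increments are conditionally independent and
the conditional mean of the product of absolute values is `(2/π) √δ √ε`.

As `h ↓ 0`, `δ / h` tends to `2D σ²` times the power `2D - 1` of the age, the time elapsed since the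
last shock before `s`; likewise for `ε`. Hence `Cov / h` tends to `2/π` times the covariance of the
square roots of the slopes, which are `σ √(2D) age^(D - 1/2)`
(`IsBivariateModel.tendsto_covariance_absReturn_div`). Two points need care.

Passing to the limit under the integral: without a shock in `(s, s+h]`, concavity bounds `δ / h` by
the slope, integrable because the age has density at most the rate near `0`. With shocks, `δ / h`
may be as large as a multiple of `N h^(2D-1)`, where `N` is the number of shocks; its mean is of
order `h^(2D)` and vanishes. `tendsto_integral_of_le_add` is the matching form of dominated
convergence.

Non-overlap: the operational intervals shrink to `I^X_s` and `I^Y_t`, so these must differ almost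
surely (`IsPoissonPair.ae_timeChange_ne`). By stationarity the probability of equality is unchanged
when both shock sets are shifted by `r`. For small `r > 0` the difference of the shifted time
changes is a real analytic function of `r` with power singularities at generic negative points, so
it is not identically zero and its zeros do not accumulate at `0`. The indicators of equality thus
tend to `0` along `r → 0`, and so does their constant mean. If both exponents are `1/2` the time
changes are deterministic and the hypothesis excludes equality.

Finally, stationarity moves the covariance of ages to the instants `0` and `u = t - s`. If `Y` has
no shock in `[0, u)`, its last shock before `u` is its last one before `0`; otherwise its age at `u`
depends only on the shocks after `0`, which are independent of the past. Only the first event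
contributes, and its probability is the exponential factor (`IsPoissonPair.covariance_age_decay`).
-/

/-! ### Locally finite sets and the enumeration of shocks. -/

/-- A set of reals with finitely many points in every bounded set. -/
def LocFin (S : Set ℝ) : Prop := ∀ B : Set ℝ, Bornology.IsBounded B → (S ∩ B).Finite

/-- The last point of `S` before `x`. -/
noncomputable def lastPoint (S : Set ℝ) (x : ℝ) : ℝ := sSup (S ∩ Iio x)

/-- A locally finite set that has negative points and does not contain the origin. -/
structure IsShockSet (S : Set ℝ) : Prop where
  locFin : LocFin S
  nonempty : (S ∩ Iio 0).Nonempty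
  zero_notMem : (0 : ℝ) ∉ S

theorem LocFin.exists_isGreatest {S A : Set ℝ} (hS : LocFin S) (hA : BddAbove A)
    (hne : (S ∩ A).Nonempty) : ∃ p, IsGreatest (S ∩ A) p := by
  obtain ⟨y, hyS, hyA⟩ := hne
  have hfin : (S ∩ (A ∩ Ici y)).Finite := by
    apply hS
    obtain ⟨b, hb⟩ := hA
    exact (Metric.isBounded_Icc y b).subset fun z hz => ⟨hz.2, hb hz.1⟩
  obtain ⟨p, hp, hmax⟩ := hfin.exists_maximalFor id _ ⟨y, hyS, hyA, le_refl y⟩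
  refine ⟨p, ⟨hp.1, hp.2.1⟩, fun z hz => ?_⟩
  by_contra! hlt
  have := hmax (j := z) ⟨hz.1, hz.2, hp.2.2.trans hlt.le⟩ hlt.le
  exact absurd this (not_le.2 hlt)

theorem LocFin.exists_isLeast {S A : Set ℝ} (hS : LocFin S) (hA : BddBelow A)
    (hne : (S ∩ A).Nonempty) : ∃ p, IsLeast (S ∩ A) p := by
  obtain ⟨y, hyS, hyA⟩ := hne
  have hfin : (S ∩ (A ∩ Iic y)).Finite := by
    apply hS
    obtain ⟨b, hb⟩ := hA
    exact (Metric.isBounded_Icc b y).subset fun z hz => ⟨hb hz.1, hz.2⟩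
  obtain ⟨p, hp, hmin⟩ := hfin.exists_minimalFor id _ ⟨y, hyS, hyA, le_refl y⟩
  refine ⟨p, ⟨hp.1, hp.2.1⟩, fun z hz => ?_⟩
  by_contra! hlt
  have := hmin (j := z) ⟨hz.1, hz.2, hlt.le.trans hp.2.2⟩ hlt.le
  exact absurd this (not_le.2 hlt)

theorem LocFin.inter {S : Set ℝ} (hS : LocFin S) (A : Set ℝ) : LocFin (S ∩ A) := fun B hB =>
  (hS B hB).subset fun _ hx => ⟨hx.1.1, hx.2⟩

theorem LocFin.union {S S' : Set ℝ} (hS : LocFin S) (hS' : LocFin S') : LocFin (S ∪ S') :=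
  fun B hB => by rw [union_inter_distrib_right]; exact (hS B hB).union (hS' B hB)

theorem LocFin.preimage_add {S : Set ℝ} (hS : LocFin S) (r : ℝ) :
    LocFin ((fun x => r + x) ⁻¹' S) := fun B hB => by
  have h : ((fun x => r + x) '' (((fun x => r + x) ⁻¹' S) ∩ B)).Finite := by
    refine (hS ((fun x => r + x) '' B) ?_).subset ?_
    · exact ((isometry_add_left r).lipschitz).isBounded_image hB
    · rintro _ ⟨x, ⟨hx, hxB⟩, rfl⟩
      exact ⟨hx, x, hxB, rfl⟩
  exact h.of_finite_image (add_right_injective r).injOn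

theorem shockIndex_eq_of_empty {S : Set ℝ} {r r' : ℝ} (hr : 0 ≤ r) (hrr : r ≤ r')
    (h : S ∩ Ioc r r' = ∅) : shockIndex S r' = shockIndex S r := by
  unfold shockIndex
  rw [← Ioc_union_Ioc_eq_Ioc hr hrr, inter_union_distrib_left, h, union_empty]

theorem LocFin.shockIndex_of_mem {S : Set ℝ} (hS : LocFin S) {r r' : ℝ} (hr : 0 ≤ r) (hrr : r < r')
    (h : S ∩ Ioo r r' = ∅) (hmem : r' ∈ S) : shockIndex S r' = shockIndex S r + 1 := by
  have key : S ∩ Ioc 0 r' = insert r' (S ∩ Ioc 0 r) := by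
    ext x
    constructor
    · rintro ⟨hx, h0, h1⟩
      rcases lt_or_ge r x with hx' | hx'
      · rcases h1.lt_or_eq with h2 | rfl
        · exact absurd (show x ∈ S ∩ Ioo r r' from ⟨hx, hx', h2⟩) (by simp [h])
        · exact mem_insert _ _
      · exact mem_insert_of_mem _ ⟨hx, h0, hx'⟩
    · rintro (rfl | ⟨hx, h0, h1⟩)
      · exact ⟨hmem, hr.trans_lt hrr, le_rfl⟩
      · exact ⟨hx, h0, h1.trans hrr.le⟩
  unfold shockIndex
  rw [key, ncard_insert_of_notMem _ (hS _ (Metric.isBounded_Ioc 0 r))]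
  exact fun hx => absurd hx.2.2 (not_le.2 hrr)

namespace IsShockSet

variable {S : Set ℝ}

theorem isGreatest_shock_zero (hS : IsShockSet S) : IsGreatest (S ∩ Iio 0) (shock S 0) := by
  obtain ⟨p, hp⟩ := hS.locFin.exists_isGreatest bddAbove_Iio hS.nonempty
  have : shock S 0 = p := hp.csSup_eq
  rwa [this]

/-- The recursion restarts at the origin: `shock S 1` is the first point after `0`, not after `shock
S 0`. The two alternatives for `p` make the step uniform in `n`. -/
theorem shock_succ_eq {n : ℕ} {p q : ℝ}
    (hn : (n = 0 ∧ p = 0) ∨ (1 ≤ n ∧ p = shock S n)) (hq : IsLeast (S ∩ Ioi p) q) :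
    shock S (n + 1) = q := by
  rcases hn with ⟨rfl, rfl⟩ | ⟨hn, rfl⟩
  · exact hq.csInf_eq
  · obtain ⟨m, rfl⟩ : ∃ m, n = m + 1 := ⟨n - 1, by omega⟩
    exact hq.csInf_eq

/-- Links the recursive enumeration with the order of the line, so that later arguments need only
the last point up to `t`. Induction on the number of points in `(0, t]`: the greatest of them is the
successor of the point preceding it, or of the origin if that point is negative. -/
theorem isGreatest_shock (hS : IsShockSet S) {t : ℝ} (ht : 0 ≤ t) :
    IsGreatest (S ∩ Iic t) (shock S (shockIndex S t)) := by
  induction hn : shockIndex S t generalizing t with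
  | zero =>
    have hfin := hS.locFin _ (Metric.isBounded_Ioc 0 t)
    have he : S ∩ Ioc 0 t = ∅ := (ncard_eq_zero hfin).1 hn
    have : S ∩ Iic t = S ∩ Iio 0 := by
      ext x
      constructor
      · rintro ⟨hx, hxt⟩
        refine ⟨hx, ?_⟩
        by_contra! h0
        rcases (not_lt.1 (show ¬ x < 0 from h0)).lt_or_eq with h | h
        · exact absurd (show x ∈ S ∩ Ioc 0 t from ⟨hx, h, hxt⟩) (by simp [he])
        · exact hS.zero_notMem (h ▸ hx)
      · rintro ⟨hx, hx0⟩
        exact ⟨hx, hx0.le.trans ht⟩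
    rw [this]
    exact hS.isGreatest_shock_zero
  | succ n ih =>
    have hne : (S ∩ Ioc 0 t).Nonempty := by
      apply nonempty_of_ncard_ne_zero
      change shockIndex S t ≠ 0
      omega
    obtain ⟨p, hp⟩ := hS.locFin.exists_isGreatest bddAbove_Ioc hne
    have hp0 : 0 < p := hp.1.2.1
    obtain ⟨r, hr⟩ := hS.locFin.exists_isGreatest (A := Iio p) bddAbove_Iio
      (hS.nonempty.mono fun x hx => ⟨hx.1, hx.2.trans hp0⟩)
    have hrp : r < p := hr.1.2
    have htp : shockIndex S t = shockIndex S p := by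
      apply shockIndex_eq_of_empty hp0.le hp.1.2.2
      by_contra! h
      obtain ⟨x, hx, hx1, hx2⟩ := h
      exact absurd (hp.2 ⟨hx, hp0.trans hx1, hx2⟩) (not_le.2 hx1)
    have hgap : ∀ x, r < x → S ∩ Ioo x p = ∅ := by
      intro x hx
      by_contra! h
      obtain ⟨y, hy, hy1, hy2⟩ := h
      exact absurd (hr.2 ⟨hy, hy2⟩) (not_le.2 (hx.trans hy1))
    have hgap' : S ∩ Ioo r p = ∅ := by
      by_contra! h
      obtain ⟨y, hy, hy1, hy2⟩ := h
      exact absurd (hr.2 ⟨hy, hy2⟩) (not_le.2 hy1)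
    have hpt : IsGreatest (S ∩ Iic t) p :=
      ⟨⟨hp.1.1, hp.1.2.2⟩, fun x hx => by
        rcases le_or_gt x 0 with h | h
        · exact h.trans hp0.le
        · exact hp.2 ⟨hx.1, h, hx.2⟩⟩
    suffices shock S (n + 1) = p by rwa [this]
    rcases lt_or_ge r 0 with hr0 | hr0
    · have h1 := hS.locFin.shockIndex_of_mem le_rfl hp0 (hgap 0 hr0) hp.1.1
      have h0 : shockIndex S 0 = 0 := by simp [shockIndex]
      have hn0 : n = 0 := by omega
      refine shock_succ_eq (p := 0) (Or.inl ⟨hn0, rfl⟩) ⟨⟨hp.1.1, hp0⟩, fun x hx => ?_⟩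
      by_contra! hlt
      exact absurd (show x ∈ S ∩ Ioo 0 p from ⟨hx.1, hx.2, hlt⟩) (by simp [hgap 0 hr0])
    · have hr0' : 0 < r := lt_of_le_of_ne hr0 fun h => hS.zero_notMem (h ▸ hr.1.1)
      have h1 := hS.locFin.shockIndex_of_mem hr0 hrp hgap' hp.1.1
      have hrn : shockIndex S r = n := by omega
      have hn1 : 1 ≤ n := by
        rw [← hrn]
        apply Nat.one_le_iff_ne_zero.2
        have hfin := hS.locFin _ (Metric.isBounded_Ioc 0 r)
        exact ((ncard_pos hfin).2 ⟨r, hr.1.1, hr0', le_rfl⟩).ne'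
      have h2 := ih hr0 hrn
      have h3 : r = shock S n := by
        refine le_antisymm (h2.2 ⟨hr.1.1, self_mem_Iic⟩) h2.1.2
      refine shock_succ_eq (Or.inr ⟨hn1, h3⟩) ⟨⟨hp.1.1, hrp⟩, fun x hx => ?_⟩
      by_contra! hlt
      exact absurd (show x ∈ S ∩ Ioo r p from ⟨hx.1, hx.2, hlt⟩) (by simp [hgap'])

/-- Between shocks only the current age term moves. This local formula, combined with induction
along the shocks, replaces the explicit sum everywhere below. -/
theorem timeChange_sub_of_empty (hS : IsShockSet S) {D : ℝ} (hD : 0 < D) (σ : ℝ) {r r' τ : ℝ}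
    (hr : 0 ≤ r) (hrr : r ≤ r') (h : S ∩ Ioo r r' = ∅) (hτ : IsGreatest (S ∩ Iic r) τ) :
    timeChange D σ S r' - timeChange D σ S r
      = σ ^ 2 * ((r' - τ) ^ (2 * D) - (r - τ) ^ (2 * D)) := by
  have hτ' : shock S (shockIndex S r) = τ := (hS.isGreatest_shock hr).unique hτ
  rcases hrr.eq_or_lt with rfl | hlt
  · simp
  -- If `r'` is itself a shock, the index jumps by one: the sum gains the completed term `(r' -
  -- τ)^(2D)` and the new age term is `0^(2D) = 0`, which is where `0 < D` enters.
  by_cases hmem : r' ∈ S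
  · have hn := hS.locFin.shockIndex_of_mem hr hlt h hmem
    have h2 : shock S (shockIndex S r') = r' :=
      (hS.isGreatest_shock (hr.trans hrr)).unique ⟨⟨hmem, self_mem_Iic⟩, fun x hx => hx.2⟩
    have h3 : Finset.Icc 1 (shockIndex S r + 1)
        = insert (shockIndex S r + 1) (Finset.Icc 1 (shockIndex S r)) := by
      ext x; simp; omega
    unfold timeChange
    rw [h2, hn, h3, Finset.sum_insert (by simp), Nat.add_sub_cancel, ← hn, h2, hτ', sub_self,
      Real.zero_rpow (by positivity)]
    ring
  · have hn : shockIndex S r' = shockIndex S r := by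
      apply shockIndex_eq_of_empty hr hrr
      rw [← Ioo_union_right hlt, inter_union_distrib_left, h, empty_union]
      ext x
      simp only [mem_inter_iff, mem_singleton_iff, mem_empty_iff_false, iff_false, not_and]
      rintro hx rfl
      exact hmem hx
    unfold timeChange
    rw [hn, hτ']
    ring

theorem timeChange_zero (S : Set ℝ) (D σ : ℝ) : timeChange D σ S 0 = 0 := by
  have h0 : shockIndex S 0 = 0 := by simp [shockIndex]
  simp [timeChange, h0]

end IsShockSet

/-- Induction along the points of a locally finite set. -/
theorem LocFin.induction {S : Set ℝ} (hS : LocFin S) {p : ℝ → Prop} {r : ℝ} (h0 : p r)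
    (hstep : ∀ x y, r ≤ x → x ≤ y → S ∩ Ioo x y = ∅ → (x = r ∨ x ∈ S) → p x → p y) :
    ∀ y, r ≤ y → p y := by
  intro y hy
  induction hn : (S ∩ Ioo r y).ncard using Nat.strong_induction_on generalizing y with
  | _ n ih =>
    have hfin : ∀ z, (S ∩ Ioo r z).Finite := fun z => hS _ (Metric.isBounded_Ioo r z)
    rcases (S ∩ Ioo r y).eq_empty_or_nonempty with he | hne
    · exact hstep r y le_rfl hy he (Or.inl rfl) h0
    · obtain ⟨q, hq⟩ := hS.exists_isGreatest bddAbove_Ioo hne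
      refine hstep q y hq.1.2.1.le hq.1.2.2.le ?_ (Or.inr hq.1.1) ?_
      · by_contra! h
        obtain ⟨x, hx, hx1, hx2⟩ := h
        exact absurd (hq.2 ⟨hx, hq.1.2.1.trans hx1, hx2⟩) (not_le.2 hx1)
      · refine ih _ ?_ q hq.1.2.1.le rfl
        rw [← hn]
        apply ncard_lt_ncard _ (hfin y)
        refine ⟨fun x hx => ⟨hx.1, hx.2.1, hx.2.2.trans hq.1.2.2⟩, fun h => ?_⟩
        exact lt_irrefl _ (h hq.1).2.2

theorem LocFin.isGreatest_lastPoint {S : Set ℝ} (hS : LocFin S) {x : ℝ}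
    (hne : (S ∩ Iio x).Nonempty) : IsGreatest (S ∩ Iio x) (lastPoint S x) := by
  obtain ⟨p, hp⟩ := hS.exists_isGreatest bddAbove_Iio hne
  have : lastPoint S x = p := hp.csSup_eq
  rwa [this]

theorem isGreatest_Iic_of_notMem {S : Set ℝ} {x p : ℝ} (hx : x ∉ S)
    (h : IsGreatest (S ∩ Iio x) p) : IsGreatest (S ∩ Iic x) p :=
  ⟨⟨h.1.1, (show p < x from h.1.2).le⟩, fun y hy => h.2
    ⟨hy.1, lt_of_le_of_ne (show y ≤ x from hy.2) (by rintro rfl; exact hx hy.1)⟩⟩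

theorem rpow_add_sub_rpow_le_rpow {p x h : ℝ} (hp : 0 < p) (hp1 : p ≤ 1) (hx : 0 ≤ x)
    (hh : 0 ≤ h) : (x + h) ^ p - x ^ p ≤ h ^ p := by
  have := Real.rpow_add_le_add_rpow hx hh hp.le hp1
  linarith

/-- A concave function lies below its tangent at `x`; this is Bernoulli's inequality after factoring
out `x ^ p`. -/
theorem rpow_add_sub_rpow_le_mul {p x h : ℝ} (hp : 0 < p) (hp1 : p ≤ 1) (hx : 0 < x)
    (hh : 0 ≤ h) : (x + h) ^ p - x ^ p ≤ p * h * x ^ (p - 1) := by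
  have h1 : (1 + h / x) ^ p ≤ 1 + p * (h / x) :=
    rpow_one_add_le_one_add_mul_self (le_trans (by norm_num) (div_nonneg hh hx.le)) hp.le hp1
  have h2 : x + h = x * (1 + h / x) := by field_simp
  have h3 : x ^ (p - 1) = x ^ p / x := by rw [Real.rpow_sub_one hx.ne']
  rw [h2, Real.mul_rpow hx.le (by positivity), h3]
  have h4 : x ^ p * (1 + h / x) ^ p ≤ x ^ p * (1 + p * (h / x)) :=
    mul_le_mul_of_nonneg_left h1 (by positivity)
  have h5 : p * h * (x ^ p / x) = x ^ p * (p * (h / x)) := by ring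
  rw [h5]
  linarith

theorem LocFin.eventually_empty {S : Set ℝ} (hS : LocFin S) (r : ℝ) :
    ∀ᶠ h in 𝓝[>] (0 : ℝ), S ∩ Ioc r (r + h) = ∅ := by
  rcases (S ∩ Ioi r).eq_empty_or_nonempty with he | hne
  · refine Eventually.of_forall fun h => ?_
    by_contra! hx
    obtain ⟨x, hx, hx1, -⟩ := hx
    exact absurd (show x ∈ S ∩ Ioi r from ⟨hx, hx1⟩) (by simp [he])
  · obtain ⟨q, hq⟩ := hS.exists_isLeast bddBelow_Ioi hne
    have hqr : 0 < q - r := sub_pos.2 hq.1.2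
    filter_upwards [Ioo_mem_nhdsGT hqr] with h hh
    by_contra! hx
    obtain ⟨x, hx, hx1, hx2⟩ := hx
    have := hq.2 ⟨hx, hx1⟩
    linarith [hh.2]

/-! ### Increments of the time change along a fixed shock set. -/

namespace IsShockSet

variable {S : Set ℝ}

theorem exists_isGreatest_Iic (hS : IsShockSet S) {x : ℝ} (hx : 0 ≤ x) :
    ∃ p, IsGreatest (S ∩ Iic x) p :=
  ⟨_, hS.isGreatest_shock hx⟩

theorem isGreatest_lastPoint (hS : IsShockSet S) {x : ℝ} (hx : 0 ≤ x) :
    IsGreatest (S ∩ Iio x) (lastPoint S x) :=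
  hS.locFin.isGreatest_lastPoint (hS.nonempty.mono fun _ hy => ⟨hy.1, hy.2.trans_le hx⟩)

theorem timeChange_lt (hS : IsShockSet S) {D σ : ℝ} (hD : 0 < D) (hσ : 0 < σ) {r r' : ℝ}
    (hr : 0 ≤ r) (hrr : r < r') : timeChange D σ S r < timeChange D σ S r' := by
  have key : ∀ y, r ≤ y → r < y → timeChange D σ S r < timeChange D σ S y := by
    refine hS.locFin.induction (fun h => absurd h (lt_irrefl _)) ?_
    intro x y hrx hxy he hx ih hry
    obtain ⟨τ, hτ⟩ := hS.exists_isGreatest_Iic (hr.trans hrx)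
    have h1 := hS.timeChange_sub_of_empty hD σ (hr.trans hrx) hxy he hτ
    have h2 : 0 ≤ x - τ := sub_nonneg.2 hτ.1.2
    rcases hxy.eq_or_lt with rfl | hlt
    · exact ih hry
    have h3 : 0 < (y - τ) ^ (2 * D) - (x - τ) ^ (2 * D) :=
      sub_pos.2 (Real.rpow_lt_rpow h2 (by linarith) (by positivity))
    have h4 : timeChange D σ S x < timeChange D σ S y := by
      rw [← sub_pos, h1]; positivity
    rcases hrx.eq_or_lt with rfl | h5
    · exact h4
    · exact (ih h5).trans h4
  exact key r' hrr.le hrr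

theorem timeChange_le (hS : IsShockSet S) {D σ : ℝ} (hD : 0 < D) (hσ : 0 < σ) {r r' : ℝ}
    (hr : 0 ≤ r) (hrr : r ≤ r') : timeChange D σ S r ≤ timeChange D σ S r' := by
  rcases hrr.eq_or_lt with rfl | h
  · exact le_rfl
  · exact (hS.timeChange_lt hD hσ hr h).le

theorem timeChange_nonneg (hS : IsShockSet S) {D σ : ℝ} (hD : 0 < D) (hσ : 0 < σ) {r : ℝ}
    (hr : 0 ≤ r) : 0 ≤ timeChange D σ S r := by
  rw [← timeChange_zero S D σ]
  exact hS.timeChange_le hD hσ le_rfl hr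

/-- The shocks cut the interval into at most one more piece than their number, and subadditivity of
the power `2D ≤ 1` bounds each contribution by `h ^ (2D)`. -/
theorem timeChange_sub_le_card (hS : IsShockSet S) {D : ℝ} (hD : 0 < D) (hD2 : D ≤ 1 / 2)
    (σ : ℝ) {r h : ℝ} (hr : 0 ≤ r) (hh : 0 ≤ h) :
    timeChange D σ S (r + h) - timeChange D σ S r
      ≤ σ ^ 2 * (((S ∩ Ioc r (r + h)).ncard + 1) * h ^ (2 * D)) := by
  have hfin : ∀ z, (S ∩ Ioo r z).Finite := fun z => hS.locFin _ (Metric.isBounded_Ioo r z)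
  have key : ∀ y, r ≤ y → y ≤ r + h → timeChange D σ S y - timeChange D σ S r
      ≤ σ ^ 2 * (((S ∩ Ioo r y).ncard + 1) * h ^ (2 * D)) := by
    refine hS.locFin.induction (fun _ => by rw [sub_self]; positivity) ?_
    intro x y hrx hxy he hx ih hy
    have hx0 := hr.trans hrx
    obtain ⟨τ, hτ⟩ := hS.exists_isGreatest_Iic hx0
    have h1 := hS.timeChange_sub_of_empty hD σ hx0 hxy he hτ
    have h2 : 0 ≤ x - τ := sub_nonneg.2 hτ.1.2
    have h3 := rpow_add_sub_rpow_le_rpow (p := 2 * D) (by positivity) (by linarith) h2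
      (sub_nonneg.2 hxy)
    have h4 : (y - x) ^ (2 * D) ≤ h ^ (2 * D) :=
      Real.rpow_le_rpow (sub_nonneg.2 hxy) (by linarith) (by positivity)
    have h5 : timeChange D σ S y - timeChange D σ S x ≤ σ ^ 2 * h ^ (2 * D) := by
      rw [h1]
      apply mul_le_mul_of_nonneg_left _ (sq_nonneg σ)
      rw [show y - τ = (x - τ) + (y - x) by ring]
      exact h3.trans h4
    rcases hrx.eq_or_lt with rfl | hlt
    · refine h5.trans ?_
      apply mul_le_mul_of_nonneg_left _ (sq_nonneg σ)
      have : (0 : ℝ) ≤ (S ∩ Ioo r y).ncard * h ^ (2 * D) := by positivity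
      linarith
    · have hxS : x ∈ S := hx.resolve_left hlt.ne'
      rcases hxy.eq_or_lt with rfl | hxy'
      · exact ih hy
      have h6 : (S ∩ Ioo r x).ncard + 1 ≤ (S ∩ Ioo r y).ncard := by
        apply Nat.succ_le_of_lt
        apply ncard_lt_ncard _ (hfin y)
        refine ⟨fun z hz => ⟨hz.1, hz.2.1, hz.2.2.trans hxy'⟩, fun h => ?_⟩
        exact lt_irrefl _ (h (show x ∈ S ∩ Ioo r y from ⟨hxS, hlt, hxy'⟩)).2.2
      have h7 : ((S ∩ Ioo r x).ncard : ℝ) + 1 ≤ (S ∩ Ioo r y).ncard := by exact_mod_cast h6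
      have h8 := ih (hxy.trans hy)
      have h9 : σ ^ 2 * ((((S ∩ Ioo r x).ncard : ℝ) + 1) * h ^ (2 * D))
          ≤ σ ^ 2 * ((S ∩ Ioo r y).ncard * h ^ (2 * D)) := by gcongr
      linarith
  refine (key (r + h) (by linarith) le_rfl).trans ?_
  gcongr
  · exact hS.locFin _ (Metric.isBounded_Ioc _ _)
  · exact Ioo_subset_Ioc_self

theorem timeChange_sub_of_empty_Ioc (hS : IsShockSet S) {D : ℝ} (hD : 0 < D) (σ : ℝ) {r h : ℝ}
    (hr : 0 ≤ r) (hrS : r ∉ S) (hh : 0 ≤ h) (he : S ∩ Ioc r (r + h) = ∅) :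
    timeChange D σ S (r + h) - timeChange D σ S r
      = σ ^ 2 * ((r + h - lastPoint S r) ^ (2 * D) - (r - lastPoint S r) ^ (2 * D)) := by
  apply hS.timeChange_sub_of_empty hD σ hr (by linarith) _
    (isGreatest_Iic_of_notMem hrS (hS.isGreatest_lastPoint hr))
  exact subset_empty_iff.1 (he ▸ inter_subset_inter_right _ Ioo_subset_Ioc_self)

theorem timeChange_sub_le_of_empty (hS : IsShockSet S) {D : ℝ} (hD : 0 < D) (hD2 : D ≤ 1 / 2)
    (σ : ℝ) {r h : ℝ} (hr : 0 ≤ r) (hrS : r ∉ S) (hh : 0 ≤ h) (he : S ∩ Ioc r (r + h) = ∅) :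
    timeChange D σ S (r + h) - timeChange D σ S r
      ≤ σ ^ 2 * (2 * D * h * (r - lastPoint S r) ^ (2 * D - 1)) := by
  rw [hS.timeChange_sub_of_empty_Ioc hD σ hr hrS hh he]
  apply mul_le_mul_of_nonneg_left _ (sq_nonneg σ)
  rw [show r + h - lastPoint S r = (r - lastPoint S r) + h by ring]
  exact rpow_add_sub_rpow_le_mul (by positivity) (by linarith)
    (sub_pos.2 (hS.isGreatest_lastPoint hr).1.2) hh

/-- Just after `r` there are no shocks, so the increment is that of a single power of the age and
the limit is its derivative. -/
theorem tendsto_timeChange_sub_div (hS : IsShockSet S) {D : ℝ} (hD : 0 < D)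
    (σ : ℝ) {r : ℝ} (hr : 0 ≤ r) (hrS : r ∉ S) :
    Tendsto (fun h => (timeChange D σ S (r + h) - timeChange D σ S r) / h) (𝓝[>] 0)
      (𝓝 (σ ^ 2 * (2 * D * (r - lastPoint S r) ^ (2 * D - 1)))) := by
  have hpos : 0 < r - lastPoint S r := sub_pos.2 (hS.isGreatest_lastPoint hr).1.2
  have hd : HasDerivAt (fun x : ℝ => x ^ (2 * D))
      (2 * D * (r - lastPoint S r) ^ (2 * D - 1)) (r - lastPoint S r) :=
    Real.hasDerivAt_rpow_const (Or.inl hpos.ne')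
  have h1 := (hasDerivAt_iff_tendsto_slope_zero.1 hd).mono_left
    (nhdsWithin_mono 0 (fun x (hx : 0 < x) => hx.ne') : 𝓝[>] (0 : ℝ) ≤ 𝓝[≠] 0)
  refine (h1.const_mul (σ ^ 2)).congr' ?_
  filter_upwards [hS.locFin.eventually_empty r, self_mem_nhdsWithin] with h he hh
  rw [hS.timeChange_sub_of_empty_Ioc hD σ hr hrS (le_of_lt hh) he]
  simp only [smul_eq_mul]
  rw [show r + h - lastPoint S r = (r - lastPoint S r) + h by ring]
  field_simp

theorem tendsto_timeChange_right (hS : IsShockSet S) {D : ℝ} (hD : 0 < D)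
    (σ : ℝ) {r : ℝ} (hr : 0 ≤ r) (hrS : r ∉ S) :
    Tendsto (fun h => timeChange D σ S (r + h)) (𝓝[>] 0) (𝓝 (timeChange D σ S r)) := by
  have h1 := hS.tendsto_timeChange_sub_div hD σ hr hrS
  have h2 : Tendsto (fun h : ℝ => h) (𝓝[>] 0) (𝓝 0) := tendsto_nhdsWithin_of_tendsto_nhds tendsto_id
  have h3 := (h1.mul h2).add_const (timeChange D σ S r)
  simp only [mul_zero, zero_add] at h3
  refine h3.congr' ?_
  filter_upwards [self_mem_nhdsWithin] with h hh
  rw [div_mul_cancel₀ _ (ne_of_gt hh)]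
  ring

/-- Increments depend only on the shocks as seen from `r`. This lets stationarity of the shocks act
on the time change. -/
theorem timeChange_preimage_add (hS : IsShockSet S) {D : ℝ} (hD : 0 < D) (σ : ℝ) {r : ℝ}
    (hr : 0 ≤ r) (hS' : IsShockSet ((fun x => r + x) ⁻¹' S)) {u : ℝ} (hu : 0 ≤ u) :
    timeChange D σ ((fun x => r + x) ⁻¹' S) u
      = timeChange D σ S (r + u) - timeChange D σ S r := by
  have key : ∀ y, r ≤ y → timeChange D σ ((fun x => r + x) ⁻¹' S) (y - r)
      = timeChange D σ S y - timeChange D σ S r := by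
    refine hS.locFin.induction (by simp [timeChange_zero]) ?_
    intro x y hrx hxy he _ ih
    obtain ⟨τ, hτ⟩ := hS.exists_isGreatest_Iic (hr.trans hrx)
    have h1 := hS.timeChange_sub_of_empty hD σ (hr.trans hrx) hxy he hτ
    have hτ' : IsGreatest (((fun x => r + x) ⁻¹' S) ∩ Iic (x - r)) (τ - r) := by
      refine ⟨⟨by simpa using hτ.1.1, sub_le_sub_right hτ.1.2 r⟩, fun z hz => ?_⟩
      have := hτ.2 ⟨hz.1, show r + z ≤ x by linarith [show z ≤ x - r from hz.2]⟩
      linarith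
    have he' : ((fun x => r + x) ⁻¹' S) ∩ Ioo (x - r) (y - r) = ∅ := by
      by_contra! h
      obtain ⟨z, hz, hz1, hz2⟩ := h
      have : r + z ∈ S ∩ Ioo x y := ⟨hz, by linarith, by linarith⟩
      simp [he] at this
    have h2 := hS'.timeChange_sub_of_empty hD σ (sub_nonneg.2 hrx)
      (sub_le_sub_right hxy r) he' hτ'
    rw [show y - r - (τ - r) = y - τ by ring, show x - r - (τ - r) = x - τ by ring, ← h1] at h2
    linarith
  simpa using key (r + u) (by linarith)

theorem timeChange_half (hS : IsShockSet S) (σ : ℝ) {t : ℝ} (ht : 0 ≤ t) :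
    timeChange (1 / 2) σ S t = σ ^ 2 * t := by
  refine hS.locFin.induction (p := fun t => timeChange (1 / 2) σ S t = σ ^ 2 * t)
    (by simp [timeChange_zero]) ?_ t ht
  intro x y hx hxy he _ ih
  obtain ⟨τ, hτ⟩ := hS.exists_isGreatest_Iic hx
  have h1 := hS.timeChange_sub_of_empty (D := 1 / 2) (by norm_num) σ hx hxy he hτ
  norm_num at h1 ih ⊢
  rw [ih] at h1
  linarith

end IsShockSet

/-! ### Measurability derived from avoidance events. -/

/-- A random locally finite set whose avoidance events are measurable. -/
structure IsRandomSet {α : Type*} [MeasurableSpace α] (T : α → Set ℝ) : Prop where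
  locFin : ∀ ω, LocFin (T ω)
  measurableSet_avoid : ∀ B : Set ℝ, MeasurableSet B → Bornology.IsBounded B →
    MeasurableSet {ω | T ω ∩ B = ∅}

namespace IsRandomSet

variable {α : Type*} [MeasurableSpace α] {T T' : α → Set ℝ}

theorem measurableSet_empty (hT : IsRandomSet T) {B : Set ℝ} (hB : MeasurableSet B) :
    MeasurableSet {ω | T ω ∩ B = ∅} := by
  have : {ω | T ω ∩ B = ∅} = ⋂ n : ℕ, {ω | T ω ∩ (B ∩ Icc (-(n : ℝ)) n) = ∅} := by
    ext ω
    simp only [mem_ofPred_eq, mem_iInter]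
    constructor
    · intro h n
      rw [← inter_assoc, h, empty_inter]
    · intro h
      by_contra! hne
      obtain ⟨x, hx, hxB⟩ := hne
      obtain ⟨n, hn⟩ := exists_nat_ge |x|
      have : x ∈ T ω ∩ (B ∩ Icc (-(n : ℝ)) n) := ⟨hx, hxB, abs_le.1 hn⟩
      simp [h n] at this
  rw [this]
  exact MeasurableSet.iInter fun n => hT.measurableSet_avoid _ (hB.inter measurableSet_Icc)
    ((Metric.isBounded_Icc _ _).subset inter_subset_right)

theorem measurableSet_nonempty (hT : IsRandomSet T) {B : Set ℝ} (hB : MeasurableSet B) :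
    MeasurableSet {ω | (T ω ∩ B).Nonempty} := by
  have : {ω | (T ω ∩ B).Nonempty} = {ω | T ω ∩ B = ∅}ᶜ := by
    ext ω; simp [nonempty_iff_ne_empty]
  rw [this]
  exact (hT.measurableSet_empty hB).compl

theorem inter (hT : IsRandomSet T) {A : Set ℝ} (hA : MeasurableSet A) :
    IsRandomSet fun ω => T ω ∩ A where
  locFin ω := (hT.locFin ω).inter A
  measurableSet_avoid B hB _ := by
    simp_rw [inter_assoc]
    exact hT.measurableSet_empty (hA.inter hB)

theorem union (hT : IsRandomSet T) (hT' : IsRandomSet T') :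
    IsRandomSet fun ω => T ω ∪ T' ω where
  locFin ω := (hT.locFin ω).union (hT'.locFin ω)
  measurableSet_avoid B hB _ := by
    simp_rw [union_inter_distrib_right, union_empty_iff]
    exact (hT.measurableSet_empty hB).inter (hT'.measurableSet_empty hB)

theorem preimage_add_inter_eq_empty_iff {S B : Set ℝ} {r : ℝ} :
    ((fun x => r + x) ⁻¹' S) ∩ B = ∅ ↔ S ∩ (fun x => -r + x) ⁻¹' B = ∅ := by
  simp only [eq_empty_iff_forall_notMem, mem_inter_iff, mem_preimage, not_and]
  constructor
  · intro h x hx hxB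
    exact h (-r + x) (by simpa using hx) hxB
  · intro h x hx hxB
    exact h (r + x) hx (by simpa using hxB)

theorem preimage_add (hT : IsRandomSet T) (r : ℝ) :
    IsRandomSet fun ω => (fun x => r + x) ⁻¹' (T ω) where
  locFin ω := (hT.locFin ω).preimage_add r
  measurableSet_avoid B hB _ := by
    simp_rw [preimage_add_inter_eq_empty_iff]
    exact hT.measurableSet_empty (hB.preimage (measurable_const_add _))

theorem measurable_lastPoint (hT : IsRandomSet T) (x : ℝ) :
    Measurable fun ω => lastPoint (T ω) x := by
  refine measurable_of_Ioi fun y => ?_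
  have : (fun ω => lastPoint (T ω) x) ⁻¹' Ioi y
      -- The second piece accounts for the default value `sSup ∅ = 0`.
      = ({ω | (T ω ∩ Iio x).Nonempty} ∩ {ω | (T ω ∩ Ioo y x).Nonempty}) ∪
        ({ω | T ω ∩ Iio x = ∅} ∩ {_ω | y < 0}) := by
    ext ω
    rcases (T ω ∩ Iio x).eq_empty_or_nonempty with he | hne
    · simp [lastPoint, he]
    · have hb : BddAbove (T ω ∩ Iio x) := bddAbove_Iio.mono inter_subset_right
      simp only [lastPoint, mem_preimage, mem_Ioi, lt_csSup_iff hb hne, mem_union, mem_inter_iff,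
        mem_ofPred_eq, hne, true_and, hne.ne_empty, false_and, or_false]
      exact ⟨fun ⟨z, hz, hyz⟩ => ⟨z, hz.1, hyz, hz.2⟩, fun ⟨z, hz, hyz, hzx⟩ => ⟨z, ⟨hz, hzx⟩, hyz⟩⟩
  rw [this]
  exact ((hT.measurableSet_nonempty measurableSet_Iio).inter
    (hT.measurableSet_nonempty measurableSet_Ioo)).union
    ((hT.measurableSet_empty measurableSet_Iio).inter (MeasurableSet.const _))

/-- The starting point is random, so a rational `q` is inserted between `f ω` and the next point;
avoidance events then involve only deterministic intervals. -/
theorem measurable_sInf_Ioi (hT : IsRandomSet T) {f : α → ℝ} (hf : Measurable f) :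
    Measurable fun ω => sInf (T ω ∩ Ioi (f ω)) := by
  have hN : MeasurableSet {ω | (T ω ∩ Ioi (f ω)).Nonempty} := by
    have : {ω | (T ω ∩ Ioi (f ω)).Nonempty}
        = ⋃ q : ℚ, {ω | f ω < q} ∩ {ω | (T ω ∩ Ici (q : ℝ)).Nonempty} := by
      ext ω
      simp only [mem_ofPred_eq, mem_iUnion, mem_inter_iff]
      constructor
      · rintro ⟨z, hz, hfz⟩
        obtain ⟨q, hq, hqz⟩ := exists_rat_btwn (show f ω < z from hfz)
        exact ⟨q, hq, z, hz, hqz.le⟩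
      · rintro ⟨q, hq, z, hz, hqz⟩
        exact ⟨z, hz, hq.trans_le hqz⟩
    rw [this]
    exact MeasurableSet.iUnion fun q => (measurableSet_lt hf measurable_const).inter
      (hT.measurableSet_nonempty measurableSet_Ici)
  refine measurable_of_Iio fun y => ?_
  have : (fun ω => sInf (T ω ∩ Ioi (f ω))) ⁻¹' Iio y
      = ({ω | (T ω ∩ Ioi (f ω)).Nonempty} ∩
          ⋃ q : ℚ, {ω | f ω < q} ∩ {ω | (T ω ∩ Ico (q : ℝ) y).Nonempty}) ∪
        ({ω | (T ω ∩ Ioi (f ω)).Nonempty}ᶜ ∩ {_ω | 0 < y}) := by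
    ext ω
    rcases (T ω ∩ Ioi (f ω)).eq_empty_or_nonempty with he | hne
    · simp [he]
    · have hb : BddBelow (T ω ∩ Ioi (f ω)) := bddBelow_Ioi.mono inter_subset_right
      simp only [mem_preimage, mem_Iio, csInf_lt_iff hb hne, mem_union, mem_inter_iff,
        mem_ofPred_eq, hne, true_and, mem_compl_iff, not_true_eq_false, false_and, or_false,
        mem_iUnion]
      constructor
      · rintro ⟨z, ⟨hz, hfz⟩, hzy⟩
        obtain ⟨q, hq, hqz⟩ := exists_rat_btwn (show f ω < z from hfz)
        exact ⟨q, hq, z, hz, hqz.le, hzy⟩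
      · rintro ⟨q, hq, z, hz, hqz, hzy⟩
        exact ⟨z, ⟨hz, hq.trans_le hqz⟩, hzy⟩
  rw [this]
  exact (hN.inter (MeasurableSet.iUnion fun q => (measurableSet_lt hf measurable_const).inter
      (hT.measurableSet_nonempty measurableSet_Ico))).union
    (hN.compl.inter (MeasurableSet.const _))

theorem measurable_shock (hT : IsRandomSet T) : ∀ n, Measurable fun ω => shock (T ω) n
  | 0 => hT.measurable_lastPoint 0
  | 1 => hT.measurable_sInf_Ioi measurable_const
  | n + 2 => hT.measurable_sInf_Ioi (hT.measurable_shock (n + 1))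

/-- There are `k + 1` points in `(0, t]` exactly when some rational `q` has `k` points in `(0, q]`
and a further one in `(q, t]`. Counts are thus recovered from avoidance events alone. -/
theorem measurableSet_le_shockIndex (hT : IsRandomSet T) (k : ℕ) (t : ℝ) :
    MeasurableSet {ω | k ≤ shockIndex (T ω) t} := by
  induction k generalizing t with
  | zero => simp
  | succ k ih =>
    have : {ω | k + 1 ≤ shockIndex (T ω) t}
        = ⋃ q : ℚ, {_ω | (0 : ℝ) ≤ q ∧ (q : ℝ) ≤ t} ∩
          ({ω | k ≤ shockIndex (T ω) q} ∩ {ω | (T ω ∩ Ioc (q : ℝ) t).Nonempty}) := by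
      ext ω
      have hS := hT.locFin ω
      simp only [mem_ofPred_eq, mem_iUnion, mem_inter_iff]
      constructor
      · intro hk
        have hne : (T ω ∩ Ioc 0 t).Nonempty := by
          apply nonempty_of_ncard_ne_zero
          change shockIndex (T ω) t ≠ 0
          omega
        obtain ⟨p, hp⟩ := hS.exists_isGreatest bddAbove_Ioc hne
        obtain ⟨a, ha0, hap, ha⟩ : ∃ a, 0 ≤ a ∧ a < p ∧ T ω ∩ Ioo a p = ∅ := by
          rcases (T ω ∩ Ioo 0 p).eq_empty_or_nonempty with he | hne'
          · exact ⟨0, le_rfl, hp.1.2.1, he⟩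
          · obtain ⟨a, ha⟩ := hS.exists_isGreatest bddAbove_Ioo hne'
            refine ⟨a, ha.1.2.1.le, ha.1.2.2, ?_⟩
            by_contra! h
            obtain ⟨x, hx, hx1, hx2⟩ := h
            exact absurd (ha.2 ⟨hx, ha.1.2.1.trans hx1, hx2⟩) (not_le.2 hx1)
        obtain ⟨q, haq, hqp⟩ := exists_rat_btwn hap
        have h1 : shockIndex (T ω) p = shockIndex (T ω) q + 1 :=
          hS.shockIndex_of_mem (ha0.trans haq.le) hqp (subset_empty_iff.1
            (ha ▸ inter_subset_inter_right _ (Ioo_subset_Ioo_left haq.le))) hp.1.1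
        have h2 : shockIndex (T ω) t = shockIndex (T ω) p := by
          apply shockIndex_eq_of_empty hp.1.2.1.le hp.1.2.2
          by_contra! h
          obtain ⟨x, hx, hx1, hx2⟩ := h
          exact absurd (hp.2 ⟨hx, hp.1.2.1.trans hx1, hx2⟩) (not_le.2 hx1)
        exact ⟨q, ⟨ha0.trans haq.le, hqp.le.trans hp.1.2.2⟩, by omega, p, hp.1.1, hqp, hp.1.2.2⟩
      · rintro ⟨q, ⟨hq0, hqt⟩, hk, hne⟩
        have hfin := fun a b => hS _ (Metric.isBounded_Ioc a b)
        have h1 : shockIndex (T ω) t = shockIndex (T ω) q + (T ω ∩ Ioc (q : ℝ) t).ncard := by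
          unfold shockIndex
          rw [← Ioc_union_Ioc_eq_Ioc hq0 hqt, inter_union_distrib_left]
          refine ncard_union_eq ?_ (hfin _ _) (hfin _ _)
          exact (Ioc_disjoint_Ioc_of_le le_rfl).mono inter_subset_right inter_subset_right
        have h2 := (ncard_pos (hfin q t)).2 hne
        omega
    rw [this]
    exact MeasurableSet.iUnion fun q => (MeasurableSet.const _).inter
      ((ih q).inter (hT.measurableSet_nonempty measurableSet_Ioc))

theorem measurable_shockIndex (hT : IsRandomSet T) (t : ℝ) :
    Measurable fun ω => shockIndex (T ω) t :=
  measurable_of_Ici fun k => hT.measurableSet_le_shockIndex k t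

theorem measurable_timeChange (hT : IsRandomSet T) (D σ t : ℝ) :
    Measurable fun ω => timeChange D σ (T ω) t := by
  -- The number of summands is random but has countably many values, so measurability can be checked
  -- with the index held fixed.
  have key : ∀ (s : ℕ → α → ℝ) (N : α → ℕ), (∀ n, Measurable (s n)) → Measurable N →
      Measurable fun ω => σ ^ 2 * ((t - s (N ω) ω) ^ (2 * D)
        + ∑ k ∈ Finset.Icc 1 (N ω), (s k ω - s (k - 1) ω) ^ (2 * D)
        - (-s 0 ω) ^ (2 * D)) := by
    intro s N hs hN
    have h : Measurable fun p : ℕ × α => σ ^ 2 * ((t - s p.1 p.2) ^ (2 * D)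
        + ∑ k ∈ Finset.Icc 1 p.1, (s k p.2 - s (k - 1) p.2) ^ (2 * D)
        - (-s 0 p.2) ^ (2 * D)) := by
      refine measurable_from_prod_countable_right fun n => ?_
      dsimp only
      fun_prop
    exact h.comp (hN.prodMk measurable_id)
  exact key (fun n ω => shock (T ω) n) _ hT.measurable_shock (hT.measurable_shockIndex t)

end IsRandomSet

/-! ### Laws of pairs of random sets. -/

/-- Pairs of locally finite sets. -/
structure ShockPair where
  fst : Set ℝ
  snd : Set ℝ
  locFin_fst : LocFin fst
  locFin_snd : LocFin snd

/-- The pairs avoiding `B` and `B'` respectively. -/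
def voidEvent (B B' : Set ℝ) : Set ShockPair := {p | p.fst ∩ B = ∅ ∧ p.snd ∩ B' = ∅}

/-- The avoidance events of bounded Borel sets. -/
def voidEvents : Set (Set ShockPair) :=
  {A | ∃ B B' : Set ℝ, MeasurableSet B ∧ Bornology.IsBounded B ∧ MeasurableSet B' ∧
    Bornology.IsBounded B' ∧ voidEvent B B' = A}

instance : MeasurableSpace ShockPair := MeasurableSpace.generateFrom voidEvents

/-- Avoiding two sets means avoiding their union. Hence avoidance probabilities determine the joint
law of a pair, and independence can be tested on them. -/
theorem isPiSystem_voidEvents : IsPiSystem voidEvents := by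
  rintro _ ⟨B, B', hB, hb, hB', hb', rfl⟩ _ ⟨C, C', hC, hc, hC', hc', rfl⟩ _
  refine ⟨B ∪ C, B' ∪ C', hB.union hC, hb.union hc, hB'.union hC', hb'.union hc', ?_⟩
  ext p
  simp only [voidEvent, mem_ofPred_eq, mem_inter_iff, inter_union_distrib_left, union_empty_iff]
  tauto

theorem isRandomSet_fst : IsRandomSet fun p : ShockPair => p.fst where
  locFin p := p.locFin_fst
  measurableSet_avoid B hB hb := MeasurableSpace.measurableSet_generateFrom
    ⟨B, ∅, hB, hb, .empty, Bornology.isBounded_empty, by simp [voidEvent]⟩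

theorem isRandomSet_snd : IsRandomSet fun p : ShockPair => p.snd where
  locFin p := p.locFin_snd
  measurableSet_avoid B hB hb := MeasurableSpace.measurableSet_generateFrom
    ⟨∅, B, .empty, Bornology.isBounded_empty, hB, hb, by simp [voidEvent]⟩

/-- The random pair built from two random sets. -/
def toPair {α : Type*} [MeasurableSpace α] {T T' : α → Set ℝ} (hT : IsRandomSet T)
    (hT' : IsRandomSet T') (ω : α) : ShockPair :=
  ⟨T ω, T' ω, hT.locFin ω, hT'.locFin ω⟩

theorem measurable_toPair {α : Type*} [MeasurableSpace α] {T T' : α → Set ℝ}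
    (hT : IsRandomSet T) (hT' : IsRandomSet T') : Measurable (toPair hT hT') := by
  refine measurable_generateFrom ?_
  rintro _ ⟨B, B', hB, hb, hB', hb', rfl⟩
  exact (hT.measurableSet_avoid B hB hb).inter (hT'.measurableSet_avoid B' hB' hb')

/-- The σ-algebra `m` is left free so that functionals of the shocks are measurable for the
σ-algebra the shocks generate, the one assumed independent of the Brownian motions. -/
theorem isRandomSet_of_pointSigma_le {α : Type*} {T : α → Set ℝ} (hT : ∀ ω, LocFin (T ω))
    {m : MeasurableSpace α} (hm : pointSigma T ≤ m) : IsRandomSet T where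
  locFin := hT
  measurableSet_avoid B hB hb := by
    apply hm
    have h1 : MeasurableSpace.comap (pointCount T B) ⊤ ≤ pointSigma T :=
      le_iSup₂_of_le B ⟨hB, hb⟩ le_rfl
    apply h1
    refine ⟨{0}, trivial, ?_⟩
    ext ω
    simp [pointCount, ncard_eq_zero (hT ω B hb)]

/-! ### Poisson sets: avoidance, ages and generic gaps. -/

section

/-- A random set with the avoidance probabilities of a Poisson process of rate `r`. -/
structure IsPoissonSet {Ω : Type*} [MeasurableSpace Ω] (T : Ω → Set ℝ) (r : ℝ≥0)
    (P : Measure Ω) : Prop where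
  random : IsRandomSet T
  avoid : ∀ B : Set ℝ, MeasurableSet B → Bornology.IsBounded B →
    P.real {ω | T ω ∩ B = ∅} = Real.exp (-(r * volume.real B))

/-- A pair of random sets with the avoidance probabilities of `(T⁰ ∪ T¹, T⁰ ∪ T²)`, where
`T⁰, T¹, T²` are independent Poisson processes of rates `a, b, c`. -/
structure IsPoissonPair {Ω : Type*} [MeasurableSpace Ω] (T T' : Ω → Set ℝ) (a b c : ℝ≥0)
    (P : Measure Ω) : Prop where
  left : IsRandomSet T
  right : IsRandomSet T'
  avoid : ∀ B B' : Set ℝ, MeasurableSet B → Bornology.IsBounded B → MeasurableSet B' →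
    Bornology.IsBounded B' → P.real {ω | T ω ∩ B = ∅ ∧ T' ω ∩ B' = ∅}
      = Real.exp (-(a * volume.real (B ∪ B') + b * volume.real B + c * volume.real B'))

variable {Ω : Type*} [MeasurableSpace Ω] {P : Measure Ω}

theorem IsPoissonPointProcess.isRandomSet {T : Ω → Set ℝ} {r : ℝ≥0}
    (hT : IsPoissonPointProcess T r P) : IsRandomSet T where
  locFin := hT.locallyFinite
  measurableSet_avoid B hB hb := by
    have : {ω | T ω ∩ B = ∅} = pointCount T B ⁻¹' {0} := by
      ext ω
      simp [pointCount, ncard_eq_zero (hT.locallyFinite ω B hb)]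
    rw [this]
    exact hT.measurable B hB hb trivial

theorem IsPoissonPointProcess.measureReal_avoid {T : Ω → Set ℝ} {r : ℝ≥0}
    (hT : IsPoissonPointProcess T r P) {B : Set ℝ} (hB : MeasurableSet B)
    (hb : Bornology.IsBounded B) :
    P.real {ω | T ω ∩ B = ∅} = Real.exp (-(r * volume.real B)) := by
  have : {ω | T ω ∩ B = ∅} = pointCount T B ⁻¹' {0} := by
    ext ω
    simp [pointCount, ncard_eq_zero (hT.locallyFinite ω B hb)]
  rw [this, ← map_measureReal_apply (hT.measurable B hB hb) (measurableSet_singleton 0),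
    (hT.hasLaw B hB hb).map_eq, poissonMeasure_real_singleton]
  simp [Measure.real, ENNReal.toReal]

/-- The joint avoidance event requires the common process to avoid `B ∪ B'` and the two private ones
to avoid `B` and `B'`; these three events are independent. -/
theorem isPoissonPair_of_indep {T : Fin 3 → Ω → Set ℝ} {l : Fin 3 → ℝ≥0}
    (hT : ∀ i, IsPoissonPointProcess (T i) (l i) P) (hi : iIndep (fun i => pointSigma (T i)) P) :
    IsPoissonPair (fun ω => T 0 ω ∪ T 1 ω) (fun ω => T 0 ω ∪ T 2 ω) (l 0) (l 1) (l 2) P where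
  left := (hT 0).isRandomSet.union (hT 1).isRandomSet
  right := (hT 0).isRandomSet.union (hT 2).isRandomSet
  avoid B B' hB hb hB' hb' := by
    have hset : {ω | (T 0 ω ∪ T 1 ω) ∩ B = ∅ ∧ (T 0 ω ∪ T 2 ω) ∩ B' = ∅}
        = ⋂ i, {ω | T i ω ∩ (![B ∪ B', B, B'] i) = ∅} := by
      ext ω
      simp only [mem_ofPred_eq, mem_iInter, Fin.forall_fin_succ, Fin.isValue, Matrix.cons_val_zero,
        inter_union_distrib_left, union_inter_distrib_right, union_empty_iff]
      simp
      tauto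
    have hm : ∀ i, MeasurableSet[pointSigma (T i)] {ω | T i ω ∩ (![B ∪ B', B, B'] i) = ∅} := by
      intro i
      have h := isRandomSet_of_pointSigma_le (m := pointSigma (T i)) (hT i).locallyFinite le_rfl
      have hBi : MeasurableSet (![B ∪ B', B, B'] i) ∧ Bornology.IsBounded (![B ∪ B', B, B'] i) := by
        fin_cases i
        · exact ⟨hB.union hB', hb.union hb'⟩
        · exact ⟨hB, hb⟩
        · exact ⟨hB', hb'⟩
      exact @IsRandomSet.measurableSet_avoid _ (pointSigma (T i)) _ h _ hBi.1 hBi.2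
    rw [Measure.real, hset, hi.meas_iInter hm, ENNReal.toReal_prod, Fin.prod_univ_three]
    change P.real {ω | T 0 ω ∩ (B ∪ B') = ∅} * P.real {ω | T 1 ω ∩ B = ∅}
      * P.real {ω | T 2 ω ∩ B' = ∅} = _
    rw [(hT 0).measureReal_avoid (hB.union hB') (hb.union hb'), (hT 1).measureReal_avoid hB hb,
      (hT 2).measureReal_avoid hB' hb', ← Real.exp_add, ← Real.exp_add]
    congr 1
    ring

namespace IsPoissonPair

variable {T T' : Ω → Set ℝ} {a b c : ℝ≥0}

theorem fst (h : IsPoissonPair T T' a b c P) : IsPoissonSet T (a + b) P where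
  random := h.left
  avoid B hB hb := by
    have := h.avoid B ∅ hB hb .empty Bornology.isBounded_empty
    simp only [inter_empty, and_true, union_empty, measureReal_empty, mul_zero, add_zero] at this
    rw [this]
    push_cast
    ring_nf

theorem symm (h : IsPoissonPair T T' a b c P) : IsPoissonPair T' T a c b P where
  left := h.right
  right := h.left
  avoid B B' hB hb hB' hb' := by
    simp_rw [and_comm (a := T' _ ∩ B = ∅)]
    rw [h.avoid B' B hB' hb' hB hb, union_comm]
    ring_nf

theorem snd (h : IsPoissonPair T T' a b c P) : IsPoissonSet T' (a + c) P := h.symm.fst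

theorem union (h : IsPoissonPair T T' a b c P) :
    IsPoissonSet (fun ω => T ω ∪ T' ω) (a + b + c) P where
  random := h.left.union h.right
  avoid B hB hb := by
    have := h.avoid B B hB hb hB hb
    simp_rw [union_inter_distrib_right, union_empty_iff]
    rw [this, union_self]
    push_cast
    ring_nf

end IsPoissonPair

namespace IsPoissonSet

variable {T : Ω → Set ℝ} {r : ℝ≥0} [IsProbabilityMeasure P]

theorem measureReal_nonempty (hT : IsPoissonSet T r P) {B : Set ℝ} (hB : MeasurableSet B)
    (hb : Bornology.IsBounded B) :
    P.real {ω | (T ω ∩ B).Nonempty} = 1 - Real.exp (-(r * volume.real B)) := by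
  have : {ω | (T ω ∩ B).Nonempty} = {ω | T ω ∩ B = ∅}ᶜ := by
    ext ω; simp [nonempty_iff_ne_empty]
  rw [this, probReal_compl_eq_one_sub (hT.random.measurableSet_avoid B hB hb), hT.avoid B hB hb]

theorem measure_nonempty_le (hT : IsPoissonSet T r P) {B : Set ℝ} (hB : MeasurableSet B)
    (hb : Bornology.IsBounded B) : P {ω | (T ω ∩ B).Nonempty} ≤ r * volume B := by
  rw [← ENNReal.toReal_le_toReal (measure_ne_top _ _)
    (ENNReal.mul_ne_top ENNReal.coe_ne_top hb.measure_lt_top.ne), ENNReal.toReal_mul]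
  change P.real _ ≤ r * volume.real B
  rw [hT.measureReal_nonempty hB hb]
  linarith [Real.add_one_le_exp (-(r * volume.real B))]

theorem ae_notMem (hT : IsPoissonSet T r P) (x : ℝ) : ∀ᵐ ω ∂P, x ∉ T ω := by
  have h := hT.measure_nonempty_le (measurableSet_singleton x) Bornology.isBounded_singleton
  simp only [measure_singleton, mul_zero, nonpos_iff_eq_zero] at h
  rw [ae_iff]
  refine measure_mono_null (fun ω hω => ?_) h
  exact ⟨x, not_not.1 hω, rfl⟩

theorem ae_nonempty_Iio (hT : IsPoissonSet T r P) (hr : 0 < r) (x : ℝ) :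
    ∀ᵐ ω ∂P, (T ω ∩ Iio x).Nonempty := by
  have hle : ∀ n : ℕ, P.real {ω | T ω ∩ Iio x = ∅} ≤ Real.exp (-(r * n)) := by
    intro n
    have := hT.avoid (Ico (x - n) x) measurableSet_Ico (Metric.isBounded_Ico _ _)
    rw [Real.volume_real_Ico_of_le (by linarith [n.cast_nonneg (α := ℝ)]), sub_sub_cancel] at this
    rw [← this]
    refine measureReal_mono fun ω (hω : T ω ∩ Iio x = ∅) => ?_
    exact subset_empty_iff.1 (hω ▸ inter_subset_inter_right _ Ico_subset_Iio_self)
  have hlim : Tendsto (fun n : ℕ => Real.exp (-(r * n))) atTop (𝓝 0) := by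
    apply Real.tendsto_exp_neg_atTop_nhds_zero.comp
    exact tendsto_natCast_atTop_atTop.const_mul_atTop (NNReal.coe_pos.2 hr)
  have h0 : P.real {ω | T ω ∩ Iio x = ∅} = 0 :=
    le_antisymm (ge_of_tendsto' hlim hle) measureReal_nonneg
  rw [ae_iff]
  simp_rw [not_nonempty_iff_eq_empty]
  exact (measureReal_eq_zero_iff).1 h0

theorem ae_isShockSet (hT : IsPoissonSet T r P) (hr : 0 < r) : ∀ᵐ ω ∂P, IsShockSet (T ω) := by
  filter_upwards [hT.ae_notMem 0, hT.ae_nonempty_Iio hr 0] with ω h1 h2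
  exact ⟨hT.random.locFin ω, h2, h1⟩

/-- If the age lies in `s`, the reflected set `x - s` contains a point, so on `(0, 1)` the law of
the age is at most `r` times Lebesgue measure. There `y ^ p` is integrable because `-1 < p`; for
ages at least `1` the power is at most `1`. -/
theorem lintegral_sub_lastPoint_rpow_lt_top (hT : IsPoissonSet T r P) (hr : 0 < r) (x : ℝ)
    {p : ℝ} (hp : -1 < p) (hp0 : p ≤ 0) :
    ∫⁻ ω, ENNReal.ofReal ((x - lastPoint (T ω) x) ^ p) ∂P < ⊤ := by
  set g : Ω → ℝ := fun ω => x - lastPoint (T ω) x with hg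
  have hgm : Measurable g := (hT.random.measurable_lastPoint x).const_sub x
  have hf : Measurable fun y : ℝ => ENNReal.ofReal (y ^ p) := by fun_prop
  have hgpos : ∀ᵐ ω ∂P, 0 < g ω := by
    filter_upwards [hT.ae_nonempty_Iio hr x] with ω hω
    exact sub_pos.2 ((hT.random.locFin ω).isGreatest_lastPoint hω).1.2
  have hlaw : (P.map g).restrict (Ioo 0 1) ≤ (r : ENNReal) • volume.restrict (Ioo 0 1) := by
    refine Measure.le_iff.2 fun s hs => ?_
    rw [Measure.smul_apply, smul_eq_mul, Measure.restrict_apply hs, Measure.restrict_apply hs,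
      Measure.map_apply hgm (hs.inter measurableSet_Ioo)]
    set B : Set ℝ := (fun y => x - y) ⁻¹' (s ∩ Ioo 0 1) with hB
    have hBm : MeasurableSet B := (hs.inter measurableSet_Ioo).preimage (by fun_prop)
    have hBb : Bornology.IsBounded B := by
      refine (Metric.isBounded_Ioo (x - 1) x).subset fun y hy => ?_
      have := hy.2
      exact ⟨by linarith [this.2], by linarith [this.1]⟩
    have hvol : volume B = volume (s ∩ Ioo 0 1) :=
      (Measure.measurePreserving_sub_left volume x).measure_preimage
        (hs.inter measurableSet_Ioo).nullMeasurableSet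
    rw [← hvol]
    refine le_trans (measure_mono_ae ?_) (hT.measure_nonempty_le hBm hBb)
    filter_upwards [hT.ae_nonempty_Iio hr x] with ω hω hωs
    exact ⟨lastPoint (T ω) x, ((hT.random.locFin ω).isGreatest_lastPoint hω).1.1, hωs⟩
  have hsplit : ∀ᵐ ω ∂P, ENNReal.ofReal (g ω ^ p)
      ≤ (Ioo 0 1).indicator (fun y => ENNReal.ofReal (y ^ p)) (g ω) + 1 := by
    filter_upwards [hgpos] with ω hω
    rcases lt_or_ge (g ω) 1 with h | h
    · rw [indicator_of_mem (show g ω ∈ Ioo (0 : ℝ) 1 from ⟨hω, h⟩)]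
      exact le_self_add
    · refine le_add_left ?_
      rw [← ENNReal.ofReal_one]
      exact ENNReal.ofReal_le_ofReal (Real.rpow_le_one_of_one_le_of_nonpos h hp0)
  calc ∫⁻ ω, ENNReal.ofReal (g ω ^ p) ∂P
      ≤ ∫⁻ ω, ((Ioo 0 1).indicator (fun y => ENNReal.ofReal (y ^ p)) (g ω) + 1) ∂P :=
        lintegral_mono_ae hsplit
    _ = (∫⁻ y in Ioo 0 1, ENNReal.ofReal (y ^ p) ∂(P.map g)) + 1 := by
        rw [lintegral_add_right _ measurable_const, lintegral_const, measure_univ, mul_one,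
          ← lintegral_indicator measurableSet_Ioo,
          lintegral_map (hf.indicator measurableSet_Ioo) hgm]
    _ ≤ r * (∫⁻ y in Ioo 0 1, ENNReal.ofReal (y ^ p)) + 1 := by
        gcongr
        rw [← smul_eq_mul, ← lintegral_smul_measure]
        exact lintegral_mono' hlaw le_rfl
    _ < ⊤ := by
        refine ENNReal.add_lt_top.2 ⟨ENNReal.mul_lt_top ENNReal.coe_lt_top ?_, ENNReal.one_lt_top⟩
        have hi : IntegrableOn (fun y : ℝ => y ^ p) (Ioo 0 1) :=
          (intervalIntegral.integrableOn_Ioo_rpow_iff one_pos).2 hp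
        exact hi.lintegral_lt_top

theorem memLp_sub_lastPoint_rpow (hT : IsPoissonSet T r P) (hr : 0 < r) (x : ℝ)
    {D : ℝ} (hD : 0 < D) (hD2 : D ≤ 1 / 2) :
    MemLp (fun ω => (x - lastPoint (T ω) x) ^ (D - 1 / 2)) 2 P := by
  have hm : Measurable fun ω => (x - lastPoint (T ω) x) ^ (D - 1 / 2) :=
    ((hT.random.measurable_lastPoint x).const_sub x).pow_const _
  refine (memLp_two_iff_integrable_sq hm.aestronglyMeasurable).2
    ⟨(hm.pow_const 2).aestronglyMeasurable, ?_⟩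
  rw [hasFiniteIntegral_iff_ofReal (Eventually.of_forall fun ω => sq_nonneg _)]
  refine lt_of_le_of_lt (lintegral_mono_ae ?_) (hT.lintegral_sub_lastPoint_rpow_lt_top hr x
    (p := 2 * D - 1) (by linarith) (by linarith))
  filter_upwards [hT.ae_nonempty_Iio hr x] with ω hω
  have h0 : 0 < x - lastPoint (T ω) x :=
    sub_pos.2 ((hT.random.locFin ω).isGreatest_lastPoint hω).1.2
  rw [← Real.rpow_natCast, ← Real.rpow_mul h0.le]
  apply le_of_eq
  congr 2
  push_cast
  ring

theorem measureReal_nonempty_inter_nonempty (hT : IsPoissonSet T r P) {B C : Set ℝ}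
    (hB : MeasurableSet B) (hBb : Bornology.IsBounded B) (hC : MeasurableSet C)
    (hCb : Bornology.IsBounded C) (hBC : Disjoint B C) :
    P.real {ω | (T ω ∩ B).Nonempty ∧ (T ω ∩ C).Nonempty}
      = (1 - Real.exp (-(r * volume.real B))) * (1 - Real.exp (-(r * volume.real C))) := by
  have hmB := hT.random.measurableSet_avoid B hB hBb
  have hmC := hT.random.measurableSet_avoid C hC hCb
  have h1 : {ω | (T ω ∩ B).Nonempty ∧ (T ω ∩ C).Nonempty}
      = ({ω | T ω ∩ B = ∅} ∪ {ω | T ω ∩ C = ∅})ᶜ := by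
    ext ω; simp [nonempty_iff_ne_empty]
  have h2 : {ω | T ω ∩ B = ∅} ∩ {ω | T ω ∩ C = ∅} = {ω | T ω ∩ (B ∪ C) = ∅} := by
    ext ω; simp [inter_union_distrib_left]
  have h3 := measureReal_union_add_inter (μ := P) (s := {ω | T ω ∩ B = ∅}) hmC
  rw [h2, hT.avoid B hB hBb, hT.avoid C hC hCb, hT.avoid _ (hB.union hC) (hBb.union hCb),
    measureReal_union hBC hC hBb.measure_lt_top.ne hCb.measure_lt_top.ne, mul_add, neg_add,
    Real.exp_add] at h3
  rw [h1, probReal_compl_eq_one_sub (hmB.union hmC)]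
  linear_combination -h3

/-- Cut `[-M, M)` into `2Mn` cells of length `1/n`. A cell and its translate by `v` are both
occupied with probability at most `(r/n)²`, so the union bound is of order `1/n`. -/
theorem ae_add_notMem (hT : IsPoissonSet T r P) {v : ℝ} (hv : 0 < v) :
    ∀ᵐ ω ∂P, ∀ x ∈ T ω, x + v ∉ T ω := by
  have hM : ∀ M : ℕ, ∀ᵐ ω ∂P, ∀ x ∈ T ω, x ∈ Ico (-(M : ℝ)) M → x + v ∉ T ω := by
    intro M
    have hle : ∀ᶠ n : ℕ in atTop, P {ω | ¬ ∀ x ∈ T ω, x ∈ Ico (-(M : ℝ)) M → x + v ∉ T ω}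
        ≤ ENNReal.ofReal (2 * M * r ^ 2 * (1 / (n : ℝ))) := by
      -- Cells shorter than `v` are disjoint from their translates, which makes the two occupations
      -- independent.
      obtain ⟨n0, hn0⟩ := exists_nat_gt (1 / v)
      filter_upwards [eventually_ge_atTop n0] with n hn
      have hn' : 1 / v < n := hn0.trans_le (by exact_mod_cast hn)
      have hnpos : (0 : ℝ) < n := (by positivity : (0 : ℝ) < 1 / v).trans hn'
      have hδ : 1 / (n : ℝ) < v := (one_div_lt hv hnpos).1 hn'
      set C : ℕ → Set ℝ := fun k => Ico (-M + k * (1 / (n : ℝ))) (-M + (k + 1) * (1 / (n : ℝ)))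
      set C' : ℕ → Set ℝ := fun k =>
        Ico (-M + k * (1 / (n : ℝ)) + v) (-M + (k + 1) * (1 / (n : ℝ)) + v)
      have hbound : ∀ k, P {ω | (T ω ∩ C k).Nonempty ∧ (T ω ∩ C' k).Nonempty}
          ≤ ENNReal.ofReal ((r * (1 / (n : ℝ))) ^ 2) := by
        intro k
        rw [← ofReal_measureReal]
        apply ENNReal.ofReal_le_ofReal
        rw [hT.measureReal_nonempty_inter_nonempty measurableSet_Ico (Metric.isBounded_Ico _ _)
          measurableSet_Ico (Metric.isBounded_Ico _ _) ?_]
        · have e1 : volume.real (C k) = 1 / (n : ℝ) := by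
            rw [Real.volume_real_Ico_of_le (by gcongr; linarith)]; ring
          have e2 : volume.real (C' k) = 1 / (n : ℝ) := by
            rw [Real.volume_real_Ico_of_le (by gcongr; linarith)]; ring
          change (1 - Real.exp (-(r * volume.real (C k))))
            * (1 - Real.exp (-(r * volume.real (C' k)))) ≤ _
          rw [e1, e2, ← sq]
          have h1 := Real.add_one_le_exp (-(r * (1 / (n : ℝ))))
          have h2 : Real.exp (-(r * (1 / (n : ℝ)))) ≤ 1 :=
            Real.exp_le_one_iff.2 (neg_nonpos.2 (by positivity))
          exact pow_le_pow_left₀ (by linarith) (by linarith) 2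
        · apply Set.disjoint_left.2
          rintro y ⟨_, hy⟩ ⟨hy', _⟩
          linarith
      have hsub : {ω | ¬ ∀ x ∈ T ω, x ∈ Ico (-(M : ℝ)) M → x + v ∉ T ω}
          ⊆ ⋃ k ∈ Finset.range (2 * M * n),
            {ω | (T ω ∩ C k).Nonempty ∧ (T ω ∩ C' k).Nonempty} := by
        intro ω hω
        simp only [mem_ofPred_eq] at hω
        push Not at hω
        obtain ⟨x, hx, ⟨hx1, hx2⟩, hxv⟩ := hω
        have hx0 : 0 ≤ (x + M) * n := mul_nonneg (by linarith) hnpos.le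
        have hf1 := Nat.floor_le hx0
        have hf2 := Nat.lt_floor_add_one ((x + M) * n)
        have hf3 : (⌊(x + M) * n⌋₊ : ℝ) * (1 / n) ≤ x + M := by
          rw [mul_one_div, div_le_iff₀ hnpos]; exact hf1
        have hf4 : x + M < ((⌊(x + M) * n⌋₊ : ℝ) + 1) * (1 / n) := by
          rw [mul_one_div, lt_div_iff₀ hnpos]; exact hf2
        simp only [mem_iUnion, Finset.mem_range]
        refine ⟨⌊(x + M) * n⌋₊, ?_, ⟨x, hx, by linarith, by linarith⟩,
          ⟨x + v, hxv, by linarith, by linarith⟩⟩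
        rw [Nat.floor_lt hx0]
        push_cast
        have : x + M < 2 * M := by linarith
        gcongr
      refine (measure_mono hsub).trans ((measure_biUnion_finset_le _ _).trans
        ((Finset.sum_le_sum fun k _ => hbound k).trans ?_))
      rw [Finset.sum_const, Finset.card_range, nsmul_eq_mul, ← ENNReal.ofReal_natCast,
        ← ENNReal.ofReal_mul (by positivity)]
      apply ENNReal.ofReal_le_ofReal
      apply le_of_eq
      push_cast
      field_simp
    have hlim : Tendsto (fun n : ℕ => ENNReal.ofReal (2 * M * r ^ 2 * (1 / (n : ℝ)))) atTop
        (𝓝 0) := by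
      rw [← ENNReal.ofReal_zero]
      apply ENNReal.tendsto_ofReal
      simpa using (tendsto_one_div_atTop_nhds_zero_nat (𝕜 := ℝ)).const_mul (2 * (M : ℝ) * r ^ 2)
    exact ae_iff.2 (le_antisymm (ge_of_tendsto hlim hle) zero_le)
  filter_upwards [ae_all_iff.2 hM] with ω hω x hx
  obtain ⟨M, hM⟩ := exists_nat_gt |x|
  have := abs_lt.1 hM
  exact hω M x hx ⟨this.1.le, this.2⟩

end IsPoissonSet

/-! ### Stationarity, independence of past and future, and covariances of ages. -/

theorem covariance_congr_ae {X X' Y Y' : Ω → ℝ} (hX : X =ᵐ[P] X') (hY : Y =ᵐ[P] Y') :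
    covariance X Y P = covariance X' Y' P := by
  unfold covariance
  rw [integral_congr_ae hX, integral_congr_ae hY]
  apply integral_congr_ae
  filter_upwards [hX, hY] with ω h1 h2
  rw [h1, h2]

theorem lastPoint_inter_Iio (S : Set ℝ) (x : ℝ) : lastPoint (S ∩ Iio x) x = lastPoint S x := by
  rw [lastPoint, inter_assoc, inter_self, lastPoint]

theorem lastPoint_of_empty {S : Set ℝ} {x y : ℝ} (hxy : x ≤ y) (h : S ∩ Ico x y = ∅) :
    lastPoint S y = lastPoint S x := by
  unfold lastPoint
  rw [← Iio_union_Ico_eq_Iio hxy, inter_union_distrib_left, h, union_empty]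

theorem LocFin.lastPoint_inter_Ici {S : Set ℝ} (hS : LocFin S) {x y : ℝ}
    (h : (S ∩ Ico x y).Nonempty) : lastPoint (S ∩ Ici x) y = lastPoint S y := by
  obtain ⟨z, hz, hxz, hzy⟩ := h
  have h1 := hS.isGreatest_lastPoint (x := y) ⟨z, hz, hzy⟩
  have h2 : IsGreatest (S ∩ Ici x ∩ Iio y) (lastPoint S y) :=
    ⟨⟨⟨h1.1.1, hxz.trans (h1.2 ⟨hz, hzy⟩)⟩, h1.1.2⟩, fun w hw => h1.2 ⟨hw.1.1, hw.2⟩⟩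
  exact h2.csSup_eq

theorem LocFin.lastPoint_preimage_add {S : Set ℝ} (hS : LocFin S) {r x : ℝ}
    (h : (S ∩ Iio (r + x)).Nonempty) :
    lastPoint ((fun y => r + y) ⁻¹' S) x = lastPoint S (r + x) - r := by
  have h1 := hS.isGreatest_lastPoint h
  have h2 : IsGreatest (((fun y => r + y) ⁻¹' S) ∩ Iio x) (lastPoint S (r + x) - r) := by
    refine ⟨⟨by simpa using h1.1.1, ?_⟩, fun w hw => ?_⟩
    · have : lastPoint S (r + x) < r + x := h1.1.2
      exact show _ < x by linarith
    · have := h1.2 ⟨hw.1, show r + w < r + x by linarith [show w < x from hw.2]⟩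
      linarith
  exact h2.csSup_eq

namespace IsPoissonPair

variable {T T' : Ω → Set ℝ} {a b c : ℝ≥0}

theorem preimage_add (h : IsPoissonPair T T' a b c P) (r : ℝ) :
    IsPoissonPair (fun ω => (fun x => r + x) ⁻¹' (T ω)) (fun ω => (fun x => r + x) ⁻¹' (T' ω))
      a b c P where
  left := h.left.preimage_add r
  right := h.right.preimage_add r
  avoid B B' hB hb hB' hb' := by
    have hbd : ∀ {B : Set ℝ}, Bornology.IsBounded B →
        Bornology.IsBounded ((fun x => -r + x) ⁻¹' B) := by
      intro B hB
      have : (fun x => -r + x) ⁻¹' B = (fun x => r + x) '' B := by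
        ext x
        simp only [mem_preimage, mem_image]
        exact ⟨fun hx => ⟨_, hx, by ring⟩, by rintro ⟨y, hy, rfl⟩; simpa using hy⟩
      rw [this]
      exact ((isometry_add_left r).lipschitz).isBounded_image hB
    have hvol : ∀ B : Set ℝ, volume.real ((fun x => -r + x) ⁻¹' B) = volume.real B := by
      intro B
      rw [Measure.real, measure_preimage_add, Measure.real]
    simp_rw [IsRandomSet.preimage_add_inter_eq_empty_iff]
    rw [h.avoid _ _ (hB.preimage (measurable_const_add _)) (hbd hb)
      (hB'.preimage (measurable_const_add _)) (hbd hb'), ← preimage_union, hvol, hvol, hvol]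

theorem map_eq [IsProbabilityMeasure P] {U U' : Ω → Set ℝ} (h : IsPoissonPair T T' a b c P)
    (h' : IsPoissonPair U U' a b c P) :
    P.map (toPair h.left h.right) = P.map (toPair h'.left h'.right) := by
  have hm := measurable_toPair h.left h.right
  have hm' := measurable_toPair h'.left h'.right
  have := Measure.isProbabilityMeasure_map (μ := P) hm.aemeasurable
  have := Measure.isProbabilityMeasure_map (μ := P) hm'.aemeasurable
  refine ext_of_generate_finite voidEvents rfl isPiSystem_voidEvents ?_ (by simp)
  intro s hs
  have hsm : MeasurableSet s := MeasurableSpace.measurableSet_generateFrom hs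
  obtain ⟨B, B', hB, hb, hB', hb', rfl⟩ := hs
  rw [Measure.map_apply hm hsm, Measure.map_apply hm' hsm, ← measureReal_eq_measureReal_iff]
  exact (h.avoid B B' hB hb hB' hb').trans (h'.avoid B B' hB hb hB' hb').symm

/-- Lebesgue measure is additive over the parts left and right of `x`, so the exponential avoidance
probabilities factor; the π-systems of avoidance events do the rest. -/
theorem indepFun_past_future [IsProbabilityMeasure P] (h : IsPoissonPair T T' a b c P) (x : ℝ) :
    IndepFun (toPair (h.left.inter (measurableSet_Iio (a := x)))
        (h.right.inter (measurableSet_Iio (a := x))))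
      (toPair (h.left.inter (measurableSet_Ici (a := x)))
        (h.right.inter (measurableSet_Ici (a := x)))) P := by
  have hm1 := measurable_toPair (h.left.inter (measurableSet_Iio (a := x)))
    (h.right.inter (measurableSet_Iio (a := x)))
  have hm2 := measurable_toPair (h.left.inter (measurableSet_Ici (a := x)))
    (h.right.inter (measurableSet_Ici (a := x)))
  rw [IndepFun_iff_Indep]
  refine IndepSets.indep hm1.comap_le hm2.comap_le (isPiSystem_voidEvents.comap _)
    (isPiSystem_voidEvents.comap _) MeasurableSpace.comap_generateFrom
    MeasurableSpace.comap_generateFrom ?_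
  rw [IndepSets_iff]
  rintro _ _ ⟨_, ⟨B, B', hB, hb, hB', hb', rfl⟩, rfl⟩ ⟨_, ⟨C, C', hC, hc, hC', hc', rfl⟩, rfl⟩
  have e1 : toPair (h.left.inter (measurableSet_Iio (a := x)))
      (h.right.inter (measurableSet_Iio (a := x))) ⁻¹' voidEvent B B'
      = {ω | T ω ∩ (Iio x ∩ B) = ∅ ∧ T' ω ∩ (Iio x ∩ B') = ∅} := by
    ext ω; simp [voidEvent, toPair, inter_assoc]
  have e2 : toPair (h.left.inter (measurableSet_Ici (a := x)))
      (h.right.inter (measurableSet_Ici (a := x))) ⁻¹' voidEvent C C'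
      = {ω | T ω ∩ (Ici x ∩ C) = ∅ ∧ T' ω ∩ (Ici x ∩ C') = ∅} := by
    ext ω; simp [voidEvent, toPair, inter_assoc]
  have e3 : {ω | T ω ∩ (Iio x ∩ B) = ∅ ∧ T' ω ∩ (Iio x ∩ B') = ∅} ∩
      {ω | T ω ∩ (Ici x ∩ C) = ∅ ∧ T' ω ∩ (Ici x ∩ C') = ∅}
      = {ω | T ω ∩ ((Iio x ∩ B) ∪ (Ici x ∩ C)) = ∅ ∧
          T' ω ∩ ((Iio x ∩ B') ∪ (Ici x ∩ C')) = ∅} := by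
    ext ω
    simp only [mem_inter_iff, mem_ofPred_eq, inter_union_distrib_left, union_empty_iff]
    tauto
  have hIio : MeasurableSet (Iio x) := measurableSet_Iio
  have hIci : MeasurableSet (Ici x) := measurableSet_Ici
  have hsub : ∀ {A B : Set ℝ}, Bornology.IsBounded B → Bornology.IsBounded (A ∩ B) :=
    fun hB => hB.subset inter_subset_right
  have hvol : ∀ {A D : Set ℝ}, MeasurableSet D → Bornology.IsBounded A → Bornology.IsBounded D →
      volume.real (Iio x ∩ A ∪ Ici x ∩ D)
        = volume.real (Iio x ∩ A) + volume.real (Ici x ∩ D) := by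
    intro A D hD hA hD'
    refine measureReal_union ?_ (hIci.inter hD) (hsub hA).measure_lt_top.ne
      (hsub hD').measure_lt_top.ne
    refine Disjoint.mono inter_subset_left inter_subset_left ?_
    exact Set.disjoint_left.2 fun y hy hy' => absurd (show y < x from hy) (not_lt.2 hy')
  have hunion : (Iio x ∩ B ∪ Ici x ∩ C) ∪ (Iio x ∩ B' ∪ Ici x ∩ C')
      = Iio x ∩ (B ∪ B') ∪ Ici x ∩ (C ∪ C') := by
    rw [inter_union_distrib_left, inter_union_distrib_left, union_union_union_comm]
  rw [e1, e2, e3, ← ENNReal.toReal_eq_toReal_iff' (by finiteness) (by finiteness),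
    ENNReal.toReal_mul]
  change P.real _ = P.real _ * P.real _
  rw [h.avoid _ _ ((hIio.inter hB).union (hIci.inter hC)) ((hsub hb).union (hsub hc))
      ((hIio.inter hB').union (hIci.inter hC')) ((hsub hb').union (hsub hc')),
    h.avoid _ _ (hIio.inter hB) (hsub hb) (hIio.inter hB') (hsub hb'),
    h.avoid _ _ (hIci.inter hC) (hsub hc) (hIci.inter hC') (hsub hc'), hunion,
    hvol (hC.union hC') (hb.union hb') (hc.union hc'), hvol hC hb hc, hvol hC' hb' hc',
    ← Real.exp_add, inter_union_distrib_left, inter_union_distrib_left]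
  congr 1
  ring

/-- Stationarity of the covariance of powers of the ages. -/
theorem covariance_age_shift [IsProbabilityMeasure P] (h : IsPoissonPair T T' a b c P)
    (ha : 0 < a + b) (hc : 0 < a + c) (α β : ℝ) (s t : ℝ) :
    covariance (fun ω => (s - lastPoint (T ω) s) ^ α) (fun ω => (t - lastPoint (T' ω) t) ^ β) P
      = covariance (fun ω => (0 - lastPoint (T ω) 0) ^ α)
        (fun ω => (t - s - lastPoint (T' ω) (t - s)) ^ β) P := by
  have h' := h.preimage_add s
  have hm := measurable_toPair h.left h.right
  have hm' := measurable_toPair h'.left h'.right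
  have hF : Measurable fun p : ShockPair => (0 - lastPoint p.fst 0) ^ α :=
    ((isRandomSet_fst.measurable_lastPoint 0).const_sub 0).pow_const _
  have hG : Measurable fun p : ShockPair => (t - s - lastPoint p.snd (t - s)) ^ β :=
    ((isRandomSet_snd.measurable_lastPoint _).const_sub _).pow_const _
  have e1 := covariance_map_fun (μ := P) hF.aestronglyMeasurable hG.aestronglyMeasurable
    hm.aemeasurable
  have e2 := covariance_map_fun (μ := P) hF.aestronglyMeasurable hG.aestronglyMeasurable
    hm'.aemeasurable
  -- The original pair and the pair seen from `s` have the same law, so the same functionals of the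
  -- ages have the same covariance.
  rw [← h.map_eq h'] at e2
  refine Eq.trans ?_ (e2.symm.trans e1)
  apply covariance_congr_ae
  · filter_upwards [h.fst.ae_nonempty_Iio ha s] with ω hω
    have := (h.left.locFin ω).lastPoint_preimage_add (r := s) (x := 0) (by simpa using hω)
    simp only [toPair, this, add_zero]
    ring_nf
  · filter_upwards [h.snd.ae_nonempty_Iio hc t] with ω hω
    have := (h.right.locFin ω).lastPoint_preimage_add (r := s) (x := t - s) (by simpa using hω)
    simp only [toPair, this, add_sub_cancel]
    ring_nf

/-- The covariance of powers of the ages decays exponentially through the first shock. -/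
theorem covariance_age_decay [IsProbabilityMeasure P] (h : IsPoissonPair T T' a b c P)
    {α β u : ℝ} (hu : 0 ≤ u)
    (hA : MemLp (fun ω => (0 - lastPoint (T ω) 0) ^ α) 2 P)
    (hB : MemLp (fun ω => (u - lastPoint (T' ω) 0) ^ β) 2 P)
    (hBu : MemLp (fun ω => (u - lastPoint (T' ω) u) ^ β) 2 P) :
    covariance (fun ω => (0 - lastPoint (T ω) 0) ^ α) (fun ω => (u - lastPoint (T' ω) u) ^ β) P
      = covariance (fun ω => (0 - lastPoint (T ω) 0) ^ α)
        (fun ω => (u - lastPoint (T' ω) 0) ^ β) P * Real.exp (-((a + c : ℝ≥0) : ℝ) * u) := by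
  set A : Ω → ℝ := fun ω => (0 - lastPoint (T ω) 0) ^ α with hAdef
  set B : Ω → ℝ := fun ω => (u - lastPoint (T' ω) 0) ^ β with hBdef
  -- `lastPoint` looks strictly to the left, so passing from `0` to `u` adds exactly the points of
  -- `[0, u)`.
  set V : Set Ω := {ω | T' ω ∩ Ico 0 u = ∅} with hV
  have hVm : MeasurableSet V := h.right.measurableSet_empty measurableSet_Ico
  have hind := h.indepFun_past_future 0
  set past := toPair (h.left.inter (measurableSet_Iio (a := (0 : ℝ))))
    (h.right.inter (measurableSet_Iio (a := (0 : ℝ)))) with hpast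
  set future := toPair (h.left.inter (measurableSet_Ici (a := (0 : ℝ))))
    (h.right.inter (measurableSet_Ici (a := (0 : ℝ)))) with hfuture
  have hFA : Measurable fun p : ShockPair => (0 - lastPoint p.fst 0) ^ α :=
    ((isRandomSet_fst.measurable_lastPoint 0).const_sub 0).pow_const _
  have hFB : Measurable fun p : ShockPair => (u - lastPoint p.snd 0) ^ β :=
    ((isRandomSet_snd.measurable_lastPoint _).const_sub _).pow_const _
  have hFBu : Measurable fun p : ShockPair => (u - lastPoint p.snd u) ^ β :=
    ((isRandomSet_snd.measurable_lastPoint _).const_sub _).pow_const _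
  have hWm : MeasurableSet {p : ShockPair | p.snd ∩ Ico 0 u = ∅} :=
    isRandomSet_snd.measurableSet_empty measurableSet_Ico
  set W : Set ShockPair := {p : ShockPair | p.snd ∩ Ico 0 u = ∅} with hW
  have hmem : ∀ ω, future ω ∈ W ↔ ω ∈ V := by
    intro ω
    simp only [hW, hV, hfuture, toPair, mem_ofPred_eq]
    rw [inter_assoc, inter_eq_self_of_subset_right (show Ico 0 u ⊆ Ici (0 : ℝ) from Ico_subset_Ici_self)]
  have eA : A = (fun p : ShockPair => (0 - lastPoint p.fst 0) ^ α) ∘ past := by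
    ext ω; simp [hAdef, hpast, toPair, lastPoint_inter_Iio]
  have eB : B = (fun p : ShockPair => (u - lastPoint p.snd 0) ^ β) ∘ past := by
    ext ω; simp [hBdef, hpast, toPair, lastPoint_inter_Iio]
  have eV : V.indicator (1 : Ω → ℝ) = W.indicator (1 : ShockPair → ℝ) ∘ future := by
    ext ω
    by_cases hω : ω ∈ V
    · simp [hω, (hmem ω).2 hω]
    · simp [hω, mt (hmem ω).1 hω]
  -- Off `V`, the last point before `u` is already visible in the configuration on `[0, ∞)`, so this
  -- part is a function of the future and uncorrelated with `A`.
  set G : Ω → ℝ := Wᶜ.indicator (fun p : ShockPair => (u - lastPoint p.snd u) ^ β) ∘ future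
    with hG
  have hdec : (fun ω => (u - lastPoint (T' ω) u) ^ β) = V.indicator B + G := by
    ext ω
    by_cases hω : ω ∈ V
    · have h1 := (hmem ω).2 hω
      simp [hω, hG, h1, hBdef, lastPoint_of_empty hu hω]
    · have h1 := mt (hmem ω).1 hω
      have h2 := (h.right.locFin ω).lastPoint_inter_Ici (nonempty_iff_ne_empty.2 hω)
      have h3 : G ω = (u - lastPoint (T' ω) u) ^ β := by
        rw [hG, Function.comp_apply, indicator_of_mem (show future ω ∈ Wᶜ from h1), ← h2]
        rfl
      simp [hω, h3]
  have hVB : MemLp (V.indicator B) 2 P := hB.indicator hVm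
  have hGL : MemLp G 2 P := by
    have : G = (fun ω => (u - lastPoint (T' ω) u) ^ β) - V.indicator B := by
      rw [hdec, add_sub_cancel_left]
    rw [this]
    exact hBu.sub hVB
  have hAG : covariance A G P = 0 := by
    refine IndepFun.covariance_eq_zero ?_ hA hGL
    rw [eA, hG]
    exact hind.comp hFA (hFBu.indicator hWm.compl)
  -- `V` is a future event. Applied to `A * B` and to `B`, this pulls the factor `P(V)` out of the
  -- covariance of `A` with `V.indicator B`.
  have hprod : ∀ Z : Ω → ℝ, (∃ F : ShockPair → ℝ, Measurable F ∧ Z = F ∘ past) →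
      ∫ ω, (Z * V.indicator (1 : Ω → ℝ)) ω ∂P = (∫ ω, Z ω ∂P) * ∫ ω, V.indicator (1 : Ω → ℝ) ω ∂P := by
    rintro _ ⟨F, hF, rfl⟩
    have hm := measurable_toPair (h.left.inter (measurableSet_Iio (a := (0 : ℝ))))
      (h.right.inter (measurableSet_Iio (a := (0 : ℝ))))
    refine IndepFun.integral_mul_eq_mul_integral ?_ (hF.comp hm).aestronglyMeasurable
      (measurable_one.indicator hVm).aestronglyMeasurable
    rw [eV]
    exact hind.comp hF (measurable_one.indicator hWm)
  have hVP : P[V.indicator (1 : Ω → ℝ)] = Real.exp (-((a + c : ℝ≥0) : ℝ) * u) := by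
    rw [integral_indicator_one hVm, h.snd.avoid _ measurableSet_Ico (Metric.isBounded_Ico _ _),
      Real.volume_real_Ico_of_le hu, sub_zero, neg_mul]
  have e1 : V.indicator B = B * V.indicator 1 := by
    ext ω; by_cases hω : ω ∈ V <;> simp [hω]
  rw [hdec, covariance_add_right hA hVB hGL, hAG, add_zero, covariance_eq_sub hA hVB,
    covariance_eq_sub hA hB, e1, ← mul_assoc, hprod (A * B) ⟨_, hFA.mul hFB, by rw [eA, eB]; rfl⟩,
    hprod B ⟨_, hFB, eB⟩, hVP]
  ring

end IsPoissonPair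

end

/-! ### Almost sure separation of the two time changes. -/

theorem not_eventuallyEq_rpow_of_tendsto {p k l e : ℝ} (hp : p < 0) (hk : k ≠ 0) {G : ℝ → ℝ}
    (hG : Tendsto G (𝓝[>] e) (𝓝 l)) : ¬ ∀ᶠ r in 𝓝[>] e, k * (r - e) ^ p = G r := by
  intro h
  have h1 : Tendsto (fun r => r - e) (𝓝[>] e) (𝓝[>] 0) := by
    refine tendsto_nhdsWithin_iff.2 ⟨?_, ?_⟩
    · have : Tendsto (fun r : ℝ => r - e) (𝓝 e) (𝓝 (e - e)) := tendsto_id.sub_const e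
      rw [sub_self] at this
      exact this.mono_left nhdsWithin_le_nhds
    · filter_upwards [self_mem_nhdsWithin] with r hr
      exact sub_pos.2 (show e < r from hr)
  have h2 := (tendsto_rpow_neg_nhdsGT_zero hp).comp h1
  refine not_tendsto_nhds_of_tendsto_atTop h2 (k⁻¹ * l) ((hG.const_mul k⁻¹).congr' ?_)
  filter_upwards [h] with r hr
  rw [← hr, inv_mul_cancel_left₀ hk, Function.comp_apply]

theorem tendsto_sub_rpow_nhdsGT {M e : ℝ} (h : e < M) (p : ℝ) :
    Tendsto (fun r => (r - e) ^ p) (𝓝[>] M) (𝓝 ((M - e) ^ p)) := by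
  have : ContinuousAt (fun r : ℝ => (r - e) ^ p) M :=
    (continuousAt_id.sub continuousAt_const).rpow_const (Or.inl (sub_pos.2 h).ne')
  exact this.tendsto.mono_left nhdsWithin_le_nhds

/-- Two singular powers at the same point cancel only if they agree. -/
theorem eq_of_eventually_rpow_sub_rpow_eq {p q k k' l e : ℝ} (hp : p < 0) (hq : q < 0)
    (hk : k ≠ 0) (hk' : k' ≠ 0) {G : ℝ → ℝ} (hG : Tendsto G (𝓝[>] e) (𝓝 l))
    (h : ∀ᶠ r in 𝓝[>] e, k * (r - e) ^ p - k' * (r - e) ^ q = G r) : p = q ∧ k = k' := by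
  -- If `p < q`, multiplying by `(r - e)^(-p)` sends the left side to `k` and the right side to `0`.
  have key : ∀ {p q k k' l : ℝ} {G : ℝ → ℝ}, p < 0 → k ≠ 0 → p < q →
      Tendsto G (𝓝[>] e) (𝓝 l) →
      ¬ ∀ᶠ r in 𝓝[>] e, k * (r - e) ^ p - k' * (r - e) ^ q = G r := by
    intro p q k k' l G hp hk hpq hG h
    have h0 : ∀ {x : ℝ}, 0 < x → Tendsto (fun r => (r - e) ^ x) (𝓝[>] e) (𝓝 0) := by
      intro x hx
      have : ContinuousAt (fun r : ℝ => (r - e) ^ x) e :=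
        (continuousAt_id.sub continuousAt_const).rpow_const (Or.inr hx.le)
      have h3 := this.tendsto.mono_left (nhdsWithin_le_nhds (s := Ioi e))
      simpa [Real.zero_rpow hx.ne'] using h3
    have h1 : Tendsto (fun r => k - k' * (r - e) ^ (q - p)) (𝓝[>] e) (𝓝 (k - k' * 0)) :=
      ((h0 (sub_pos.2 hpq)).const_mul k').const_sub k
    have h2 : Tendsto (fun r => (r - e) ^ (-p) * G r) (𝓝[>] e) (𝓝 (0 * l)) :=
      (h0 (neg_pos.2 hp)).mul hG
    have h3 : (fun r => (r - e) ^ (-p) * G r)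
        =ᶠ[𝓝[>] e] fun r => k - k' * (r - e) ^ (q - p) := by
      filter_upwards [h, self_mem_nhdsWithin] with r hr hre
      have hpos : 0 < r - e := sub_pos.2 hre
      rw [← hr, mul_sub, mul_left_comm, ← Real.rpow_add hpos, mul_left_comm (b := k'),
        ← Real.rpow_add hpos, neg_add_cancel, Real.rpow_zero, mul_one, neg_add_eq_sub]
    have h4 := tendsto_nhds_unique (h2.congr' h3) h1
    rw [mul_zero, zero_mul, sub_zero] at h4
    exact hk h4.symm
  rcases lt_trichotomy p q with hpq | rfl | hpq
  · exact absurd h (key hp hk hpq hG)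
  · refine ⟨rfl, ?_⟩
    by_contra hne
    refine not_eventuallyEq_rpow_of_tendsto hp (sub_ne_zero.2 hne) hG ?_
    filter_upwards [h] with r hr
    rw [← hr]; ring
  · refine absurd ?_ (key (k := k') (k' := k) (l := -l) (G := fun r => -G r) hq hk' hpq hG.neg)
    filter_upwards [h] with r hr
    rw [← hr]; ring

theorem eq_of_sub_rpow_eq {p e e' r : ℝ} (hp : p ≠ 0) (he : e < r) (he' : e' < r)
    (h : (r - e) ^ p = (r - e') ^ p) : e = e' := by
  have := (Real.rpow_left_inj (sub_pos.2 he).le (sub_pos.2 he').le hp).1 h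
  linarith

/-- Differences of shifted powers with generic singularities are not proportional. -/
theorem not_forall_rpow_sub_eq {p q k k' e₁ e₂ e₃ e₄ : ℝ} (hp : p ≤ 0) (hq : q ≤ 0)
    (hpq : ¬ (p = 0 ∧ q = 0)) (hk : 0 < k) (hk' : 0 < k') (h12 : e₁ ≠ e₂) (h34 : e₃ ≠ e₄)
    (h13 : e₁ ≠ e₃) (h14 : e₁ ≠ e₄) (h23 : e₂ ≠ e₃) :
    ¬ ∀ r, e₁ < r → e₂ < r → e₃ < r → e₄ < r →
      k * ((r - e₁) ^ p - (r - e₂) ^ p) = k' * ((r - e₃) ^ q - (r - e₄) ^ q) := by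
  intro h
  obtain ⟨R, h1, h2, h3, h4⟩ : ∃ R, e₁ < R ∧ e₂ < R ∧ e₃ < R ∧ e₄ < R := by
    refine ⟨max (max e₁ e₂) (max e₃ e₄) + 1, ?_, ?_, ?_, ?_⟩ <;> grind
  rcases hp.eq_or_lt with rfl | hp
  · have hq0 : q ≠ 0 := fun h => hpq ⟨rfl, h⟩
    have := h R h1 h2 h3 h4
    simp only [Real.rpow_zero, sub_self, mul_zero] at this
    have h5 := (mul_eq_zero.1 this.symm).resolve_left hk'.ne'
    exact h34 (eq_of_sub_rpow_eq hq0 h3 h4 (sub_eq_zero.1 h5))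
  rcases hq.eq_or_lt with rfl | hq
  · have := h R h1 h2 h3 h4
    simp only [Real.rpow_zero, sub_self, mul_zero] at this
    have h5 := (mul_eq_zero.1 this).resolve_left hk.ne'
    exact h12 (eq_of_sub_rpow_eq hp.ne h1 h2 (sub_eq_zero.1 h5))
  have ev : ∀ {M : ℝ}, e₁ ≤ M → e₂ ≤ M → e₃ ≤ M → e₄ ≤ M → ∀ᶠ r in 𝓝[>] M,
      k * ((r - e₁) ^ p - (r - e₂) ^ p) = k' * ((r - e₃) ^ q - (r - e₄) ^ q) := by
    intro M h1 h2 h3 h4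
    filter_upwards [self_mem_nhdsWithin] with r hr
    exact h r (h1.trans_lt hr) (h2.trans_lt hr) (h3.trans_lt hr) (h4.trans_lt hr)
  -- A singularity strictly to the right of the others makes one term blow up while the rest stay
  -- bounded. The four cases exclude this for each point.
  by_cases m1 : e₂ < e₁ ∧ e₃ < e₁ ∧ e₄ < e₁
  · obtain ⟨i2, i3, i4⟩ := m1
    refine not_eventuallyEq_rpow_of_tendsto hp hk.ne'
      (((tendsto_sub_rpow_nhdsGT i2 p).const_mul k).add
      (((tendsto_sub_rpow_nhdsGT i3 q).sub (tendsto_sub_rpow_nhdsGT i4 q)).const_mul k')) ?_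
    filter_upwards [ev le_rfl i2.le i3.le i4.le] with r hr
    linarith
  by_cases m3 : e₁ < e₃ ∧ e₂ < e₃ ∧ e₄ < e₃
  · obtain ⟨i1, i2, i4⟩ := m3
    refine not_eventuallyEq_rpow_of_tendsto hq hk'.ne'
      (((tendsto_sub_rpow_nhdsGT i4 q).const_mul k').add
      (((tendsto_sub_rpow_nhdsGT i1 p).sub (tendsto_sub_rpow_nhdsGT i2 p)).const_mul k)) ?_
    filter_upwards [ev i1.le i2.le le_rfl i4.le] with r hr
    linarith
  by_cases m2 : e₁ < e₂ ∧ e₃ < e₂ ∧ e₄ < e₂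
  · obtain ⟨i1, i3, i4⟩ := m2
    refine not_eventuallyEq_rpow_of_tendsto hp hk.ne'
      (((tendsto_sub_rpow_nhdsGT i1 p).const_mul k).sub
      (((tendsto_sub_rpow_nhdsGT i3 q).sub (tendsto_sub_rpow_nhdsGT i4 q)).const_mul k')) ?_
    filter_upwards [ev i1.le le_rfl i3.le i4.le] with r hr
    linarith
  by_cases m4 : e₁ < e₄ ∧ e₂ < e₄ ∧ e₃ < e₄
  · obtain ⟨i1, i2, i3⟩ := m4
    refine not_eventuallyEq_rpow_of_tendsto hq hk'.ne'
      (((tendsto_sub_rpow_nhdsGT i3 q).const_mul k').sub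
      (((tendsto_sub_rpow_nhdsGT i1 p).sub (tendsto_sub_rpow_nhdsGT i2 p)).const_mul k)) ?_
    filter_upwards [ev i1.le i2.le i3.le le_rfl] with r hr
    linarith
  -- The only coincidence left at the top is `e₂ = e₄`. It must be allowed: a common shock can be
  -- the last one before `0` for both assets. Cancellation there forces equal exponents and
  -- coefficients, and the remaining terms then give `e₁ = e₃`.
  obtain ⟨rfl, i1, i3⟩ : e₂ = e₄ ∧ e₁ < e₂ ∧ e₃ < e₂ := by
    have hA : ¬ e₂ < e₄ := fun i24 => by
      rcases lt_or_gt_of_ne h13 with i | i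
      · rcases lt_or_gt_of_ne h34 with j | j
        · exact m4 ⟨i.trans j, i24, j⟩
        · exact m3 ⟨i, i24.trans j, j⟩
      · rcases lt_or_gt_of_ne h14 with j | j
        · exact m4 ⟨j, i24, i.trans j⟩
        · exact m1 ⟨i24.trans j, i, j⟩
    have hB : ¬ e₄ < e₂ := fun i24 => by
      rcases lt_or_gt_of_ne h13 with i | i
      · rcases lt_or_gt_of_ne h23 with j | j
        · exact m3 ⟨i, j, i24.trans j⟩
        · exact m2 ⟨i.trans j, j, i24⟩
      · rcases lt_or_gt_of_ne h12 with j | j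
        · exact m2 ⟨j, i.trans j, i24⟩
        · exact m1 ⟨j, i, i24.trans j⟩
    have h24 : e₂ = e₄ := le_antisymm (not_lt.1 hB) (not_lt.1 hA)
    subst h24
    refine ⟨rfl, lt_of_le_of_ne (not_lt.1 fun j => ?_) h12,
      lt_of_le_of_ne (not_lt.1 fun j => ?_) h23.symm⟩
    · rcases lt_or_gt_of_ne h13 with i | i
      · exact m3 ⟨i, j.trans i, j.trans i⟩
      · exact m1 ⟨j, i, j⟩
    · rcases lt_or_gt_of_ne h13 with i | i
      · exact m3 ⟨i, j, j⟩
      · exact m1 ⟨j.trans i, i, j.trans i⟩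
  obtain ⟨rfl, rfl⟩ := eq_of_eventually_rpow_sub_rpow_eq hp hq hk.ne' hk'.ne'
    (((tendsto_sub_rpow_nhdsGT i1 p).const_mul k).sub
      ((tendsto_sub_rpow_nhdsGT i3 q).const_mul k')) (by
      filter_upwards [ev i1.le le_rfl i3.le le_rfl] with r hr
      linarith)
  have h5 := mul_left_cancel₀ hk.ne' (h R h1 h2 h3 h4)
  exact h13 (eq_of_sub_rpow_eq hp.ne h1 h3 (sub_left_inj.1 h5))

theorem analyticAt_sub_rpow {e x : ℝ} (h : e < x) (p : ℝ) :
    AnalyticAt ℝ (fun r => (r - e) ^ p) x := by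
  have h1 : AnalyticAt ℝ (fun y : ℝ => y ^ p) (x - e) :=
    (Real.contDiffAt_rpow_const_of_ne (sub_pos.2 h).ne').analyticAt
  exact AnalyticAt.fun_comp (g := fun y : ℝ => y ^ p) (f := fun r => r - e) h1 (by fun_prop)

/-- Near a generic instant, two increments of shock time changes are eventually different. -/
theorem eventually_timeChange_sub_ne {S S' : Set ℝ} (hS : IsShockSet S) (hS' : IsShockSet S')
    {D D' σ σ' s t : ℝ} (hD : D ∈ Ioc (0 : ℝ) (1 / 2)) (hD' : D' ∈ Ioc (0 : ℝ) (1 / 2))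
    (hσ : 0 < σ) (hσ' : 0 < σ') (hs : 0 < s) (hst : s < t) (hsS : s ∉ S) (htS : t ∉ S')
    (hDD : ¬ (D = 1 / 2 ∧ D' = 1 / 2))
    (hgap_s : ∀ x ∈ S ∪ S', x + s ∉ S ∪ S') (hgap_t : ∀ x ∈ S ∪ S', x + t ∉ S ∪ S')
    (hgap : ∀ x ∈ S ∪ S', x + (t - s) ∉ S ∪ S') :
    ∀ᶠ r in 𝓝[>] (0 : ℝ), timeChange D σ S (r + s) - timeChange D σ S r
      ≠ timeChange D' σ' S' (r + t) - timeChange D' σ' S' r := by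
  have ht : 0 < t := hs.trans hst
  have ga := hS.isGreatest_lastPoint hs.le
  have gb := hS.isGreatest_lastPoint le_rfl
  have gc := hS'.isGreatest_lastPoint ht.le
  have gd := hS'.isGreatest_lastPoint le_rfl
  set a := lastPoint S s
  set b := lastPoint S 0
  set c := lastPoint S' t
  set d := lastPoint S' 0
  have ha : a - s < 0 := sub_neg.2 ga.1.2
  have hb : b < 0 := gb.1.2
  have hc : c - t < 0 := sub_neg.2 gc.1.2
  have hd : d < 0 := gd.1.2
  set K : ℝ := timeChange D σ S s - σ ^ 2 * ((s - a) ^ (2 * D) - (0 - b) ^ (2 * D))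
    - (timeChange D' σ' S' t - σ' ^ 2 * ((t - c) ^ (2 * D') - (0 - d) ^ (2 * D')))
  -- For small `r > 0` no shock falls in the four short windows, so the difference of increments is
  -- this explicit function; `K` collects everything independent of `r`.
  set F : ℝ → ℝ := fun r => σ ^ 2 * ((r - (a - s)) ^ (2 * D) - (r - b) ^ (2 * D))
    - σ' ^ 2 * ((r - (c - t)) ^ (2 * D') - (r - d) ^ (2 * D')) + K with hF
  have hev : ∀ᶠ r in 𝓝[>] (0 : ℝ), (timeChange D σ S (r + s) - timeChange D σ S r)
      - (timeChange D' σ' S' (r + t) - timeChange D' σ' S' r) = F r := by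
    filter_upwards [hS.locFin.eventually_empty s, hS.locFin.eventually_empty 0,
      hS'.locFin.eventually_empty t, hS'.locFin.eventually_empty 0, self_mem_nhdsWithin]
      with r h1 h2 h3 h4 hr
    have hr0 : 0 ≤ r := le_of_lt hr
    have i1 := hS.timeChange_sub_of_empty_Ioc hD.1 σ hs.le hsS hr0 h1
    have i2 := hS.timeChange_sub_of_empty_Ioc hD.1 σ le_rfl hS.zero_notMem hr0 h2
    have i3 := hS'.timeChange_sub_of_empty_Ioc hD'.1 σ' ht.le htS hr0 h3
    have i4 := hS'.timeChange_sub_of_empty_Ioc hD'.1 σ' le_rfl hS'.zero_notMem hr0 h4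
    rw [IsShockSet.timeChange_zero, zero_add] at i2 i4
    rw [add_comm s r] at i1
    rw [add_comm t r] at i3
    have j1 : r - (a - s) = r + s - a := by ring
    have j2 : r - (c - t) = r + t - c := by ring
    simp only [hF, K, j1, j2]
    linear_combination i1 - i2 - i3 + i4
  by_contra hne
  have hfreq : ∃ᶠ r in 𝓝[>] (0 : ℝ), F r = 0 := by
    refine ((not_eventually.1 hne).and_eventually hev).mono fun r hr => ?_
    rw [← hr.2, not_not.1 hr.1, sub_self]
  have hfreq' : ∃ᶠ r in 𝓝[≠] (0 : ℝ), F r = 0 :=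
    hfreq.filter_mono (nhdsWithin_mono 0 fun x (hx : 0 < x) => hx.ne')
  -- All singularities are negative, so `F` is analytic on a half-line containing `0` in its
  -- interior, and zeros accumulating at `0` would make it vanish there.
  set M := max (max (a - s) b) (max (c - t) d) with hM
  have hM1 : a - s ≤ M := by grind
  have hM2 : b ≤ M := by grind
  have hM3 : c - t ≤ M := by grind
  have hM4 : d ≤ M := by grind
  have hM0 : M < 0 := by grind
  have hAn : AnalyticOnNhd ℝ F (Ioi M) := by
    intro x hx
    have hx' : M < x := hx
    exact (((analyticAt_const.mul ((analyticAt_sub_rpow (hM1.trans_lt hx') _).sub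
      (analyticAt_sub_rpow (hM2.trans_lt hx') _))).sub
      (analyticAt_const.mul ((analyticAt_sub_rpow (hM3.trans_lt hx') _).sub
      (analyticAt_sub_rpow (hM4.trans_lt hx') _)))).add analyticAt_const)
  have hzero := hAn.eqOn_zero_of_preconnected_of_frequently_eq_zero isPreconnected_Ioi
    (show (0 : ℝ) ∈ Ioi M from hM0) hfreq'
  -- Differentiating removes the unknown constant `K`; this explains the exponents `2D - 1` and the
  -- factors `2D`.
  refine not_forall_rpow_sub_eq (p := 2 * D - 1) (q := 2 * D' - 1) (k := σ ^ 2 * (2 * D))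
    (k' := σ' ^ 2 * (2 * D')) (e₁ := a - s) (e₂ := b) (e₃ := c - t) (e₄ := d)
    (by linarith [hD.2]) (by linarith [hD'.2]) (fun h => hDD ⟨by linarith [h.1], by linarith [h.2]⟩)
    (mul_pos (by positivity) (by linarith [hD.1])) (mul_pos (by positivity) (by linarith [hD'.1]))
    ?_ ?_ ?_ ?_ ?_ ?_
  · intro h
    refine hgap_s b (Or.inl gb.1.1) (Or.inl ?_)
    rw [← h, sub_add_cancel]; exact ga.1.1
  · intro h
    refine hgap_t d (Or.inr gd.1.1) (Or.inr ?_)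
    rw [← h, sub_add_cancel]; exact gc.1.1
  · intro h
    refine hgap a (Or.inl ga.1.1) (Or.inr ?_)
    rw [show a + (t - s) = c by linarith]; exact gc.1.1
  · intro h
    refine hgap_s d (Or.inr gd.1.1) (Or.inl ?_)
    rw [← h, sub_add_cancel]; exact ga.1.1
  · intro h
    refine hgap_t b (Or.inl gb.1.1) (Or.inr ?_)
    rw [h, sub_add_cancel]; exact gc.1.1
  · intro r r1 r2 r3 r4
    have hMr : M < r := by grind
    have hd : ∀ {e : ℝ} (p : ℝ), e < r →
        HasDerivAt (fun r => (r - e) ^ p) (p * (r - e) ^ (p - 1)) r := by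
      intro e p he
      have := ((hasDerivAt_id r).sub_const e).rpow_const (p := p) (Or.inl (sub_pos.2 he).ne')
      simpa using this
    have hder : HasDerivAt F (σ ^ 2 * (2 * D * (r - (a - s)) ^ (2 * D - 1)
        - 2 * D * (r - b) ^ (2 * D - 1)) - σ' ^ 2 * (2 * D' * (r - (c - t)) ^ (2 * D' - 1)
        - 2 * D' * (r - d) ^ (2 * D' - 1))) r :=
      ((((hd _ r1).sub (hd _ r2)).const_mul _).sub
        (((hd _ r3).sub (hd _ r4)).const_mul _)).add_const K
    have h0 : HasDerivAt F 0 r := by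
      refine (hasDerivAt_const r (0 : ℝ)).congr_of_eventuallyEq ?_
      filter_upwards [Ioi_mem_nhds hMr] with x hx
      exact hzero hx
    have := hder.unique h0
    linear_combination this

section

variable {Ω : Type*} [MeasurableSpace Ω] {P : Measure Ω}

/-- Two shock time changes at different instants almost surely do not coincide. -/
theorem IsPoissonPair.ae_timeChange_ne [IsProbabilityMeasure P] {T T' : Ω → Set ℝ} {a b c : ℝ≥0}
    (h : IsPoissonPair T T' a b c P) (hab : 0 < a + b) (hac : 0 < a + c)
    {D D' σ σ' s t : ℝ} (hD : D ∈ Ioc (0 : ℝ) (1 / 2)) (hD' : D' ∈ Ioc (0 : ℝ) (1 / 2))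
    (hσ : 0 < σ) (hσ' : 0 < σ') (hs : 0 ≤ s) (hst : s < t)
    (hne : ¬ (D = 1 / 2 ∧ D' = 1 / 2 ∧ σ ^ 2 * s = σ' ^ 2 * t)) :
    ∀ᵐ ω ∂P, timeChange D σ (T ω) s ≠ timeChange D' σ' (T' ω) t := by
  have ht : 0 < t := hs.trans_lt hst
  have hS := h.fst.ae_isShockSet hab
  have hS' := h.snd.ae_isShockSet hac
  rcases hs.eq_or_lt with rfl | hs
  · filter_upwards [hS'] with ω hω
    rw [IsShockSet.timeChange_zero, ← IsShockSet.timeChange_zero (T' ω) D' σ']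
    exact (hω.timeChange_lt hD'.1 hσ' le_rfl ht).ne
  by_cases hDD : D = 1 / 2 ∧ D' = 1 / 2
  · obtain ⟨rfl, rfl⟩ := hDD
    filter_upwards [hS, hS'] with ω hω hω'
    rw [hω.timeChange_half σ hs.le, hω'.timeChange_half σ' ht.le]
    exact fun he => hne ⟨rfl, rfl, he⟩
  set E : Set ShockPair := {p | timeChange D σ p.fst s = timeChange D' σ' p.snd t} with hE
  have hEm : MeasurableSet E := measurableSet_eq_fun (isRandomSet_fst.measurable_timeChange D σ s)
    (isRandomSet_snd.measurable_timeChange D' σ' t)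
  set J : ℝ → Ω → ShockPair := fun r => toPair (h.preimage_add r).left (h.preimage_add r).right
  have hJm : ∀ r, Measurable (J r) := fun r => measurable_toPair _ _
  -- By stationarity the probability of coincidence does not depend on the shift, so it equals its
  -- limit along shifts tending to `0`.
  have hP : ∀ r, P (J r ⁻¹' E) = P (toPair h.left h.right ⁻¹' E) := by
    intro r
    rw [← Measure.map_apply (hJm r) hEm, ← Measure.map_apply (measurable_toPair _ _) hEm,
      h.map_eq (h.preimage_add r)]
  set r : ℕ → ℝ := fun k => 1 / ((k : ℝ) + 1) with hr
  have hr0 : ∀ k, 0 < r k := fun k => by positivity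
  have hrt : Tendsto r atTop (𝓝[>] 0) := tendsto_nhdsWithin_iff.2
    ⟨tendsto_one_div_add_atTop_nhds_zero_nat, Eventually.of_forall hr0⟩
  have hev : ∀ᵐ ω ∂P, ∀ᶠ k in atTop, ω ∈ J (r k) ⁻¹' E ↔ ω ∈ (∅ : Set Ω) := by
    have hshift : ∀ᵐ ω ∂P, ∀ k, IsShockSet ((fun x => r k + x) ⁻¹' (T ω)) ∧
        IsShockSet ((fun x => r k + x) ⁻¹' (T' ω)) := by
      rw [ae_all_iff]
      intro k
      filter_upwards [(h.preimage_add (r k)).fst.ae_isShockSet hab,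
        (h.preimage_add (r k)).snd.ae_isShockSet hac] with ω h1 h2
      exact ⟨h1, h2⟩
    filter_upwards [hS, hS', h.fst.ae_notMem s, h.snd.ae_notMem t, h.union.ae_add_notMem hs,
      h.union.ae_add_notMem ht, h.union.ae_add_notMem (sub_pos.2 hst), hshift]
      with ω i1 i2 i3 i4 i5 i6 i7 i8
    have := eventually_timeChange_sub_ne i1 i2 hD hD' hσ hσ' hs hst i3 i4 hDD i5 i6 i7
    filter_upwards [hrt.eventually this] with k hk
    simp only [mem_empty_iff_false, iff_false]
    intro hmem
    apply hk
    rw [← i1.timeChange_preimage_add hD.1 σ (hr0 k).le (i8 k).1 hs.le,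
      ← i2.timeChange_preimage_add hD'.1 σ' (hr0 k).le (i8 k).2 ht.le]
    exact hmem
  have hlim := tendsto_measure_of_ae_tendsto_indicator_of_isFiniteMeasure (μ := P) atTop
    MeasurableSet.empty (fun k => hEm.preimage (hJm (r k))) hev
  simp_rw [hP, measure_empty] at hlim
  have h0 := tendsto_nhds_unique hlim tendsto_const_nhds
  exact measure_eq_zero_iff_ae_notMem.1 h0.symm

/-! ### Gaussian moments and freezing of the operational times. -/

theorem integral_abs_gaussianReal (v : ℝ≥0) :
    ∫ x, |x| ∂(gaussianReal 0 v) = √(2 / Real.pi) * √v := by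
  by_cases hv : v = 0
  · simp [hv]
  have hv' : (0 : ℝ) < v := NNReal.coe_pos.2 (pos_iff_ne_zero.2 hv)
  rw [integral_gaussianReal_eq_integral_smul hv]
  have h1 : ∀ x : ℝ, gaussianPDFReal 0 v x • |x|
      = (√(2 * Real.pi * v))⁻¹ * (|x| ^ (1 : ℝ) * Real.exp (-(1 / (2 * v)) * |x| ^ (2 : ℝ))) := by
    intro x
    rw [gaussianPDFReal, smul_eq_mul, Real.rpow_one, Real.rpow_two, sq_abs, sub_zero]
    rw [show -x ^ 2 / (2 * (v : ℝ)) = -(1 / (2 * v)) * x ^ 2 by ring]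
    ring
  simp_rw [h1]
  rw [integral_const_mul, integral_comp_abs
    (f := fun x => x ^ (1 : ℝ) * Real.exp (-(1 / (2 * v)) * x ^ (2 : ℝ))),
    integral_rpow_mul_exp_neg_mul_rpow two_pos (by norm_num) (by positivity)]
  norm_num
  rw [Real.rpow_neg_one]
  have h2 : √Real.pi ≠ 0 := (Real.sqrt_pos.2 Real.pi_pos).ne'
  have h3 : √(v : ℝ) ≠ 0 := (Real.sqrt_pos.2 hv').ne'
  have h4 : √(2 : ℝ) ≠ 0 := (Real.sqrt_pos.2 two_pos).ne'
  field_simp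
  simp only [Real.sq_sqrt hv'.le, Real.sq_sqrt zero_le_two]
  ring

theorem lintegral_abs_of_hasLaw_gaussianReal {X : Ω → ℝ} {v : ℝ≥0}
    (hX : HasLaw X (gaussianReal 0 v) P) :
    ∫⁻ ω, ENNReal.ofReal |X ω| ∂P = ENNReal.ofReal (√(2 / Real.pi) * √v) := by
  rw [hX.lintegral_comp (f := fun x => ENNReal.ofReal |x|) (by fun_prop),
    ← ofReal_integral_eq_lintegral_ofReal _ (Eventually.of_forall fun x => abs_nonneg x),
    integral_abs_gaussianReal]
  exact (memLp_id_gaussianReal 1).integrable le_rfl |>.abs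

theorem lintegral_sq_of_hasLaw_gaussianReal {X : Ω → ℝ} {v : ℝ≥0}
    (hX : HasLaw X (gaussianReal 0 v) P) :
    ∫⁻ ω, ENNReal.ofReal (X ω ^ 2) ∂P = ENNReal.ofReal v := by
  rw [hX.lintegral_comp (f := fun x => ENNReal.ofReal (x ^ 2)) (by fun_prop),
    ← ofReal_integral_eq_lintegral_ofReal _ (Eventually.of_forall fun x => sq_nonneg x)]
  · congr 1
    have h := variance_id_gaussianReal (μ := 0) (v := v)
    rw [variance_eq_integral aemeasurable_id] at h
    simpa using h
  · exact (memLp_id_gaussianReal (μ := 0) (v := v) 2).integrable_sq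

theorem IndepFun.prodMk_right_of_prodMk_left [IsProbabilityMeasure P] {X Y Z : Ω → ℝ}
    (hX : AEMeasurable X P) (hY : AEMeasurable Y P) (hZ : AEMeasurable Z P)
    (hXY : IndepFun X Y P) (h : IndepFun (fun ω => (X ω, Y ω)) Z P) :
    IndepFun X (fun ω => (Y ω, Z ω)) P := by
  have hYZ : IndepFun Y Z P := h.comp measurable_snd measurable_id
  rw [indepFun_iff_map_prod_eq_prod_map_map hX hY] at hXY
  rw [indepFun_iff_map_prod_eq_prod_map_map hY hZ] at hYZ
  rw [indepFun_iff_map_prod_eq_prod_map_map (hX.prodMk hY) hZ, hXY] at h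
  rw [indepFun_iff_map_prod_eq_prod_map_map hX (hY.prodMk hZ), hYZ]
  have := Measure.isProbabilityMeasure_map hX
  have := Measure.isProbabilityMeasure_map hY
  have := Measure.isProbabilityMeasure_map hZ
  rw [← (measurePreserving_prodAssoc (P.map X) (P.map Y) (P.map Z)).map_eq, ← h,
    AEMeasurable.map_map_of_aemeasurable (MeasurableEquiv.prodAssoc.measurable.aemeasurable)
      ((hX.prodMk hY).prodMk hZ)]
  rfl

/-- The value of the process `W` along a measurable time, for a pair of almost surely continuous
processes independent of the times: the times can be frozen. -/
theorem lintegral_freeze [IsProbabilityMeasure P] {W V : ℝ≥0 → Ω → ℝ} {τ : Ω → Fin 4 → ℝ≥0}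
    (hW : ∀ t, Measurable (W t)) (hV : ∀ t, Measurable (V t)) (hτ : Measurable τ)
    (hWc : ∀ᵐ ω ∂P, Continuous fun t => W t ω) (hVc : ∀ᵐ ω ∂P, Continuous fun t => V t ω)
    (hI : IndepFun (fun ω t => (W t ω, V t ω)) τ P) {F : ℝ × ℝ → ENNReal} (hF : Measurable F) :
    (∫⁻ ω, F (W (τ ω 1) ω - W (τ ω 0) ω, V (τ ω 3) ω - V (τ ω 2) ω) ∂P
      = ∫⁻ ω, (∫⁻ ω', F (W (τ ω 1) ω' - W (τ ω 0) ω', V (τ ω 3) ω' - V (τ ω 2) ω') ∂P) ∂P) ∧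
    AEMeasurable (fun ω => W (τ ω 1) ω - W (τ ω 0) ω) P ∧
    AEMeasurable (fun ω => V (τ ω 3) ω - V (τ ω 2) ω) P ∧
    Measurable fun u : Fin 4 → ℝ≥0 =>
      ∫⁻ ω', F (W (u 1) ω' - W (u 0) ω', V (u 3) ω' - V (u 2) ω') ∂P := by
  classical
  obtain ⟨N, hN, hNm, hN0⟩ := exists_measurable_superset_of_null (ae_iff.1 (hWc.and hVc))
  have hcont : ∀ ω, ω ∉ N → Continuous (fun t => W t ω) ∧ Continuous fun t => V t ω := by
    intro ω hω
    by_contra h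
    exact hω (hN h)
  have hae : ∀ᵐ ω ∂P, ω ∉ N := measure_eq_zero_iff_ae_notMem.1 hN0
  -- On continuous paths, evaluation is jointly measurable in time and path. The processes are only
  -- almost surely continuous, so the path is set to `0` on a measurable null set; Fubini for the
  -- product law of path and times then applies.
  let C := {w : ℝ≥0 → ℝ × ℝ // Continuous w}
  let g : Ω → C := fun ω => if h : ω ∈ N then ⟨fun _ => 0, continuous_const⟩ else
    ⟨fun t => (W t ω, V t ω), (hcont ω h).1.prodMk (hcont ω h).2⟩
  have hgval : ∀ ω, ω ∉ N → (g ω).1 = fun t => (W t ω, V t ω) := by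
    intro ω hω
    simp only [g, hω, dite_false]
  have hgm : Measurable g := by
    refine Measurable.subtype_mk (f := fun ω => (g ω).1) ?_ |>.comp measurable_id
    refine measurable_pi_lambda _ fun t => ?_
    have : (fun ω => (g ω).1 t) = fun ω => if ω ∈ N then 0 else (W t ω, V t ω) := by
      ext1 ω
      by_cases hω : ω ∈ N
      · simp [g, hω]
      · rw [hgval ω hω, if_neg hω]
    rw [this]
    exact Measurable.ite hNm measurable_const ((hW t).prodMk (hV t))
  have hind : IndepFun g τ P := by
    have h1 : IndepFun (fun ω => (g ω).1) τ P := by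
      refine hI.congr ?_ EventuallyEq.rfl
      filter_upwards [hae] with ω hω
      exact (hgval ω hω).symm
    rw [IndepFun_iff_Indep] at h1 ⊢
    have : MeasurableSpace.comap g inferInstance
        = MeasurableSpace.comap (fun ω => (g ω).1) inferInstance := by
      rw [show (fun ω => (g ω).1) = Subtype.val ∘ g from rfl, ← MeasurableSpace.comap_comp]
      rfl
    rw [this]
    exact h1
  have heval : Measurable fun p : ℝ≥0 × C => p.2.1 p.1 :=
    measurable_uncurry_of_continuous_of_measurable (u := fun (t : ℝ≥0) (w : C) => w.1 t)
      (fun w => w.2) (fun t => (measurable_pi_apply t).comp measurable_subtype_coe)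
  have hev : ∀ i : Fin 4, Measurable fun p : C × (Fin 4 → ℝ≥0) => p.1.1 (p.2 i) := fun i =>
    heval.comp (show Measurable fun p : C × (Fin 4 → ℝ≥0) => (p.2 i, p.1) by fun_prop)
  have hG : Measurable fun p : C × (Fin 4 → ℝ≥0) =>
      F ((p.1.1 (p.2 1)).1 - (p.1.1 (p.2 0)).1, (p.1.1 (p.2 3)).2 - (p.1.1 (p.2 2)).2) :=
    hF.comp (((hev 1).fst.sub (hev 0).fst).prodMk ((hev 3).snd.sub (hev 2).snd))
  have hpair : Measurable fun ω => (g ω, τ ω) := hgm.prodMk hτ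
  have hκ : ∀ u : Fin 4 → ℝ≥0,
      ∫⁻ ω', F (W (u 1) ω' - W (u 0) ω', V (u 3) ω' - V (u 2) ω') ∂P
        = ∫⁻ w, F ((w.1 (u 1)).1 - (w.1 (u 0)).1, (w.1 (u 3)).2 - (w.1 (u 2)).2) ∂(P.map g) := by
    intro u
    have hGu : Measurable fun w : C =>
        F ((w.1 (u 1)).1 - (w.1 (u 0)).1, (w.1 (u 3)).2 - (w.1 (u 2)).2) :=
      hG.comp (measurable_id.prodMk measurable_const)
    rw [lintegral_map hGu hgm]
    apply lintegral_congr_ae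
    filter_upwards [hae] with ω hω
    simp only [hgval ω hω]
  have hprob := Measure.isProbabilityMeasure_map (μ := P) hgm.aemeasurable
  have hprob' := Measure.isProbabilityMeasure_map (μ := P) hτ.aemeasurable
  refine ⟨?_, ?_, ?_, ?_⟩
  · have h1 : ∫⁻ ω, F (W (τ ω 1) ω - W (τ ω 0) ω, V (τ ω 3) ω - V (τ ω 2) ω) ∂P
        = ∫⁻ ω, F (((g ω).1 (τ ω 1)).1 - ((g ω).1 (τ ω 0)).1,
          ((g ω).1 (τ ω 3)).2 - ((g ω).1 (τ ω 2)).2) ∂P := by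
      apply lintegral_congr_ae
      filter_upwards [hae] with ω hω
      simp only [hgval ω hω]
    simp_rw [hκ]
    rw [h1, ← lintegral_map hG hpair,
      (indepFun_iff_map_prod_eq_prod_map_map hgm.aemeasurable hτ.aemeasurable).1 hind,
      lintegral_prod_symm _ hG.aemeasurable,
      lintegral_map (Measurable.lintegral_prod_left' hG) hτ]
  · refine ⟨fun ω => ((g ω).1 (τ ω 1)).1 - ((g ω).1 (τ ω 0)).1,
      ((hev 1).comp hpair).fst.sub ((hev 0).comp hpair).fst, ?_⟩
    filter_upwards [hae] with ω hω
    simp only [hgval ω hω]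
  · refine ⟨fun ω => ((g ω).1 (τ ω 3)).2 - ((g ω).1 (τ ω 2)).2,
      ((hev 3).comp hpair).snd.sub ((hev 2).comp hpair).snd, ?_⟩
    filter_upwards [hae] with ω hω
    simp only [hgval ω hω]
  · simp_rw [hκ]
    exact Measurable.lintegral_prod_left' hG

namespace ProbabilityTheory.IsPreBrownianReal

variable {W W' : ℝ≥0 → Ω → ℝ} {ρ : ℝ}

theorem hasLaw_increment (hW : IsPreBrownianReal W P) (u v : ℝ≥0) :
    HasLaw (fun ω => W v ω - W u ω) (gaussianReal 0 (nndist (v : ℝ) u)) P :=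
  hW.hasLaw_sub v u

theorem indepFun_increments (hW : IsPreBrownianReal W P) {u v w z : ℝ≥0} (huv : u ≤ v)
    (hvw : v ≤ w) (hwz : w ≤ z) :
    IndepFun (fun ω => W v ω - W u ω) (fun ω => W z ω - W w ω) P := by
  have hmono : Monotone ![u, v, w, z] := by
    refine Fin.monotone_iff_le_succ.2 fun i => ?_
    fin_cases i
    · exact huv
    · exact hvw
    · exact hwz
  exact (hW.hasIndepIncrements 3 ![u, v, w, z] hmono).indepFun (i := 0) (j := 2) (by decide)

theorem indepFun_increment_of_indepFun (hI : IndepFun (fun ω t => W t ω) (fun ω t => W' t ω) P)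
    (u v w z : ℝ≥0) :
    IndepFun (fun ω => (W v ω - W u ω, W z ω - W w ω)) (fun ω => W' z ω - W' w ω) P :=
  hI.comp (φ := fun f : ℝ≥0 → ℝ => (f v - f u, f z - f w)) (ψ := fun f : ℝ≥0 → ℝ => f z - f w)
    (by fun_prop) (by fun_prop)

theorem correlated_sub {Ω : Type*} (ρ : ℝ) (W W' : ℝ≥0 → Ω → ℝ) (w z : ℝ≥0) (ω : Ω) :
    correlated ρ W W' z ω - correlated ρ W W' w ω
      = ρ * (W z ω - W w ω) + √(1 - ρ ^ 2) * (W' z ω - W' w ω) := by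
  unfold correlated
  ring

theorem hasLaw_correlated_increment (hW : IsPreBrownianReal W P) (hW' : IsPreBrownianReal W' P)
    (hI : IndepFun (fun ω t => W t ω) (fun ω t => W' t ω) P) (hρ : ρ ∈ Icc (-1 : ℝ) 1)
    (w z : ℝ≥0) :
    HasLaw (fun ω => correlated ρ W W' z ω - correlated ρ W W' w ω)
      (gaussianReal 0 (nndist (z : ℝ) w)) P := by
  have h1 := gaussianReal_const_mul (hW.hasLaw_increment w z) ρ
  have h2 := gaussianReal_const_mul (hW'.hasLaw_increment w z) (√(1 - ρ ^ 2))
  have hind : IndepFun (fun ω => ρ * (W z ω - W w ω)) (fun ω => √(1 - ρ ^ 2) * (W' z ω - W' w ω))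
      P :=
    (indepFun_increment_of_indepFun hI w z w z).comp (φ := fun p : ℝ × ℝ => ρ * p.1)
      (ψ := fun x : ℝ => √(1 - ρ ^ 2) * x) (by fun_prop) (by fun_prop)
  have h3 := gaussianReal_add_gaussianReal_of_indepFun hind h1.map_eq h2.map_eq
  have h4 : (fun ω => correlated ρ W W' z ω - correlated ρ W W' w ω)
      = (fun ω => ρ * (W z ω - W w ω)) + fun ω => √(1 - ρ ^ 2) * (W' z ω - W' w ω) := by
    ext ω
    exact correlated_sub ρ W W' w z ω
  have hρ2 : 0 ≤ 1 - ρ ^ 2 := by nlinarith [hρ.1, hρ.2]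
  rw [h4]
  refine ⟨h1.aemeasurable.add h2.aemeasurable, h3.trans ?_⟩
  rw [mul_zero, mul_zero, add_zero]
  congr 1
  ext
  push_cast
  rw [Real.sq_sqrt hρ2]
  ring

theorem coe_nndist_of_le {u v : ℝ≥0} (huv : u ≤ v) : ((nndist (v : ℝ) u : ℝ≥0) : ℝ) = v - u := by
  rw [coe_nndist, Real.dist_eq, abs_of_nonneg (sub_nonneg.2 (NNReal.coe_le_coe.2 huv))]

/-- When `ρ = 0` or the intervals do not overlap, the first increment is independent of `ρ` times
the second increment of `W`, and the `W'` part is independent of both. So it is independent of their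
sum, and the mean of the product factors. -/
theorem lintegral_abs_mul_abs_increments [IsProbabilityMeasure P] (hWm : ∀ t, Measurable (W t))
    (hWm' : ∀ t, Measurable (W' t))
    (hW : IsPreBrownianReal W P) (hW' : IsPreBrownianReal W' P)
    (hI : IndepFun (fun ω t => W t ω) (fun ω t => W' t ω) P) (hρ : ρ ∈ Icc (-1 : ℝ) 1)
    {u v w z : ℝ≥0} (huv : u ≤ v) (hwz : w ≤ z) (h : ρ = 0 ∨ v ≤ w ∨ z ≤ u) :
    ∫⁻ ω, ENNReal.ofReal (|W v ω - W u ω| * |correlated ρ W W' z ω - correlated ρ W W' w ω|) ∂P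
      = ENNReal.ofReal (2 / Real.pi * (√(v - u) * √(z - w))) := by
  have hm1 : Measurable fun ω => W v ω - W u ω := (hWm v).sub (hWm u)
  have hm2 : Measurable fun ω => W z ω - W w ω := (hWm z).sub (hWm w)
  have hm3 : Measurable fun ω => W' z ω - W' w ω := (hWm' z).sub (hWm' w)
  have h1 : IndepFun (fun ω => W v ω - W u ω) (fun ω => ρ * (W z ω - W w ω)) P := by
    rcases h with rfl | h | h
    · simp_rw [zero_mul]
      exact indepFun_const_right _ _
    · exact (hW.indepFun_increments huv h hwz).comp measurable_id (measurable_const_mul ρ)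
    · exact (hW.indepFun_increments hwz h huv).symm.comp measurable_id (measurable_const_mul ρ)
  have h2 : IndepFun (fun ω => (W v ω - W u ω, ρ * (W z ω - W w ω)))
      (fun ω => √(1 - ρ ^ 2) * (W' z ω - W' w ω)) P :=
    (indepFun_increment_of_indepFun hI u v w z).comp (φ := fun p : ℝ × ℝ => (p.1, ρ * p.2))
      (ψ := fun x : ℝ => √(1 - ρ ^ 2) * x) (by fun_prop) (by fun_prop)
  have h3 := IndepFun.prodMk_right_of_prodMk_left hm1.aemeasurable
    (hm2.const_mul ρ).aemeasurable (hm3.const_mul _).aemeasurable h1 h2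
  have h4 : IndepFun (fun ω => ENNReal.ofReal |W v ω - W u ω|)
      (fun ω => ENNReal.ofReal |correlated ρ W W' z ω - correlated ρ W W' w ω|) P := by
    have := h3.comp (φ := fun x : ℝ => ENNReal.ofReal |x|)
      (ψ := fun p : ℝ × ℝ => ENNReal.ofReal |p.1 + p.2|) (by fun_prop) (by fun_prop)
    simp_rw [correlated_sub]
    exact this
  have hm4 : Measurable fun ω => correlated ρ W W' z ω - correlated ρ W W' w ω := by
    simp_rw [correlated_sub]
    fun_prop
  have h5 := lintegral_mul_eq_lintegral_mul_lintegral_of_indepFun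
    (hm1.abs.ennreal_ofReal) (hm4.abs.ennreal_ofReal) h4
  simp_rw [ENNReal.ofReal_mul (abs_nonneg _)]
  refine h5.trans ?_
  rw [lintegral_abs_of_hasLaw_gaussianReal (hW.hasLaw_increment u v),
    lintegral_abs_of_hasLaw_gaussianReal (hasLaw_correlated_increment hW hW' hI hρ w z),
    ← ENNReal.ofReal_mul (by positivity), coe_nndist_of_le huv, coe_nndist_of_le hwz]
  congr 1
  have hpi : √(2 / Real.pi) * √(2 / Real.pi) = 2 / Real.pi :=
    Real.mul_self_sqrt (by positivity)
  linear_combination (√((v : ℝ) - u) * √((z : ℝ) - w)) * hpi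

/-- Holds even for overlapping intervals, by `|xy| ≤ x² + y²`. It supplies the domination at values
of `h` where independence is not available. -/
theorem lintegral_abs_mul_abs_increments_le [IsProbabilityMeasure P]
    (hW : IsPreBrownianReal W P) (hW' : IsPreBrownianReal W' P)
    (hI : IndepFun (fun ω t => W t ω) (fun ω t => W' t ω) P) (hρ : ρ ∈ Icc (-1 : ℝ) 1)
    {u v w z : ℝ≥0} (huv : u ≤ v) (hwz : w ≤ z) :
    ∫⁻ ω, ENNReal.ofReal (|W v ω - W u ω| * |correlated ρ W W' z ω - correlated ρ W W' w ω|) ∂P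
      ≤ ENNReal.ofReal ((v - u) + (z - w)) := by
  have h1 := hW.hasLaw_increment u v
  have h2 := hasLaw_correlated_increment hW hW' hI hρ w z
  have hnn1 : (0 : ℝ) ≤ v - u := sub_nonneg.2 (NNReal.coe_le_coe.2 huv)
  have hnn2 : (0 : ℝ) ≤ z - w := sub_nonneg.2 (NNReal.coe_le_coe.2 hwz)
  calc _ ≤ ∫⁻ ω, (ENNReal.ofReal ((W v ω - W u ω) ^ 2)
        + ENNReal.ofReal ((correlated ρ W W' z ω - correlated ρ W W' w ω) ^ 2)) ∂P := by
        refine lintegral_mono fun ω => ?_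
        rw [← ENNReal.ofReal_add (sq_nonneg _) (sq_nonneg _)]
        apply ENNReal.ofReal_le_ofReal
        set x := W v ω - W u ω
        set y := correlated ρ W W' z ω - correlated ρ W W' w ω
        rw [← sq_abs x, ← sq_abs y]
        nlinarith [sq_nonneg (|x| - |y|), abs_nonneg x, abs_nonneg y]
    _ = ENNReal.ofReal ((v - u) + (z - w)) := by
        rw [lintegral_add_left' ((h1.aemeasurable.pow_const 2).ennreal_ofReal),
          lintegral_sq_of_hasLaw_gaussianReal h1, lintegral_sq_of_hasLaw_gaussianReal h2,
          coe_nndist_of_le huv, coe_nndist_of_le hwz, ENNReal.ofReal_add hnn1 hnn2]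

end ProbabilityTheory.IsPreBrownianReal

/-! ### Passing to the limit in the mean. -/

/-- Dominated convergence with a bound that is fixed up to an error vanishing in mean. -/
theorem tendsto_integral_of_le_add {ι : Type*} {l : Filter ι} [l.IsCountablyGenerated]
    {F : ι → Ω → ℝ} {f g : Ω → ℝ} {v : ι → Ω → ℝ} (hf : ∀ᵐ ω ∂P, |f ω| ≤ g ω)
    (hF : ∀ᶠ i in l, AEStronglyMeasurable (F i) P) (hg : Integrable g P)
    (hv : ∀ᶠ i in l, Integrable (v i) P) (hv0 : ∀ᶠ i in l, ∀ ω, 0 ≤ v i ω)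
    (hvlim : Tendsto (fun i => ∫ ω, v i ω ∂P) l (𝓝 0))
    (hbound : ∀ᶠ i in l, ∀ᵐ ω ∂P, |F i ω| ≤ g ω + v i ω)
    (hlim : ∀ᵐ ω ∂P, Tendsto (fun i => F i ω) l (𝓝 (f ω))) :
    Tendsto (fun i => ∫ ω, F i ω ∂P) l (𝓝 (∫ ω, f ω ∂P)) := by
  -- Truncating `F i` at `±g` brings it under ordinary dominated convergence, and the part cut off
  -- is at most `v i`.
  set c : ι → Ω → ℝ := fun i ω => max (-g ω) (min (g ω) (F i ω)) with hc
  have hg0 : ∀ᵐ ω ∂P, 0 ≤ g ω := hf.mono fun ω h => (abs_nonneg _).trans h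
  have hcm : ∀ᶠ i in l, AEStronglyMeasurable (c i) P := by
    filter_upwards [hF] with i hi
    exact hg.1.neg.sup (hg.1.inf hi)
  have hcb : ∀ i, ∀ᵐ ω ∂P, |c i ω| ≤ g ω := by
    intro i
    filter_upwards [hg0] with ω h0
    exact abs_le.2 ⟨le_max_left _ _, max_le (by linarith) (min_le_left _ _)⟩
  have h1 : Tendsto (fun i => ∫ ω, c i ω ∂P) l (𝓝 (∫ ω, f ω ∂P)) := by
    refine tendsto_integral_filter_of_dominated_convergence g hcm
      (Eventually.of_forall fun i => (hcb i).mono fun ω h => h) hg ?_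
    filter_upwards [hlim, hf] with ω h h'
    have h2 := abs_le.1 h'
    have h3 : Tendsto (fun i => c i ω) l (𝓝 (max (-g ω) (min (g ω) (f ω)))) :=
      tendsto_const_nhds.max (tendsto_const_nhds.min h)
    rwa [min_eq_right h2.2, max_eq_right h2.1] at h3
  have h2 : Tendsto (fun i => ∫ ω, F i ω ∂P - ∫ ω, c i ω ∂P) l (𝓝 0) := by
    refine squeeze_zero_norm' ?_ hvlim
    filter_upwards [hF, hv, hv0, hbound, hcm] with i h1 h2 h3 h4 h5
    have hFi : Integrable (F i) P := (hg.add h2).mono' h1 (h4.mono fun ω h => h)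
    have hci : Integrable (c i) P := hg.mono' h5 ((hcb i).mono fun ω h => h)
    rw [← integral_sub hFi hci]
    refine (norm_integral_le_integral_norm _).trans (integral_mono_ae (hFi.sub hci).norm h2 ?_)
    filter_upwards [h4, hg0] with ω h h0
    have h6 := abs_le.1 h
    have h7 := h3 ω
    simp only [hc, Real.norm_eq_abs]
    rw [abs_le]
    constructor
    · have : max (-g ω) (min (g ω) (F i ω)) ≤ F i ω + v i ω :=
        max_le (by linarith) ((min_le_right _ _).trans (by linarith))
      linarith
    · rcases le_total (g ω) (F i ω) with h8 | h8
      · rw [min_eq_left h8]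
        linarith [le_max_right (-g ω) (g ω)]
      · rw [min_eq_right h8]
        linarith [le_max_right (-g ω) (F i ω)]
  simpa using h2.add h1

theorem lintegral_natCast_poissonMeasure (r : ℝ≥0) :
    ∫⁻ n, (n : ENNReal) ∂(poissonMeasure r) = r := by
  rw [lintegral_countable', tsum_eq_zero_add' ENNReal.summable]
  have h : ∀ n : ℕ, ((n + 1 : ℕ) : ENNReal) * poissonMeasure r {n + 1}
      = r * poissonMeasure r {n} := by
    intro n
    rw [poissonMeasure_singleton, poissonMeasure_singleton, ← ENNReal.ofReal_natCast,
      ← ENNReal.ofReal_coe_nnreal, ← ENNReal.ofReal_mul (by positivity),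
      ← ENNReal.ofReal_mul (by positivity)]
    congr 1
    rw [Nat.factorial_succ]
    push_cast
    field_simp
    ring
  simp_rw [h]
  have h1 : ∑' n : ℕ, poissonMeasure r {n} = 1 := by
    have := lintegral_countable' (μ := poissonMeasure r) (fun _ : ℕ => (1 : ENNReal))
    simpa using this.symm
  rw [ENNReal.tsum_mul_left, h1]
  simp

theorem IsPoissonPointProcess.lintegral_pointCount {T : Ω → Set ℝ} {r : ℝ≥0}
    (hT : IsPoissonPointProcess T r P) (x h : ℝ) :
    ∫⁻ ω, (pointCount T (Ioc x (x + h)) ω : ENNReal) ∂P = ENNReal.ofReal (r * h) := by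
  have hb := Metric.isBounded_Ioc x (x + h)
  rw [(hT.hasLaw _ measurableSet_Ioc hb).lintegral_comp (f := fun n : ℕ => (n : ENNReal))
    (by fun_prop), lintegral_natCast_poissonMeasure, Real.volume_Ioc, add_sub_cancel_left,
    ENNReal.ofReal_mul r.coe_nonneg, ENNReal.ofReal_coe_nnreal, ENNReal.coe_mul]
  rfl

/-- The number of points in short intervals is dominated by a random variable whose mean is
proportional to the length. -/
def HasCardBound (T : Ω → Set ℝ) (P : Measure Ω) (M : ℝ) : Prop :=
  ∀ x h : ℝ, 0 ≤ h → ∃ n : Ω → ℝ, Measurable n ∧ (∀ ω, ((T ω ∩ Ioc x (x + h)).ncard : ℝ) ≤ n ω) ∧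
    Integrable n P ∧ ∫ ω, n ω ∂P ≤ M * h

theorem IsPoissonPointProcess.hasCardBound_union {T T' : Ω → Set ℝ} {r r' : ℝ≥0}
    (hT : IsPoissonPointProcess T r P) (hT' : IsPoissonPointProcess T' r' P) :
    HasCardBound (fun ω => T ω ∪ T' ω) P (r + r') := by
  intro x h hh
  have hb := Metric.isBounded_Ioc x (x + h)
  have key : ∀ {T : Ω → Set ℝ} {r : ℝ≥0}, IsPoissonPointProcess T r P →
      Measurable (fun ω => (pointCount T (Ioc x (x + h)) ω : ℝ)) ∧
      Integrable (fun ω => (pointCount T (Ioc x (x + h)) ω : ℝ)) P ∧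
      ∫ ω, (pointCount T (Ioc x (x + h)) ω : ℝ) ∂P = r * h := by
    intro T r hT
    have hm : Measurable (fun ω => (pointCount T (Ioc x (x + h)) ω : ℝ)) :=
      measurable_from_top.comp (hT.measurable _ measurableSet_Ioc hb)
    have h1 : ∫⁻ ω, ENNReal.ofReal (pointCount T (Ioc x (x + h)) ω : ℝ) ∂P
        = ENNReal.ofReal (r * h) := by
      simp_rw [ENNReal.ofReal_natCast]
      exact hT.lintegral_pointCount x h
    refine ⟨hm, ⟨hm.aestronglyMeasurable, ?_⟩, ?_⟩
    · rw [hasFiniteIntegral_iff_ofReal (Eventually.of_forall fun ω => Nat.cast_nonneg _), h1]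
      exact ENNReal.ofReal_lt_top
    · rw [integral_eq_lintegral_of_nonneg_ae (Eventually.of_forall fun ω => Nat.cast_nonneg _)
        hm.aestronglyMeasurable, h1, ENNReal.toReal_ofReal (by positivity)]
  obtain ⟨m1, i1, e1⟩ := key hT
  obtain ⟨m2, i2, e2⟩ := key hT'
  refine ⟨_, m1.add m2, fun ω => ?_, i1.add i2, ?_⟩
  · simp only [Pi.add_apply, pointCount]
    rw [union_inter_distrib_right]
    exact_mod_cast ncard_union_le _ _
  · simp only [Pi.add_apply]
    rw [integral_add i1 i2, e1, e2, add_mul]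

/-- The increments of the time change of a Poisson set over short intervals. -/
theorem IsPoissonSet.timeChange_increment_bound [IsProbabilityMeasure P] {T : Ω → Set ℝ} {r : ℝ≥0}
    (hT : IsPoissonSet T r P) (hr : 0 < r) {M : ℝ} (hM : HasCardBound T P M) {D σ : ℝ}
    (hD : D ∈ Ioc (0 : ℝ) (1 / 2)) {s : ℝ} (hs : 0 ≤ s) :
    ∃ v : ℝ → Ω → ℝ, (∀ h ω, 0 < h → 0 ≤ v h ω) ∧ (∀ h, 0 < h → Integrable (v h) P) ∧
      Tendsto (fun h => ∫ ω, v h ω ∂P) (𝓝[>] 0) (𝓝 0) ∧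
      ∀ h, 0 < h → ∀ᵐ ω ∂P, (timeChange D σ (T ω) (s + h) - timeChange D σ (T ω) s) / h
        ≤ σ ^ 2 * (2 * D * (s - lastPoint (T ω) s) ^ (2 * D - 1)) + v h ω := by
  choose! n hnm hncard hni hnM using fun h (hh : 0 ≤ h) => hM s h hh
  have hn0 : ∀ h, 0 ≤ h → ∀ ω, 0 ≤ n h ω := fun h hh ω => (Nat.cast_nonneg _).trans (hncard h hh ω)
  -- When there is a shock, the number of pieces `N + 1` is at most `2N`, whence the factor `2` and
  -- an error that the mean of `n h` controls.
  refine ⟨fun h ω => 2 * σ ^ 2 * h ^ (2 * D - 1) * n h ω, ?_, ?_, ?_, ?_⟩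
  · intro h ω hh
    have := hn0 h hh.le ω
    positivity
  · intro h hh
    exact (hni h hh.le).const_mul _
  · have hlim : Tendsto (fun h : ℝ => 2 * σ ^ 2 * M * h ^ (2 * D)) (𝓝[>] 0) (𝓝 0) := by
      have : ContinuousAt (fun h : ℝ => h ^ (2 * D)) 0 :=
        Real.continuousAt_rpow_const _ _ (Or.inr (by linarith [hD.1]))
      have h1 := (this.tendsto.mono_left (nhdsWithin_le_nhds (s := Ioi 0))).const_mul
        (2 * σ ^ 2 * M)
      rwa [Real.zero_rpow (by linarith [hD.1]), mul_zero] at h1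
    refine squeeze_zero' ?_ ?_ hlim
    · filter_upwards [self_mem_nhdsWithin] with h (hh : 0 < h)
      refine integral_nonneg fun ω => ?_
      have := hn0 h hh.le ω
      simp only [Pi.zero_apply]
      positivity
    · filter_upwards [self_mem_nhdsWithin] with h (hh : 0 < h)
      rw [integral_const_mul]
      calc 2 * σ ^ 2 * h ^ (2 * D - 1) * ∫ ω, n h ω ∂P
          ≤ 2 * σ ^ 2 * h ^ (2 * D - 1) * (M * h) := by
            gcongr
            exact hnM h hh.le
        _ = 2 * σ ^ 2 * M * h ^ (2 * D) := by
            rw [Real.rpow_sub_one hh.ne']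
            field_simp
  · intro h hh
    filter_upwards [hT.ae_isShockSet hr, hT.ae_notMem s] with ω hω hsω
    rw [div_le_iff₀ hh]
    have hpos : 0 < s - lastPoint (T ω) s := sub_pos.2 (hω.isGreatest_lastPoint hs).1.2
    have hg0 : 0 ≤ σ ^ 2 * (2 * D * (s - lastPoint (T ω) s) ^ (2 * D - 1)) := by
      have := hD.1
      positivity
    rcases (T ω ∩ Ioc s (s + h)).eq_empty_or_nonempty with he | hne
    · have h1 := hω.timeChange_sub_le_of_empty hD.1 hD.2 σ hs hsω hh.le he
      have h2 : 0 ≤ 2 * σ ^ 2 * h ^ (2 * D - 1) * n h ω * h := by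
        have := hn0 h hh.le ω
        positivity
      rw [add_mul]
      linarith
    · have h1 := hω.timeChange_sub_le_card hD.1 hD.2 σ hs hh.le
      have hfin := hω.locFin _ (Metric.isBounded_Ioc s (s + h))
      have h2 : (1 : ℝ) ≤ (T ω ∩ Ioc s (s + h)).ncard := by
        exact_mod_cast (ncard_pos hfin).2 hne
      have h3 := hncard h hh.le ω
      have h4 : h ^ (2 * D) = h ^ (2 * D - 1) * h := by
        rw [Real.rpow_sub_one hh.ne']
        field_simp
      have h5 : σ ^ 2 * (((T ω ∩ Ioc s (s + h)).ncard + 1) * h ^ (2 * D))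
          ≤ σ ^ 2 * ((2 * n h ω) * h ^ (2 * D)) := by
        gcongr
        linarith
      rw [h4] at h1 h5
      have h6 := mul_nonneg hg0 hh.le
      rw [add_mul]
      linarith

/-- The nonnegative random quantities `δ h` are of order `h` as `h ↓ 0`, with almost sure slope `g`
and a bound that is integrable up to an error vanishing in mean. -/
structure HasMeanSlope (δ : ℝ → Ω → ℝ) (g : Ω → ℝ) (P : Measure Ω) : Prop where
  measurable : ∀ h, Measurable (δ h)
  nonneg : ∀ᵐ ω ∂P, ∀ h, 0 < h → 0 ≤ δ h ω
  integrable_slope : Integrable g P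
  bound : ∃ v : ℝ → Ω → ℝ, (∀ h ω, 0 < h → 0 ≤ v h ω) ∧ (∀ h, 0 < h → Integrable (v h) P) ∧
    Tendsto (fun h => ∫ ω, v h ω ∂P) (𝓝[>] 0) (𝓝 0) ∧
    ∀ h, 0 < h → ∀ᵐ ω ∂P, δ h ω / h ≤ g ω + v h ω
  tendsto_div : ∀ᵐ ω ∂P, Tendsto (fun h => δ h ω / h) (𝓝[>] 0) (𝓝 (g ω))

namespace HasMeanSlope

variable {δ ε : ℝ → Ω → ℝ} {g k : Ω → ℝ}

theorem slope_nonneg (hδ : HasMeanSlope δ g P) : ∀ᵐ ω ∂P, 0 ≤ g ω := by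
  filter_upwards [hδ.nonneg, hδ.tendsto_div] with ω h1 h2
  refine ge_of_tendsto h2 ?_
  filter_upwards [self_mem_nhdsWithin] with h (hh : 0 < h)
  exact div_nonneg (h1 h hh) hh.le

theorem integrable (hδ : HasMeanSlope δ g P) {h : ℝ} (hh : 0 < h) : Integrable (δ h) P := by
  obtain ⟨v, -, hv, -, hb⟩ := hδ.bound
  refine ((hδ.integrable_slope.add (hv h hh)).const_mul h).mono'
    (hδ.measurable h).aestronglyMeasurable ?_
  filter_upwards [hb h hh, hδ.nonneg] with ω h1 h2
  rw [Real.norm_of_nonneg (h2 h hh), mul_comm]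
  exact (div_le_iff₀ hh).1 h1

theorem memLp_sqrt_slope (hδ : HasMeanSlope δ g P) : MemLp (fun ω => √(g ω)) 2 P := by
  refine (memLp_two_iff_integrable_sq
    (Real.continuous_sqrt.comp_aestronglyMeasurable hδ.integrable_slope.1)).2 ?_
  refine hδ.integrable_slope.congr ?_
  filter_upwards [hδ.slope_nonneg] with ω h
  exact (Real.sq_sqrt h).symm

/-- Square roots inherit the domination through `√x ≤ 1 + x`. -/
theorem tendsto_integral_sqrt [IsFiniteMeasure P] (hδ : HasMeanSlope δ g P) :
    Tendsto (fun h => ∫ ω, √(δ h ω / h) ∂P) (𝓝[>] 0) (𝓝 (∫ ω, √(g ω) ∂P)) := by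
  have hsqrt : ∀ x : ℝ, 0 ≤ x → √x ≤ 1 + x := fun x hx => by
    nlinarith [Real.sq_sqrt hx, Real.sqrt_nonneg x]
  obtain ⟨v, hv0, hv, hvl, hb⟩ := hδ.bound
  refine tendsto_integral_of_le_add (g := fun ω => 1 + g ω) (v := v) ?_ ?_
    ((integrable_const 1).add hδ.integrable_slope) ?_ ?_ hvl ?_ ?_
  · filter_upwards [hδ.slope_nonneg] with ω h
    rw [abs_of_nonneg (Real.sqrt_nonneg _)]
    exact hsqrt _ h
  · exact Eventually.of_forall fun h =>
      ((hδ.measurable h).div_const h).sqrt.aestronglyMeasurable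
  · filter_upwards [self_mem_nhdsWithin] with h hh using hv h hh
  · filter_upwards [self_mem_nhdsWithin] with h hh ω using hv0 h ω hh
  · filter_upwards [self_mem_nhdsWithin] with h (hh : 0 < h)
    filter_upwards [hb h hh, hδ.nonneg] with ω h1 h2
    rw [abs_of_nonneg (Real.sqrt_nonneg _)]
    linarith [hsqrt _ (div_nonneg (h2 h hh) hh.le)]
  · filter_upwards [hδ.tendsto_div] with ω h using h.sqrt

theorem tendsto_integral_mul (hδ : HasMeanSlope δ g P) (hε : HasMeanSlope ε k P)
    {c : ℝ} (hc : 0 ≤ c) (hc1 : c ≤ 1) {K : ℝ → Ω → ℝ} (hK : ∀ h, AEStronglyMeasurable (K h) P)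
    (hK0 : ∀ h ω, 0 ≤ K h ω) (hKle : ∀ h, 0 < h → ∀ᵐ ω ∂P, K h ω ≤ δ h ω + ε h ω)
    (hKeq : ∀ᵐ ω ∂P, ∀ᶠ h in 𝓝[>] (0 : ℝ), K h ω = c * (√(δ h ω) * √(ε h ω))) :
    Tendsto (fun h => ∫ ω, K h ω / h ∂P) (𝓝[>] 0) (𝓝 (∫ ω, c * (√(g ω) * √(k ω)) ∂P)) := by
  obtain ⟨v, hv0, hv, hvl, hb⟩ := hδ.bound
  obtain ⟨w, hw0, hw, hwl, hb'⟩ := hε.bound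
  refine tendsto_integral_of_le_add (g := fun ω => g ω + k ω) (v := fun h ω => v h ω + w h ω) ?_ ?_
    (hδ.integrable_slope.add hε.integrable_slope) ?_ ?_ ?_ ?_ ?_
  · filter_upwards [hδ.slope_nonneg, hε.slope_nonneg] with ω h1 h2
    rw [abs_of_nonneg (by positivity)]
    have h3 := Real.sq_sqrt h1
    have h4 := Real.sq_sqrt h2
    have h5 : 0 ≤ √(g ω) * √(k ω) := by positivity
    nlinarith [sq_nonneg (√(g ω) - √(k ω))]
  · exact Eventually.of_forall fun h => by
      simp_rw [div_eq_mul_inv]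
      exact (hK h).mul_const _
  · filter_upwards [self_mem_nhdsWithin] with h hh using (hv h hh).add (hw h hh)
  · filter_upwards [self_mem_nhdsWithin] with h hh ω using add_nonneg (hv0 h ω hh) (hw0 h ω hh)
  · have h1 := hvl.add hwl
    rw [add_zero] at h1
    refine h1.congr' ?_
    filter_upwards [self_mem_nhdsWithin] with h hh using (integral_add (hv h hh) (hw h hh)).symm
  · filter_upwards [self_mem_nhdsWithin] with h (hh : 0 < h)
    filter_upwards [hb h hh, hb' h hh, hKle h hh] with ω h1 h2 h3
    rw [abs_of_nonneg (div_nonneg (hK0 h ω) hh.le)]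
    have h4 := div_le_div_of_nonneg_right h3 hh.le
    rw [add_div] at h4
    linarith
  · filter_upwards [hδ.tendsto_div, hε.tendsto_div, hKeq] with ω h1 h2 h3
    refine ((h1.sqrt.mul h2.sqrt).const_mul c).congr' ?_
    filter_upwards [h3, self_mem_nhdsWithin] with h h4 (hh : 0 < h)
    rw [h4, Real.sqrt_div' _ hh.le, Real.sqrt_div' _ hh.le]
    have h5 : √h ≠ 0 := (Real.sqrt_pos.2 hh).ne'
    field_simp
    rw [Real.sq_sqrt hh.le]
    ring

end HasMeanSlope

/-- The first two absolute moments of `x` are those of a centred Gaussian variable whose variance is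
drawn from the law of `δ`. -/
structure HasMixedGaussianMoments (x δ : Ω → ℝ) (P : Measure Ω) : Prop where
  aemeasurable : AEMeasurable x P
  lintegral_abs : ∫⁻ ω, ENNReal.ofReal |x ω| ∂P
    = ∫⁻ ω, ENNReal.ofReal (√(2 / Real.pi) * √(δ ω)) ∂P
  lintegral_sq : ∫⁻ ω, ENNReal.ofReal (x ω ^ 2) ∂P = ∫⁻ ω, ENNReal.ofReal (δ ω) ∂P

theorem HasMixedGaussianMoments.memLp_abs {x δ : Ω → ℝ} (hx : HasMixedGaussianMoments x δ P)
    (hδ : Integrable δ P) : MemLp (fun ω => |x ω|) 2 P := by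
  refine MemLp.abs ((memLp_two_iff_integrable_sq hx.aemeasurable.aestronglyMeasurable).2
    ⟨(hx.aemeasurable.pow_const 2).aestronglyMeasurable, ?_⟩)
  rw [hasFiniteIntegral_iff_ofReal (Eventually.of_forall fun ω => sq_nonneg _), hx.lintegral_sq]
  exact hδ.lintegral_lt_top

theorem HasMixedGaussianMoments.integral_abs {x δ : Ω → ℝ} (hx : HasMixedGaussianMoments x δ P)
    (hδ : Measurable δ) : ∫ ω, |x ω| ∂P = √(2 / Real.pi) * ∫ ω, √(δ ω) ∂P := by
  rw [← integral_const_mul, integral_eq_lintegral_of_nonneg_ae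
    (Eventually.of_forall fun ω => abs_nonneg _) hx.aemeasurable.abs.aestronglyMeasurable,
    integral_eq_lintegral_of_nonneg_ae (Eventually.of_forall fun ω => by positivity)
    (hδ.sqrt.const_mul _).aestronglyMeasurable, hx.lintegral_abs]

/-- `K h` stands for the conditional mean of `|x h| |y h|`. The product of means also has order `h`,
each factor contributing `√h`, so both parts of the covariance survive division by `h` and recombine
into the covariance of the square roots. -/
theorem tendsto_covariance_abs_div [IsProbabilityMeasure P] {x y δ ε K : ℝ → Ω → ℝ} {g k : Ω → ℝ}
    (hδ : HasMeanSlope δ g P) (hε : HasMeanSlope ε k P)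
    (hx : ∀ h, 0 < h → HasMixedGaussianMoments (x h) (δ h) P)
    (hy : ∀ h, 0 < h → HasMixedGaussianMoments (y h) (ε h) P)
    (hK : ∀ h, AEStronglyMeasurable (K h) P) (hK0 : ∀ h ω, 0 ≤ K h ω)
    (hxy : ∀ h, 0 < h → ∫ ω, |x h ω| * |y h ω| ∂P = ∫ ω, K h ω ∂P)
    (hKle : ∀ h, 0 < h → ∀ᵐ ω ∂P, K h ω ≤ δ h ω + ε h ω)
    (hKeq : ∀ᵐ ω ∂P, ∀ᶠ h in 𝓝[>] (0 : ℝ), K h ω = 2 / Real.pi * (√(δ h ω) * √(ε h ω))) :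
    Tendsto (fun h => covariance (fun ω => |x h ω|) (fun ω => |y h ω|) P / h) (𝓝[>] 0)
      (𝓝 (2 / Real.pi * covariance (fun ω => √(g ω)) (fun ω => √(k ω)) P)) := by
  have hπ : 2 / Real.pi ≤ 1 := by
    rw [div_le_one Real.pi_pos]
    exact Real.two_le_pi
  have h1 := hδ.tendsto_integral_mul hε (by positivity) hπ hK hK0 hKle hKeq
  have h2 := (hδ.tendsto_integral_sqrt.mul hε.tendsto_integral_sqrt).const_mul (2 / Real.pi)
  rw [covariance_eq_sub hδ.memLp_sqrt_slope hε.memLp_sqrt_slope, mul_sub]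
  rw [integral_const_mul] at h1
  refine (h1.sub h2).congr' ?_
  filter_upwards [self_mem_nhdsWithin] with h (hh : 0 < h)
  rw [covariance_eq_sub ((hx h hh).memLp_abs (hδ.integrable hh))
    ((hy h hh).memLp_abs (hε.integrable hh)), (hx h hh).integral_abs (hδ.measurable h),
    (hy h hh).integral_abs (hε.measurable h)]
  simp only [Pi.mul_apply]
  rw [hxy h hh]
  simp_rw [Real.sqrt_div' _ hh.le]
  rw [integral_div, integral_div, integral_div]
  have h5 : √h ≠ 0 := (Real.sqrt_pos.2 hh).ne'
  have h6 : √(2 / Real.pi) * √(2 / Real.pi) = 2 / Real.pi := Real.mul_self_sqrt (by positivity)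
  have h7 : √h * √h = h := Real.mul_self_sqrt hh.le
  set a := ∫ ω, √(δ h ω) ∂P
  set b := ∫ ω, √(ε h ω) ∂P
  rw [show a / √h * (b / √h) = a * b / (√h * √h) by field_simp, h7,
    show √(2 / Real.pi) * a * (√(2 / Real.pi) * b)
      = √(2 / Real.pi) * √(2 / Real.pi) * (a * b) by ring, h6]
  ring

/-- The slope is written as a square so that its root is a constant times the power `D - 1/2` of the
age. -/
theorem IsPoissonSet.hasMeanSlope_timeChange [IsProbabilityMeasure P] {T : Ω → Set ℝ} {r : ℝ≥0}
    (hT : IsPoissonSet T r P) (hr : 0 < r) {M : ℝ} (hM : HasCardBound T P M) {D σ : ℝ}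
    (hD : D ∈ Ioc (0 : ℝ) (1 / 2)) (hσ : 0 < σ) {s : ℝ} (hs : 0 ≤ s) :
    HasMeanSlope (fun h ω => timeChange D σ (T ω) (s + h) - timeChange D σ (T ω) s)
      (fun ω => (σ * √(2 * D) * (s - lastPoint (T ω) s) ^ (D - 1 / 2)) ^ 2) P := by
  have hslope : ∀ᵐ ω ∂P, (σ * √(2 * D) * (s - lastPoint (T ω) s) ^ (D - 1 / 2)) ^ 2
      = σ ^ 2 * (2 * D * (s - lastPoint (T ω) s) ^ (2 * D - 1)) := by
    filter_upwards [hT.ae_isShockSet hr] with ω hω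
    have hpos : 0 < s - lastPoint (T ω) s := sub_pos.2 (hω.isGreatest_lastPoint hs).1.2
    rw [mul_pow, mul_pow, Real.sq_sqrt (by linarith [hD.1]), ← Real.rpow_mul_natCast hpos.le]
    push_cast
    rw [show (D - 1 / 2) * 2 = 2 * D - 1 by ring, mul_assoc]
  refine ⟨fun h => (hT.random.measurable_timeChange D σ _).sub
    (hT.random.measurable_timeChange D σ _), ?_, ?_, ?_, ?_⟩
  · filter_upwards [hT.ae_isShockSet hr] with ω hω h hh
    exact sub_nonneg.2 (hω.timeChange_le hD.1 hσ hs (by linarith))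
  · exact ((hT.memLp_sub_lastPoint_rpow hr s hD.1 hD.2).const_mul (σ * √(2 * D))).integrable_sq
  · obtain ⟨v, hv0, hv, hvl, hb⟩ := hT.timeChange_increment_bound hr hM (σ := σ) hD hs
    refine ⟨v, hv0, hv, hvl, fun h hh => ?_⟩
    filter_upwards [hb h hh, hslope] with ω h1 h2
    rwa [h2]
  · filter_upwards [hT.ae_isShockSet hr, hT.ae_notMem s, hslope] with ω h1 h2 h3
    rw [h3]
    exact h1.tendsto_timeChange_sub_div hD.1 σ hs h2

/-- The operational times at which the two driving processes are read over the periods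
`[s, s + h]` and `[t, t + h]`. -/
noncomputable def operationalTimes (D σ D' σ' : ℝ) (S S' : Set ℝ) (s t h : ℝ) : Fin 4 → ℝ≥0 :=
  ![(timeChange D σ S s).toNNReal, (timeChange D σ S (s + h)).toNNReal,
    (timeChange D' σ' S' t).toNNReal, (timeChange D' σ' S' (t + h)).toNNReal]

theorem measurable_operationalTimes {α : Type*} [MeasurableSpace α] {S S' : α → Set ℝ}
    (hS : IsRandomSet S) (hS' : IsRandomSet S') (D σ D' σ' s t h : ℝ) :
    Measurable fun ω => operationalTimes D σ D' σ' (S ω) (S' ω) s t h := by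
  refine measurable_pi_lambda _ fun i => ?_
  fin_cases i
  · exact (hS.measurable_timeChange D σ s).real_toNNReal
  · exact (hS.measurable_timeChange D σ (s + h)).real_toNNReal
  · exact (hS'.measurable_timeChange D' σ' t).real_toNNReal
  · exact (hS'.measurable_timeChange D' σ' (t + h)).real_toNNReal

theorem IsShockSet.toNNReal_timeChange_le {S : Set ℝ} (hS : IsShockSet S) {D σ : ℝ} (hD : 0 < D)
    (hσ : 0 < σ) {s h : ℝ} (hs : 0 ≤ s) (hh : 0 < h) :
    (timeChange D σ S s).toNNReal ≤ (timeChange D σ S (s + h)).toNNReal :=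
  Real.toNNReal_le_toNNReal (hS.timeChange_le hD hσ hs (by linarith))

theorem IsShockSet.coe_toNNReal_timeChange {S : Set ℝ} (hS : IsShockSet S) {D σ : ℝ} (hD : 0 < D)
    (hσ : 0 < σ) {s : ℝ} (hs : 0 ≤ s) :
    ((timeChange D σ S s).toNNReal : ℝ) = timeChange D σ S s :=
  Real.coe_toNNReal _ (hS.timeChange_nonneg hD hσ hs)

/-! ### The bivariate model. -/

namespace IsBivariateModel

variable {T : Fin 3 → Ω → Set ℝ} {TX TY : Ω → Set ℝ} {l : Fin 3 → ℝ≥0}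
  {WX W' WY : ℝ≥0 → Ω → ℝ} {ρ DX DY σX σY : ℝ}

theorem isPoissonPair [IsProbabilityMeasure P]
    (model : IsBivariateModel P T TX TY l WX W' WY ρ DX DY σX σY) :
    IsPoissonPair TX TY (l 0) (l 1) (l 2) P := by
  rw [model.shocks_X, model.shocks_Y]
  exact isPoissonPair_of_indep model.poisson model.poisson_indep

theorem hasCardBound_X (model : IsBivariateModel P T TX TY l WX W' WY ρ DX DY σX σY) :
    HasCardBound TX P (l 0 + l 1) := by
  rw [model.shocks_X]
  exact (model.poisson 0).hasCardBound_union (model.poisson 1)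

theorem hasCardBound_Y (model : IsBivariateModel P T TX TY l WX W' WY ρ DX DY σX σY) :
    HasCardBound TY P (l 0 + l 2) := by
  rw [model.shocks_Y]
  exact (model.poisson 0).hasCardBound_union (model.poisson 2)

theorem ae_isShockSet_X [IsProbabilityMeasure P]
    (model : IsBivariateModel P T TX TY l WX W' WY ρ DX DY σX σY) :
    ∀ᵐ ω ∂P, IsShockSet (TX ω) :=
  model.isPoissonPair.fst.ae_isShockSet model.rate_X

theorem ae_isShockSet_Y [IsProbabilityMeasure P]
    (model : IsBivariateModel P T TX TY l WX W' WY ρ DX DY σX σY) :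
    ∀ᵐ ω ∂P, IsShockSet (TY ω) :=
  model.isPoissonPair.snd.ae_isShockSet model.rate_Y

theorem hasMeanSlope_X [IsProbabilityMeasure P]
    (model : IsBivariateModel P T TX TY l WX W' WY ρ DX DY σX σY) {s : ℝ} (hs : 0 ≤ s) :
    HasMeanSlope (fun h ω => timeChange DX σX (TX ω) (s + h) - timeChange DX σX (TX ω) s)
      (fun ω => (σX * √(2 * DX) * (s - lastPoint (TX ω) s) ^ (DX - 1 / 2)) ^ 2) P :=
  model.isPoissonPair.fst.hasMeanSlope_timeChange model.rate_X model.hasCardBound_X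
    model.exponent_X model.scale_X hs

theorem hasMeanSlope_Y [IsProbabilityMeasure P]
    (model : IsBivariateModel P T TX TY l WX W' WY ρ DX DY σX σY) {s : ℝ} (hs : 0 ≤ s) :
    HasMeanSlope (fun h ω => timeChange DY σY (TY ω) (s + h) - timeChange DY σY (TY ω) s)
      (fun ω => (σY * √(2 * DY) * (s - lastPoint (TY ω) s) ^ (DY - 1 / 2)) ^ 2) P :=
  model.isPoissonPair.snd.hasMeanSlope_timeChange model.rate_Y model.hasCardBound_Y
    model.exponent_Y model.scale_Y hs

theorem measurable_correlated (model : IsBivariateModel P T TX TY l WX W' WY ρ DX DY σX σY)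
    (t : ℝ≥0) : Measurable (WY t) := by
  rw [model.brownian_Y]
  exact ((model.measurable_X t).const_mul ρ).add ((model.measurable_W' t).const_mul _)

theorem ae_continuous_correlated (model : IsBivariateModel P T TX TY l WX W' WY ρ DX DY σX σY) :
    ∀ᵐ ω ∂P, Continuous fun t => WY t ω := by
  filter_upwards [model.brownian_X.cont, model.brownian_W'.cont] with ω h1 h2
  rw [model.brownian_Y]
  exact (h1.const_mul ρ).add (h2.const_mul _)

/-- The operational times are functions of the two shock sets, measurable for `pointSigma TX ⊔
pointSigma TY` and not merely for the ambient σ-algebra. -/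
theorem indepFun_operationalTimes [IsProbabilityMeasure P]
    (model : IsBivariateModel P T TX TY l WX W' WY ρ DX DY σX σY) (s t h : ℝ) :
    IndepFun (fun ω t => (WX t ω, WY t ω))
      (fun ω => operationalTimes DX σX DY σY (TX ω) (TY ω) s t h) P := by
  rw [IndepFun_iff_Indep]
  refine indep_of_indep_of_le_right model.indep ?_
  exact (@measurable_operationalTimes Ω (pointSigma TX ⊔ pointSigma TY) TX TY
    (isRandomSet_of_pointSigma_le model.isPoissonPair.left.locFin le_sup_left)
    (isRandomSet_of_pointSigma_le model.isPoissonPair.right.locFin le_sup_right)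
    DX σX DY σY s t h).comap_le

theorem lintegral_increments [IsProbabilityMeasure P]
    (model : IsBivariateModel P T TX TY l WX W' WY ρ DX DY σX σY) (s t h : ℝ)
    {F : ℝ × ℝ → ENNReal} (hF : Measurable F) :
    (∫⁻ ω, F (timeChangedProcess WX DX σX TX (s + h) ω - timeChangedProcess WX DX σX TX s ω,
        timeChangedProcess WY DY σY TY (t + h) ω - timeChangedProcess WY DY σY TY t ω) ∂P
      = ∫⁻ ω, (∫⁻ ω', F
        (WX (timeChange DX σX (TX ω) (s + h)).toNNReal ω'
          - WX (timeChange DX σX (TX ω) s).toNNReal ω',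
        WY (timeChange DY σY (TY ω) (t + h)).toNNReal ω'
          - WY (timeChange DY σY (TY ω) t).toNNReal ω') ∂P) ∂P) ∧
    AEMeasurable (fun ω => timeChangedProcess WX DX σX TX (s + h) ω
      - timeChangedProcess WX DX σX TX s ω) P ∧
    AEMeasurable (fun ω => timeChangedProcess WY DY σY TY (t + h) ω
      - timeChangedProcess WY DY σY TY t ω) P ∧
    Measurable fun ω => ∫⁻ ω', F
        (WX (timeChange DX σX (TX ω) (s + h)).toNNReal ω'
          - WX (timeChange DX σX (TX ω) s).toNNReal ω',
        WY (timeChange DY σY (TY ω) (t + h)).toNNReal ω'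
          - WY (timeChange DY σY (TY ω) t).toNNReal ω') ∂P := by
  have hτ := measurable_operationalTimes model.isPoissonPair.left model.isPoissonPair.right
    DX σX DY σY s t h
  obtain ⟨h1, h2, h3, h4⟩ := lintegral_freeze model.measurable_X model.measurable_correlated hτ
    model.brownian_X.cont model.ae_continuous_correlated (model.indepFun_operationalTimes s t h) hF
  exact ⟨h1, h2, h3, h4.comp hτ⟩

/-- With the times frozen, the increment is Brownian over a fixed interval and its variance is the
length of that interval. -/
theorem hasMixedGaussianMoments_X [IsProbabilityMeasure P]
    (model : IsBivariateModel P T TX TY l WX W' WY ρ DX DY σX σY) {s h : ℝ} (hs : 0 ≤ s)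
    (hh : 0 < h) :
    HasMixedGaussianMoments (fun ω => timeChangedProcess WX DX σX TX (s + h) ω
        - timeChangedProcess WX DX σX TX s ω)
      (fun ω => timeChange DX σX (TX ω) (s + h) - timeChange DX σX (TX ω) s) P := by
  have hlaw : ∀ u v, HasLaw (fun ω => WX v ω - WX u ω) (gaussianReal 0 (nndist (v : ℝ) u)) P :=
    model.brownian_X.hasLaw_increment
  have h1 := model.lintegral_increments s s h (F := fun p => ENNReal.ofReal |p.1|) (by fun_prop)
  have h2 := model.lintegral_increments s s h (F := fun p => ENNReal.ofReal (p.1 ^ 2))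
    (by fun_prop)
  have hd : ∀ᵐ ω ∂P, ((nndist ((timeChange DX σX (TX ω) (s + h)).toNNReal : ℝ)
      (timeChange DX σX (TX ω) s).toNNReal : ℝ≥0) : ℝ)
      = timeChange DX σX (TX ω) (s + h) - timeChange DX σX (TX ω) s := by
    filter_upwards [model.ae_isShockSet_X] with ω hω
    rw [IsPreBrownianReal.coe_nndist_of_le
      (hω.toNNReal_timeChange_le model.exponent_X.1 model.scale_X hs hh),
      hω.coe_toNNReal_timeChange model.exponent_X.1 model.scale_X hs,
      hω.coe_toNNReal_timeChange model.exponent_X.1 model.scale_X (by linarith)]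
  refine ⟨h1.2.1, h1.1.trans (lintegral_congr_ae ?_), h2.1.trans (lintegral_congr_ae ?_)⟩
  · filter_upwards [hd] with ω hω
    rw [lintegral_abs_of_hasLaw_gaussianReal (hlaw _ _), hω]
  · filter_upwards [hd] with ω hω
    rw [lintegral_sq_of_hasLaw_gaussianReal (hlaw _ _), ← hω]

theorem hasMixedGaussianMoments_Y [IsProbabilityMeasure P]
    (model : IsBivariateModel P T TX TY l WX W' WY ρ DX DY σX σY) {s h : ℝ} (hs : 0 ≤ s)
    (hh : 0 < h) :
    HasMixedGaussianMoments (fun ω => timeChangedProcess WY DY σY TY (s + h) ω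
        - timeChangedProcess WY DY σY TY s ω)
      (fun ω => timeChange DY σY (TY ω) (s + h) - timeChange DY σY (TY ω) s) P := by
  have hlaw : ∀ u v, HasLaw (fun ω => WY v ω - WY u ω) (gaussianReal 0 (nndist (v : ℝ) u)) P := by
    rw [model.brownian_Y]
    exact IsPreBrownianReal.hasLaw_correlated_increment model.brownian_X.toIsPreBrownianReal
      model.brownian_W'.toIsPreBrownianReal model.brownian_indep model.corr
  have h1 := model.lintegral_increments s s h (F := fun p => ENNReal.ofReal |p.2|) (by fun_prop)
  have h2 := model.lintegral_increments s s h (F := fun p => ENNReal.ofReal (p.2 ^ 2))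
    (by fun_prop)
  have hd : ∀ᵐ ω ∂P, ((nndist ((timeChange DY σY (TY ω) (s + h)).toNNReal : ℝ)
      (timeChange DY σY (TY ω) s).toNNReal : ℝ≥0) : ℝ)
      = timeChange DY σY (TY ω) (s + h) - timeChange DY σY (TY ω) s := by
    filter_upwards [model.ae_isShockSet_Y] with ω hω
    rw [IsPreBrownianReal.coe_nndist_of_le
      (hω.toNNReal_timeChange_le model.exponent_Y.1 model.scale_Y hs hh),
      hω.coe_toNNReal_timeChange model.exponent_Y.1 model.scale_Y hs,
      hω.coe_toNNReal_timeChange model.exponent_Y.1 model.scale_Y (by linarith)]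
  refine ⟨h1.2.2.1, h1.1.trans (lintegral_congr_ae ?_), h2.1.trans (lintegral_congr_ae ?_)⟩
  · filter_upwards [hd] with ω hω
    rw [lintegral_abs_of_hasLaw_gaussianReal (hlaw _ _), hω]
  · filter_upwards [hd] with ω hω
    rw [lintegral_sq_of_hasLaw_gaussianReal (hlaw _ _), ← hω]

theorem tendsto_covariance_absReturn_div [IsProbabilityMeasure P]
    (model : IsBivariateModel P T TX TY l WX W' WY ρ DX DY σX σY) {s t : ℝ} (hs : 0 ≤ s)
    (ht : 0 ≤ t)
    (hne : ρ = 0 ∨ ∀ᵐ ω ∂P, timeChange DX σX (TX ω) s ≠ timeChange DY σY (TY ω) t) :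
    Tendsto (fun h => covariance (absReturn (timeChangedProcess WX DX σX TX) h s)
        (absReturn (timeChangedProcess WY DY σY TY) h t) P / h) (𝓝[>] 0)
      (𝓝 (4 * σX * σY * √(DX * DY) / Real.pi
        * covariance (fun ω => (s - lastPoint (TX ω) s) ^ (DX - 1 / 2))
          (fun ω => (t - lastPoint (TY ω) t) ^ (DY - 1 / 2)) P)) := by
  set κ : ℝ → Ω → ENNReal := fun h ω => ∫⁻ ω', ENNReal.ofReal
      (|WX (timeChange DX σX (TX ω) (s + h)).toNNReal ω'
          - WX (timeChange DX σX (TX ω) s).toNNReal ω'| *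
        |WY (timeChange DY σY (TY ω) (t + h)).toNNReal ω'
          - WY (timeChange DY σY (TY ω) t).toNNReal ω'|) ∂P with hκ
  have hfreeze := fun h => model.lintegral_increments s t h
    (F := fun p => ENNReal.ofReal (|p.1| * |p.2|)) (by fun_prop)
  have hδ := model.hasMeanSlope_X hs
  have hε := model.hasMeanSlope_Y ht
  have hXs := model.ae_isShockSet_X
  have hYs := model.ae_isShockSet_Y
  have hDX := model.exponent_X.1
  have hDY := model.exponent_Y.1
  have hle : ∀ h, 0 < h → ∀ᵐ ω ∂P, κ h ω ≤ ENNReal.ofReal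
      ((timeChange DX σX (TX ω) (s + h) - timeChange DX σX (TX ω) s)
        + (timeChange DY σY (TY ω) (t + h) - timeChange DY σY (TY ω) t)) := by
    intro h hh
    filter_upwards [hXs, hYs] with ω h1 h2
    have := IsPreBrownianReal.lintegral_abs_mul_abs_increments_le
      model.brownian_X.toIsPreBrownianReal model.brownian_W'.toIsPreBrownianReal
      model.brownian_indep model.corr
      (h1.toNNReal_timeChange_le hDX model.scale_X hs hh)
      (h2.toNNReal_timeChange_le hDY model.scale_Y ht hh)
    rw [← model.brownian_Y, h1.coe_toNNReal_timeChange hDX model.scale_X hs,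
      h1.coe_toNNReal_timeChange hDX model.scale_X (by linarith),
      h2.coe_toNNReal_timeChange hDY model.scale_Y ht,
      h2.coe_toNNReal_timeChange hDY model.scale_Y (by linarith)] at this
    exact this
  have key := tendsto_covariance_abs_div (K := fun h ω => (κ h ω).toReal) hδ hε
    (fun h hh => model.hasMixedGaussianMoments_X hs hh)
    (fun h hh => model.hasMixedGaussianMoments_Y ht hh)
    (fun h => (hfreeze h).2.2.2.ennreal_toReal.aestronglyMeasurable)
    (fun h ω => ENNReal.toReal_nonneg) ?_ ?_ ?_
  · have hX0 : (fun ω => √((σX * √(2 * DX) * (s - lastPoint (TX ω) s) ^ (DX - 1 / 2)) ^ 2))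
        =ᵐ[P] fun ω => σX * √(2 * DX) * (s - lastPoint (TX ω) s) ^ (DX - 1 / 2) := by
      filter_upwards [hXs] with ω hω
      have hpos : 0 < s - lastPoint (TX ω) s := sub_pos.2 (hω.isGreatest_lastPoint hs).1.2
      have := model.scale_X
      exact Real.sqrt_sq (by positivity)
    have hY0 : (fun ω => √((σY * √(2 * DY) * (t - lastPoint (TY ω) t) ^ (DY - 1 / 2)) ^ 2))
        =ᵐ[P] fun ω => σY * √(2 * DY) * (t - lastPoint (TY ω) t) ^ (DY - 1 / 2) := by
      filter_upwards [hYs] with ω hω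
      have hpos : 0 < t - lastPoint (TY ω) t := sub_pos.2 (hω.isGreatest_lastPoint ht).1.2
      have := model.scale_Y
      exact Real.sqrt_sq (by positivity)
    rw [covariance_congr_ae hX0 hY0, covariance_const_mul_left, covariance_const_mul_right] at key
    -- The factor `4` is the Gaussian `2` times `√2 · √2` from the two slopes.
    have hc : 4 * σX * σY * √(DX * DY) / Real.pi
        = 2 / Real.pi * ((σX * √(2 * DX)) * (σY * √(2 * DY))) := by
      rw [Real.sqrt_mul zero_le_two, Real.sqrt_mul zero_le_two, Real.sqrt_mul hDX.le]
      linear_combination (-2 / Real.pi * σX * σY * √DX * √DY) * Real.mul_self_sqrt zero_le_two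
    rw [hc, mul_assoc, mul_assoc]
    exact key
  · intro h hh
    have hX := (model.hasMixedGaussianMoments_X hs hh).aemeasurable
    have hY := (model.hasMixedGaussianMoments_Y ht hh).aemeasurable
    have hE : ∫ ω, (κ h ω).toReal ∂P = (∫⁻ ω, κ h ω ∂P).toReal := by
      refine integral_toReal (hfreeze h).2.2.2.aemeasurable ?_
      filter_upwards [hle h hh] with ω h1 using h1.trans_lt ENNReal.ofReal_lt_top
    rw [hE]
    exact (integral_eq_lintegral_of_nonneg_ae
      (Eventually.of_forall fun ω => mul_nonneg (abs_nonneg _) (abs_nonneg _))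
      (hX.abs.mul hY.abs).aestronglyMeasurable).trans (congrArg ENNReal.toReal (hfreeze h).1)
  · intro h hh
    filter_upwards [hle h hh, hδ.nonneg, hε.nonneg] with ω h1 h2 h3
    exact ENNReal.toReal_le_of_le_ofReal (add_nonneg (h2 h hh) (h3 h hh)) h1
  -- The time changes are right continuous at `s` and `t`, so intervals starting at distinct
  -- operational times are disjoint for small `h`.
  · have hsep : ρ = 0 ∨ ∀ᵐ ω ∂P, ∀ᶠ h in 𝓝[>] (0 : ℝ),
        timeChange DX σX (TX ω) (s + h) ≤ timeChange DY σY (TY ω) t ∨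
        timeChange DY σY (TY ω) (t + h) ≤ timeChange DX σX (TX ω) s := by
      refine hne.imp_right fun hne => ?_
      filter_upwards [hne, hXs, hYs, model.isPoissonPair.fst.ae_notMem s,
        model.isPoissonPair.snd.ae_notMem t] with ω h1 h2 h3 h4 h5
      rcases h1.lt_or_gt with h6 | h6
      · filter_upwards [(h2.tendsto_timeChange_right hDX σX hs h4).eventually_lt_const h6]
          with h h7 using Or.inl h7.le
      · filter_upwards [(h3.tendsto_timeChange_right hDY σY ht h5).eventually_lt_const h6]
          with h h7 using Or.inr h7.le
    have hsep' : ∀ᵐ ω ∂P, ∀ᶠ h in 𝓝[>] (0 : ℝ), ρ = 0 ∨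
        timeChange DX σX (TX ω) (s + h) ≤ timeChange DY σY (TY ω) t ∨
        timeChange DY σY (TY ω) (t + h) ≤ timeChange DX σX (TX ω) s := by
      rcases hsep with h0 | h0
      · exact Eventually.of_forall fun ω => Eventually.of_forall fun h => Or.inl h0
      · filter_upwards [h0] with ω h1
        filter_upwards [h1] with h h2 using Or.inr h2
    filter_upwards [hsep', hXs, hYs] with ω h0 h1 h2
    filter_upwards [h0, self_mem_nhdsWithin] with h h3 (hh : 0 < h)
    have := IsPreBrownianReal.lintegral_abs_mul_abs_increments model.measurable_X
      model.measurable_W' model.brownian_X.toIsPreBrownianReal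
      model.brownian_W'.toIsPreBrownianReal model.brownian_indep model.corr
      (h1.toNNReal_timeChange_le hDX model.scale_X hs hh)
      (h2.toNNReal_timeChange_le hDY model.scale_Y ht hh)
      (h3.imp_right (Or.imp Real.toNNReal_le_toNNReal Real.toNNReal_le_toNNReal))
    rw [← model.brownian_Y, h1.coe_toNNReal_timeChange hDX model.scale_X hs,
      h1.coe_toNNReal_timeChange hDX model.scale_X (by linarith),
      h2.coe_toNNReal_timeChange hDY model.scale_Y ht,
      h2.coe_toNNReal_timeChange hDY model.scale_Y (by linarith)] at this
    change (κ h ω).toReal = _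
    rw [hκ]
    simp only
    rw [this, ENNReal.toReal_ofReal (by positivity)]

end IsBivariateModel

end

/-! ### The limit of the covariances. -/

theorem theorem3p1 {Ω : Type*} [MeasurableSpace Ω] (P : Measure Ω) [IsProbabilityMeasure P]
    (T : Fin 3 → Ω → Set ℝ) (TX TY : Ω → Set ℝ) (l : Fin 3 → ℝ≥0)
    (WX W' WY : ℝ≥0 → Ω → ℝ) (ρ DX DY σX σY : ℝ)
    (model : IsBivariateModel P T TX TY l WX W' WY ρ DX DY σX σY)
    (X Y : ℝ → Ω → ℝ) (hX : X = timeChangedProcess WX DX σX TX)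
    (hY : Y = timeChangedProcess WY DY σY TY)
    (s t : ℝ) (hs : 0 ≤ s) (hst : s ≤ t)
    (hρ : ρ = 0 ∨ (s < t ∧ ¬ (DX = 1 / 2 ∧ DY = 1 / 2 ∧ σX ^ 2 * s = σY ^ 2 * t)))
    (A B : Ω → ℝ) (hA : A = fun ω => (-shock (TX ω) 0) ^ (DX - 1 / 2))
    (hB : B = fun ω => (t - s - shock (TY ω) 0) ^ (DY - 1 / 2))
    (L : ℝ) (hL : L = 4 * σX * σY * √(DX * DY) / Real.pi
      * covariance A B P * Real.exp (-((l 0 + l 2 : ℝ≥0) : ℝ) * (t - s))) :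
    (∀ h r : ℝ, 0 < h → 0 ≤ r → MemLp (absReturn X h r) 2 P ∧ MemLp (absReturn Y h r) 2 P) ∧
    MemLp A 2 P ∧ MemLp B 2 P ∧
    Tendsto (fun h => covariance (absReturn X h s) (absReturn Y h t) P / h) (𝓝[>] 0) (𝓝 L) ∧
    Tendsto (fun h => covariance (absReturn X h 0) (absReturn Y h (t - s)) P / h)
      (𝓝[>] 0) (𝓝 L) := by
  have hpair := model.isPoissonPair
  have hDX := model.exponent_X
  have hDY := model.exponent_Y
  have hu : 0 ≤ t - s := sub_nonneg.2 hst
  have hA' : A = fun ω => (0 - lastPoint (TX ω) 0) ^ (DX - 1 / 2) := by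
    simp_rw [zero_sub]
    exact hA
  have hB' : B = fun ω => (t - s - lastPoint (TY ω) 0) ^ (DY - 1 / 2) := hB
  have hAL : MemLp A 2 P := hA' ▸ hpair.fst.memLp_sub_lastPoint_rpow model.rate_X 0 hDX.1 hDX.2
  have hBL : MemLp B 2 P := by
    -- The exponent is nonpositive and `t - s ≥ 0`, so lengthening the age by `t - s` only decreases
    -- the power.
    refine (hpair.snd.memLp_sub_lastPoint_rpow model.rate_Y 0 hDY.1 hDY.2).mono ?_ ?_
    · rw [hB']
      exact (((hpair.right.measurable_lastPoint 0).const_sub _).pow_const _).aestronglyMeasurable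
    · filter_upwards [model.ae_isShockSet_Y] with ω hω
      have hpos : 0 < 0 - lastPoint (TY ω) 0 := sub_pos.2 (hω.isGreatest_lastPoint le_rfl).1.2
      rw [hB', Real.norm_of_nonneg (Real.rpow_nonneg (by linarith) _),
        Real.norm_of_nonneg (Real.rpow_nonneg hpos.le _)]
      exact Real.rpow_le_rpow_of_nonpos hpos (by linarith) (by linarith [hDY.2])
  have hdecay := hpair.covariance_age_decay hu (hA' ▸ hAL) (hB' ▸ hBL)
    (hpair.snd.memLp_sub_lastPoint_rpow model.rate_Y (t - s) hDY.1 hDY.2)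
  rw [← hA', ← hB'] at hdecay
  have hshift := hpair.covariance_age_shift model.rate_X model.rate_Y (DX - 1 / 2) (DY - 1 / 2) s t
  rw [← hA'] at hshift
  have hne : ρ = 0 ∨ ∀ᵐ ω ∂P, timeChange DX σX (TX ω) s ≠ timeChange DY σY (TY ω) t :=
    hρ.imp_right fun h => hpair.ae_timeChange_ne model.rate_X model.rate_Y hDX hDY model.scale_X
      model.scale_Y hs h.1 h.2
  have hne0 : ρ = 0 ∨ ∀ᵐ ω ∂P, timeChange DX σX (TX ω) 0 ≠ timeChange DY σY (TY ω) (t - s) := by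
    refine hρ.imp_right fun h => hpair.ae_timeChange_ne model.rate_X model.rate_Y hDX hDY
      model.scale_X model.scale_Y le_rfl (sub_pos.2 h.1) fun h' => ?_
    -- At the instants `0` and `t - s` the excluded equality would read `0 = σY² (t - s)`,
    -- impossible for `s < t`.
    have h1 := mul_pos (pow_pos model.scale_Y 2) (sub_pos.2 h.1)
    rw [mul_zero] at h'
    exact h1.ne h'.2.2
  have h1 := model.tendsto_covariance_absReturn_div hs (hs.trans hst) hne
  have h2 := model.tendsto_covariance_absReturn_div le_rfl hu hne0
  rw [hshift, hdecay, ← mul_assoc, ← hL] at h1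
  rw [← hA', hdecay, ← mul_assoc, ← hL] at h2
  subst hX hY
  exact ⟨fun h r hh hr => ⟨(model.hasMixedGaussianMoments_X hr hh).memLp_abs
      ((model.hasMeanSlope_X hr).integrable hh), (model.hasMixedGaussianMoments_Y hr hh).memLp_abs
      ((model.hasMeanSlope_Y hr).integrable hh)⟩, hAL, hBL, h1, h2⟩
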